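/- **Setting.** Let $V$ be a finite dimensional complex vector space, $W\subset GL(V)$ a finite subgroup, $\Gamma\subset V$ a lattice (discrete, of full rank) preserved by $W$, and $X=V/\Gamma$. A reflection is a nontrivial semisimple $g\in GL(V)$ fixing a hyperplane pointwise; a reflection hypertorus is a (codimension one) connected component of $X^g$ for a reflection $g\in W$; $X_{\rm reg}$ is the complement of the reflection hypertori. For a reflection hypertorus $H$ let $W_H$ be the (cyclic) stabilizer of a generic point of $H$, $n_H=|W_H|$, let $g_H\in W_H$ be the element with $\det g_H=e^{2\pi i/n_H}$, and let $V_H^*\subset V^*$ be the line of linear forms vanishing on $V^{g_H}$. Let $\mathcal S$ be the set of pairs $(H,j)$ with $1\le j\le n_H-1$, and $C:\mathcal S\to\mathbb C$ a function invariant under $w(H,j)=(wH,j)$. For an antilinear form $\alpha$ on $V$ let $\mathcal L_\alpha$ be the topologically trivial line bundle on $X$ whose sections are the functions on (open subsets of) $V$ with $s(z+\gamma)=\chi_\alpha(\gamma)s(z)$, $\chi_\alpha(\gamma)=e^{2\pi i\,{\rm Im}\,\alpha(\gamma)}$, $\gamma\in\Gamma$; put $\mathcal L_\alpha^w=\mathcal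 L_{w\alpha}$, where $(w\alpha)(v)=\alpha(w^{-1}v)$. Fix $\mathcal L=\mathcal L_\alpha$ such that $(\mathcal L^w)^*\otimes\mathcal L$ is nontrivial for all $w\ne1$ (equivalently, $\alpha-w\alpha$ is not in $\Gamma^\vee=\{\beta:\ {\rm Im}\,\beta(\Gamma)\subset\mathbb Z\}$), and a flat holomorphic connection $\nabla$ on $\mathcal L$; denote also by $\nabla$ the connections obtained from it on the bundles $\mathcal L^w$ and $(\mathcal L^*)^w=(\mathcal L^w)^*$. For $(H,j)\in\mathcal S$ and $M=\mathcal L^w$, $w\in W$, let $f^{M}_{H,j}$ be the unique global meromorphic section of $(M^{g_H^j})^*\otimes M\otimes V_H^*$ with a simple pole on $H$, no other singularities, and residue $1$ on $H$ (at the points of $H$, which are fixed by $g_H^j$, the fibres of $M^{g_H^j}$ and $M$ are canonically identified). Let $W\ltimes D_{X_{\rm reg}}$ be the sheaf of algebras on $X/W$ generated by $W$ and by the differential operators on $X$ with poles on the reflection hypertori. Let $H_{c,X,W}\subset W\ltimes D_{X_{\rm reg}}$, with $c(H,j)=\frac12(e^{-2\pi ij/n_H}-1)C(H,j)$, be the sheaf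 of elliptic Cherednik algebras: on the preimage $U\subset X$ of a small open set of $X/W$ it is generated by $\mathcal O(U)$, $W$ and the operators $$D_{v,\phi}=\partial_v-\sum_{(H,j)\in\mathcal S}C(H,j)\langle\phi_H,v\rangle g_H^j,\qquad v\in V,$$ where $\phi=(\phi_H)$ is a collection of 1-forms on $U$, $\phi_H$ being holomorphic off $H$ and locally near $H$ of the form $d\log\ell_H+\phi'_H$, with $\ell_H$ holomorphic with a simple zero along $H$ and $\phi'_H$ holomorphic. Category $\mathcal O$ is the category of representations of $H_{c,X,W}$ on coherent sheaves on $X$. **Statement.** Let $\mathcal F=\bigoplus_{w\in W}(\mathcal L^*)^w$. There is a unique representation $\rho=\rho_{\mathcal L,\nabla}$ of the sheaf of algebras $W\ltimes D_{X_{\rm reg}}$ on the local sections of $\mathcal F$ with poles on the reflection hypertori such that, for a section $\beta$ of $(\mathcal L^*)^w$, $$\rho(f)\beta=f\beta,\qquad (\rho(g)\beta)(x)=\beta(g^{-1}x)\ \ (\text{a section of }(\mathcal L^*)^{gw}),$$ $$\rho(\partial_v)\beta=\nabla_v\beta+\sum_{(H,j)\in\mathcal S}C(H,j)\,\langle f^{\mathcal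 L^w}_{H,j},v\rangle\,\beta$$ for functions $f$, $g\in W$ and $v\in V$, where the term of $(H,j)$ is a section of $(\mathcal L^*)^{g_H^jw}$. The restriction of $\rho$ to $H_{c,X,W}$ preserves holomorphic sections of $\mathcal F$, and so is a representation of $H_{c,X,W}$ on $\mathcal F$, in which holomorphic functions act by multiplication. The sheaf $\mathcal F$ is coherent, so that this representation belongs to category $\mathcal O$. -/

import Mathlib

open TopologicalSpace Topology Filter

set_option linter.unusedSectionVars false

universe u

noncomputable section

/-- A finite group `W ⊂ GL(V)` together with a lattice `Γ ⊂ V` (discrete, of full rank) which is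
preserved by `W`. -/
structure TorusAction (V : Type u) [NormedAddCommGroup V] [NormedSpace ℂ V] where
  Γ : Submodule ℤ V
  discrete : DiscreteTopology Γ
  isLattice : IsZLattice ℝ Γ
  W : Subgroup (V ≃ₗ[ℂ] V)
  finite : Finite W
  stable : ∀ w ∈ W, ∀ γ ∈ Γ, w γ ∈ Γ

namespace TorusAction

attribute [instance] TorusAction.discrete TorusAction.isLattice TorusAction.finite

variable {V : Type u} [NormedAddCommGroup V] [NormedSpace ℂ V] (T : TorusAction V)

/-! ### The torus, the orbifold quotient, reflection hypertori -/

/-- The complex torus `X = V / Γ`. -/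
def X : Type u := V ⧸ T.Γ

instance : TopologicalSpace T.X := inferInstanceAs (TopologicalSpace (V ⧸ T.Γ))

/-- The projection `V → X`. -/
def proj (z : V) : T.X := (Submodule.Quotient.mk z : V ⧸ T.Γ)

theorem proj_surjective : Function.Surjective T.proj := Submodule.Quotient.mk_surjective T.Γ

theorem continuous_proj : Continuous T.proj := continuous_quotient_mk'

theorem proj_eq_iff {z z' : V} : T.proj z = T.proj z' ↔ z - z' ∈ T.Γ :=
  Submodule.Quotient.eq T.Γ

theorem smul_mem (w : T.W) {γ : V} (h : γ ∈ T.Γ) : w • γ ∈ T.Γ := T.stable w.1 w.2 γ h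

/-- The action of `W` on `X` induced by its action on `V`. -/
instance : MulAction T.W T.X where
  smul w := Quotient.lift (fun z : V => T.proj (w • z)) (fun a b h => by
    have h' : a - b ∈ T.Γ := (Submodule.quotientRel_def T.Γ).1 h
    rw [T.proj_eq_iff, ← smul_sub]
    exact T.smul_mem w h')
  one_smul x := by
    obtain ⟨z, rfl⟩ := T.proj_surjective x
    change T.proj ((1 : T.W) • z) = _
    rw [one_smul]
  mul_smul a b x := by
    obtain ⟨z, rfl⟩ := T.proj_surjective x
    change T.proj ((a * b) • z) = T.proj (a • b • z)
    rw [mul_smul]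

theorem proj_smul (w : T.W) (z : V) : T.proj (w • z) = w • T.proj z := rfl

/-- The quotient space `X / W`. -/
def Y : Type u := MulAction.orbitRel.Quotient T.W T.X

instance : TopologicalSpace T.Y :=
  inferInstanceAs (TopologicalSpace (Quotient (MulAction.orbitRel T.W T.X)))

/-- The projection `X → X / W`. -/
def toY (x : T.X) : T.Y := Quotient.mk (MulAction.orbitRel T.W T.X) x

theorem continuous_toY : Continuous T.toY := continuous_quotient_mk'

theorem toY_smul (w : T.W) (x : T.X) : T.toY (w • x) = T.toY x :=
  Quotient.sound (s := MulAction.orbitRel T.W T.X) ⟨w, rfl⟩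

/-- The preimage in `X` of an open subset of `X / W`. -/
def pre (U : Opens T.Y) : Opens T.X := ⟨T.toY ⁻¹' U, U.isOpen.preimage T.continuous_toY⟩

theorem pre_mono {U U' : Opens T.Y} (h : U' ≤ U) : T.pre U' ≤ T.pre U := fun _ hx => h hx

/-- A (complex) reflection: a nontrivial semisimple linear automorphism fixing a hyperplane
pointwise. -/
def IsReflection (g : V ≃ₗ[ℂ] V) : Prop :=
  g ≠ 1 ∧ Module.End.IsSemisimple (g : V →ₗ[ℂ] V) ∧
    ∃ P : Submodule ℂ V, IsCoatom P ∧ ∀ v ∈ P, g v = v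

/-- A reflection hypertorus: a connected component of the fixed locus `X ^ g` of a reflection
`g ∈ W`. (For a reflection `g`, the preimage of `X ^ g` in `V` is a locally finite union of translates
of the hyperplane `V ^ g`, so every component of `X ^ g` has codimension `1`.) -/
def IsHypertorus (H : Set T.X) : Prop :=
  ∃ g : T.W, IsReflection g.1 ∧ ∃ x ∈ MulAction.fixedBy T.X g,
    H = connectedComponentIn (MulAction.fixedBy T.X g) x

/-- The type of reflection hypertori. -/
def Hypertorus : Type u := {H : Set T.X // T.IsHypertorus H}

/-- `X_reg`, the complement of the reflection hypertori. -/
def reg : Set T.X := {x | ∀ H : T.Hypertorus, x ∉ H.1}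

/-- `W_H`: the stabilizer of a generic point of `H`, i.e. the pointwise stabilizer of `H`. -/
def stab (H : T.Hypertorus) : Subgroup T.W := fixingSubgroup T.W H.1

/-- `n_H = |W_H|`. -/
def ord (H : T.Hypertorus) : ℕ := Nat.card (T.stab H)

open scoped Classical in
/-- `g_H`: the element of `W_H` with determinant `exp (2 π i / n_H)`. It exists and is unique, since
the determinant identifies `W_H` with the group of `n_H`-th roots of unity. -/
def gen (H : T.Hypertorus) : T.W :=
  if h : ∃ g ∈ T.stab H, LinearMap.det (g.1 : V →ₗ[ℂ] V) =
      Complex.exp (2 * Real.pi * Complex.I / T.ord H)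
  then h.choose else 1

/-- The set `𝒮` of pairs `(H, j)`, `H` a reflection hypertorus and `1 ≤ j ≤ n_H - 1`. -/
structure Pairs where
  H : T.Hypertorus
  j : ℕ
  one_le : 1 ≤ j
  lt_ord : j < T.ord H

/-- The group element `g_H ^ j` attached to `(H, j) ∈ 𝒮`. -/
def refl (p : T.Pairs) : T.W := T.gen p.H ^ p.j

/-- `C : 𝒮 → ℂ` is `W`-invariant, where `w (H, j) = (w H, j)`. -/
def IsInvariant (C : T.Pairs → ℂ) : Prop :=
  ∀ (p q : T.Pairs) (w : T.W), q.H.1 = (fun x => w • x) '' p.H.1 → q.j = p.j → C q = C p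

/-! Finiteness of `𝒮`, openness and invariance of `X_reg` -/

theorem continuous_smulV [FiniteDimensional ℂ V] (w : T.W) : Continuous fun z : V => w • z :=
  LinearMap.continuous_of_finiteDimensional (w.1 : V →ₗ[ℂ] V)

theorem analytic_smulV [FiniteDimensional ℂ V] (w : T.W) (z : V) :
    AnalyticAt ℂ (fun z : V => w • z) z :=
  (LinearMap.toContinuousLinearMap (w.1 : V →ₗ[ℂ] V)).analyticAt z

theorem isClosed_lattice : IsClosed (T.Γ : Set V) :=
  @AddSubgroup.isClosed_of_discrete V _ _ _ _ T.Γ.toAddSubgroup T.discrete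

theorem mem_fixedBy_proj (g : T.W) (z : V) :
    T.proj z ∈ MulAction.fixedBy T.X g ↔ g • z - z ∈ T.Γ := by
  rw [MulAction.mem_fixedBy, ← proj_smul, proj_eq_iff]

theorem mem_reg_iff (x : T.X) :
    x ∈ T.reg ↔ ∀ g : T.W, IsReflection g.1 → x ∉ MulAction.fixedBy T.X g := by
  constructor
  · intro h g hg hx
    exact h ⟨_, g, hg, x, hx, rfl⟩ (mem_connectedComponentIn hx)
  · rintro h ⟨H, g, hg, y, hy, rfl⟩ hx
    exact h g hg (connectedComponentIn_subset _ _ hx)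

theorem isReflection_conj {g h : T.W} (hg : IsReflection g.1) :
    IsReflection (h * g * h⁻¹ : T.W).1 := by
  obtain ⟨h1, -, P, hP, hP'⟩ := hg
  have hne : h * g * h⁻¹ ≠ 1 := by
    intro e
    apply h1
    have : g = 1 := by simpa [mul_inv_eq_one] using e
    rw [this]; rfl
  refine ⟨fun e => hne (Subtype.ext e), ?_, P.map (h.1 : V →ₗ[ℂ] V), ?_, ?_⟩
  · have hfin : IsOfFinOrder (h * g * h⁻¹) := isOfFinOrder_of_finite _
    obtain ⟨n, hn, hpow⟩ := hfin.exists_pow_eq_one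
    refine Module.End.isSemisimple_of_squarefree_aeval_eq_zero
      (p := Polynomial.X ^ n - Polynomial.C 1) ?_ ?_
    · apply Polynomial.Separable.squarefree
      exact Polynomial.separable_X_pow_sub_C _ (by exact_mod_cast hn.ne') one_ne_zero
    · have h3 : ((h * g * h⁻¹ : T.W).1 : V →ₗ[ℂ] V) ^ n = 1 := by
        have h4 : (h * g * h⁻¹ : T.W).1 ^ n = 1 := by
          have := congrArg Subtype.val hpow
          simpa using this
        ext v
        have h5 := congrArg (fun e : V ≃ₗ[ℂ] V => e v) h4
        rw [Module.End.pow_apply]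
        have h6 : ∀ (m : ℕ) (e : V ≃ₗ[ℂ] V) (v : V), (e ^ m) v = (e : V →ₗ[ℂ] V)^[m] v := by
          intro m e
          induction m with
          | zero => intro v; rfl
          | succ k ih => intro v; rw [pow_succ, LinearEquiv.mul_apply, ih]; rfl
        rw [← h6]; exact h5
      rw [map_sub, map_pow, Polynomial.aeval_X, Polynomial.aeval_C, h3, map_one, sub_self]
  · exact (Submodule.orderIsoMapComap h.1).isCoatom_iff P |>.2 hP
  · rintro v ⟨u, hu, rfl⟩
    change (h * g * h⁻¹) • (h • u) = h • u
    rw [mul_smul, inv_smul_smul, mul_smul]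
    congr 1
    exact hP' u hu

theorem smul_mem_reg {x : T.X} (w : T.W) : w • x ∈ T.reg ↔ x ∈ T.reg := by
  have key : ∀ (x : T.X) (w : T.W), x ∈ T.reg → w • x ∈ T.reg := by
    intro x w h
    rw [mem_reg_iff] at h ⊢
    intro g hg hx
    refine h (w⁻¹ * g * w⁻¹⁻¹) (T.isReflection_conj hg) ?_
    rw [MulAction.mem_fixedBy] at hx ⊢
    rw [inv_inv, mul_smul, mul_smul, hx, inv_smul_smul]
  refine ⟨fun h => ?_, key x w⟩
  simpa using key _ w⁻¹ h

theorem isOpen_reg_preimage [FiniteDimensional ℂ V] : IsOpen (T.proj ⁻¹' T.reg) := by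
  have : T.proj ⁻¹' T.reg =
      ⋂ g : T.W, {z : V | IsReflection g.1 → g • z - z ∉ T.Γ} := by
    ext z
    simp only [Set.mem_preimage, mem_reg_iff, mem_fixedBy_proj, Set.mem_iInter, Set.mem_ofPred_eq]
  rw [this]
  refine isOpen_iInter_of_finite fun g => ?_
  by_cases hg : IsReflection g.1
  · simp only [hg, true_imp_iff]
    exact (T.isClosed_lattice.preimage ((T.continuous_smulV g).sub continuous_id)).isOpen_compl
  · simp [hg]

theorem finite_hypertori [FiniteDimensional ℂ V] : {H : Set T.X | T.IsHypertorus H}.Finite := by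
  classical
  let b : Module.Basis _ ℝ V := (Module.Free.chooseBasis ℤ T.Γ).ofZLatticeBasis ℝ T.Γ
  have hb : Submodule.span ℤ (Set.range b) = T.Γ := Module.Basis.ofZLatticeBasis_span ℝ T.Γ _
  let M : ℝ := ∑ i, ‖b i‖
  have hred : ∀ x : T.X, ∃ z : V, ‖z‖ ≤ M ∧ T.proj z = x := by
    intro x
    obtain ⟨z, rfl⟩ := T.proj_surjective x
    refine ⟨ZSpan.fract b z, ZSpan.norm_fract_le b z, ?_⟩
    rw [proj_eq_iff, ZSpan.fract_apply, sub_sub_cancel_left]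
    exact neg_mem (hb.le (ZSpan.floor b z).2)
  have : ProperSpace V := FiniteDimensional.proper ℂ V
  let B : T.W → Set V := fun g => ((fun z : V => g • z - z) '' Metric.closedBall 0 M) ∩ T.Γ
  have hB : ∀ g, (B g).Finite := by
    intro g
    have hc : IsCompact ((fun z : V => g • z - z) '' Metric.closedBall 0 M) :=
      (isCompact_closedBall 0 M).image ((T.continuous_smulV g).sub continuous_id)
    exact Metric.finite_isBounded_inter_isClosed
      ⟨T.discrete⟩ hc.isBounded T.isClosed_lattice
  let F : T.W → V → Set T.X := fun g γ =>
    if h : ∃ z : V, g • z - z = γ then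
      connectedComponentIn (MulAction.fixedBy T.X g) (T.proj h.choose) else ∅
  refine (Set.finite_iUnion fun g => (hB g).image (F g)).subset ?_
  rintro H ⟨g, hg, x, hx, rfl⟩
  obtain ⟨z, hz, rfl⟩ := hred x
  have hγ : g • z - z ∈ T.Γ := (T.mem_fixedBy_proj g z).1 hx
  refine Set.mem_iUnion.2 ⟨g, g • z - z, ⟨⟨z, by simpa using hz, rfl⟩, hγ⟩, ?_⟩
  have hex : ∃ z' : V, g • z' - z' = g • z - z := ⟨z, rfl⟩
  change (if h : _ then _ else _) = _
  rw [dif_pos hex]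
  have hsp := hex.choose_spec
  set z' := hex.choose
  let A : Set V := {u : V | g • u - u = g • z - z}
  have hA : Convex ℝ A := by
    intro u hu v hv s t _ _ hst
    have e : g • (s • u + t • v) = s • g • u + t • g • v := by
      change g.1 (s • u + t • v) = s • g.1 u + t • g.1 v
      rw [map_add, ← Complex.coe_smul, ← Complex.coe_smul t v, map_smul, map_smul]
      rfl
    have hu' : g • u - u = g • z - z := hu
    have hv' : g • v - v = g • z - z := hv
    change g • (s • u + t • v) - (s • u + t • v) = g • z - z
    rw [e]
    calc s • g • u + t • g • v - (s • u + t • v)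
        = s • (g • u - u) + t • (g • v - v) := by rw [smul_sub, smul_sub]; abel
      _ = g • z - z := by rw [hu', hv', ← add_smul, hst, one_smul]
  have hpre : IsPreconnected (T.proj '' A) :=
    hA.isPreconnected.image _ T.continuous_proj.continuousOn
  have hsub : T.proj '' A ⊆ MulAction.fixedBy T.X g := by
    rintro _ ⟨u, hu, rfl⟩
    rw [mem_fixedBy_proj]
    have hu' : g • u - u = g • z - z := hu
    rw [hu']; exact hγ
  exact connectedComponentIn_eq
    (hpre.subset_connectedComponentIn ⟨z', hsp, rfl⟩ hsub ⟨z, rfl, rfl⟩)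

instance [FiniteDimensional ℂ V] : Finite T.Hypertorus := T.finite_hypertori.to_subtype

instance [FiniteDimensional ℂ V] : Finite T.Pairs := by
  let f : T.Pairs → (Σ H : T.Hypertorus, Fin (T.ord H)) := fun p => ⟨p.H, p.j, p.lt_ord⟩
  refine Finite.of_injective f ?_
  rintro ⟨H, j, h1, h2⟩ ⟨H', j', h1', h2'⟩ h
  obtain ⟨rfl, h⟩ := Sigma.mk.inj h
  have : j = j' := congrArg Fin.val (eq_of_heq h)
  subst this
  rfl

instance [FiniteDimensional ℂ V] : Fintype T.Pairs := Fintype.ofFinite _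

/-! ### Line bundles, holomorphic and meromorphic sections -/

/-- The space `V^∨` of antilinear forms on `V`. -/
abbrev AntiDual (V : Type u) [NormedAddCommGroup V] [NormedSpace ℂ V] : Type u :=
  V →ₛₗ[starRingEnd ℂ] ℂ

/-- The multiplier `χ_α(γ) = exp (2 π i Im α(γ))` of the line bundle `L_α`. -/
def mult (α : AntiDual V) (v : V) : ℂ :=
  Complex.exp (2 * Real.pi * Complex.I * ((α v).im : ℂ))

theorem mult_zero_left (v : V) : mult (0 : AntiDual V) v = 1 := by simp [mult]

theorem mult_add_left (α β : AntiDual V) (v : V) : mult (α + β) v = mult α v * mult β v := by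
  rw [mult, mult, mult, ← Complex.exp_add]
  congr 1
  simp only [LinearMap.add_apply, Complex.add_im, Complex.ofReal_add]
  ring

/-- The dual lattice `Γ^∨ = {α | Im α(Γ) ⊂ ℤ}`, so that `X^∨ = V^∨ / Γ^∨`. -/
def dualLattice : AddSubgroup (AntiDual V) where
  carrier := {α | ∀ γ ∈ T.Γ, ∃ n : ℤ, (α γ).im = n}
  zero_mem' γ _ := ⟨0, by simp⟩
  add_mem' {a b} ha hb γ hγ := by
    obtain ⟨n, hn⟩ := ha γ hγ
    obtain ⟨m, hm⟩ := hb γ hγ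
    exact ⟨n + m, by simp [hn, hm]⟩
  neg_mem' {a} ha γ hγ := by
    obtain ⟨n, hn⟩ := ha γ hγ
    exact ⟨-n, by simp [hn]⟩

/-- The dual action of `W` on `V^∨`, `(w α)(v) = α (w⁻¹ v)`; thus `L_α ^ w = L_{w α}`. -/
def dualAct (w : T.W) (α : AntiDual V) : AntiDual V :=
  α.comp ((w⁻¹).1 : V →ₗ[ℂ] V)

/-- The point of `X^∨` represented by `α` has trivial stabilizer in `W`, i.e. the line bundle
`(L_α ^ w)^* ⊗ L_α = L_{α - w α}` is nontrivial for every `w ≠ 1`. -/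
def HasTrivialStabilizer (α : AntiDual V) : Prop :=
  ∀ w : T.W, w ≠ 1 → α - T.dualAct w α ∉ T.dualLattice

/-- The preimage in `V` of an open subset of `X`. -/
def lift (U : Opens T.X) : Set V := T.proj ⁻¹' U

/-- The preimage in `V` of `U ∩ X_reg`. -/
def regLift (U : Opens T.X) : Set V := {z | T.proj z ∈ U ∧ T.proj z ∈ T.reg}

theorem isOpen_lift (U : Opens T.X) : IsOpen (T.lift U) := U.isOpen.preimage T.continuous_proj

theorem isOpen_regLift [FiniteDimensional ℂ V] (U : Opens T.X) : IsOpen (T.regLift U) :=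
  (T.isOpen_lift U).inter T.isOpen_reg_preimage

theorem lift_mono {U U' : Opens T.X} (h : U' ≤ U) : T.lift U' ⊆ T.lift U := fun _ hz => h hz

theorem regLift_mono {U U' : Opens T.X} (h : U' ≤ U) : T.regLift U' ⊆ T.regLift U :=
  fun _ hz => ⟨h hz.1, hz.2⟩

theorem regLift_subset (U : Opens T.X) : T.regLift U ⊆ T.lift U := fun _ hz => hz.1

theorem smul_mem_lift {U : Opens T.Y} (w : T.W) {z : V} (hz : z ∈ T.lift (T.pre U)) :
    w • z ∈ T.lift (T.pre U) := by
  change T.toY (w • T.proj z) ∈ U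
  rw [toY_smul]; exact hz

theorem smul_mem_regLift {U : Opens T.Y} (w : T.W) {z : V} (hz : z ∈ T.regLift (T.pre U)) :
    w • z ∈ T.regLift (T.pre U) :=
  ⟨T.smul_mem_lift w hz.1, (T.smul_mem_reg w).2 hz.2⟩

/-- Restriction of functions to a smaller set. -/
def restr {Ω Ω' : Set V} (h : Ω' ⊆ Ω) (s : Ω → ℂ) : Ω' → ℂ := fun z => s ⟨z, h z.2⟩

/-- Extension of a function by zero (used only near points of its domain). -/
def ext {Ω : Set V} (s : Ω → ℂ) : V → ℂ := Function.extend Subtype.val s 0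

/-- `s` is holomorphic on the open set `Ω ⊂ V`. -/
def IsHol {Ω : Set V} (s : Ω → ℂ) : Prop := AnalyticOnNhd ℂ (ext s) Ω

/-- `s` has multiplier `χ_α`: `s (z + γ) = χ_α(γ) s(z)` for `γ ∈ Γ`. -/
def HasMult (α : AntiDual V) {Ω : Set V} (s : Ω → ℂ) : Prop :=
  ∀ z z' : Ω, (z' - z : V) ∈ T.Γ → s z' = mult α (z' - z : V) * s z

/-- `s` is a holomorphic section of `L_α` over `U` (pulled back to `V`). -/
structure IsHolSection (α : AntiDual V) (U : Opens T.X) (s : T.lift U → ℂ) : Prop where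
  hol : IsHol s
  mult : T.HasMult α s

/-- `s` is a section of `L_α` over `U` with poles on the reflection hypertori: it is holomorphic
on `U ∩ X_reg`, and near each point of `U` it is a quotient `t / h` of holomorphic functions with
`h` vanishing at most on the reflection hypertori. -/
structure IsMerSection (α : AntiDual V) (U : Opens T.X) (s : T.regLift U → ℂ) : Prop where
  hol : IsHol s
  mult : T.HasMult α s
  mer : ∀ z₀ ∈ T.lift U, ∃ h t : V → ℂ, AnalyticAt ℂ h z₀ ∧ AnalyticAt ℂ t z₀ ∧
    ∀ᶠ z in 𝓝 z₀, ∀ hz : z ∈ T.regLift U, h z ≠ 0 ∧ h z * s ⟨z, hz⟩ = t z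

section closure

variable {Ω Ω' : Set V}

theorem ext_apply (s : Ω → ℂ) (z : Ω) : ext s z = s z :=
  Subtype.val_injective.extend_apply s 0 z

theorem ext_apply_mem (s : Ω → ℂ) {z : V} (hz : z ∈ Ω) : ext s z = s ⟨z, hz⟩ :=
  ext_apply s ⟨z, hz⟩

theorem isHol_of (hΩ : IsOpen Ω) {s : Ω → ℂ} {S : V → ℂ} (hS : AnalyticOnNhd ℂ S Ω)
    (h : ∀ z : Ω, s z = S z) : IsHol s := by
  intro z hz
  refine (hS z hz).congr ?_
  filter_upwards [hΩ.mem_nhds hz] with y hy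
  rw [ext_apply_mem s hy, h]

theorem IsHol.restr (hΩ' : IsOpen Ω') (h : Ω' ⊆ Ω) {s : Ω → ℂ} (hs : IsHol s) :
    IsHol (restr h s) :=
  isHol_of hΩ' (fun z hz => hs z (h hz)) fun z => (ext_apply_mem s (h z.2)).symm

theorem IsHol.add (hΩ : IsOpen Ω) {s t : Ω → ℂ} (hs : IsHol s) (ht : IsHol t) : IsHol (s + t) :=
  isHol_of hΩ (AnalyticOnNhd.add hs ht) fun z => by simp [ext_apply]

theorem IsHol.mul (hΩ : IsOpen Ω) {s t : Ω → ℂ} (hs : IsHol s) (ht : IsHol t) : IsHol (s * t) :=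
  isHol_of hΩ (AnalyticOnNhd.mul hs ht) fun z => by simp [ext_apply]

theorem isHol_const (hΩ : IsOpen Ω) (c : ℂ) : IsHol (fun _ : Ω => c) :=
  isHol_of hΩ (S := fun _ => c) (fun _ _ => analyticAt_const) fun _ => rfl

variable {T}

theorem IsHolSection.add {α : AntiDual V} {U : Opens T.X} {s t : T.lift U → ℂ}
    (hs : T.IsHolSection α U s) (ht : T.IsHolSection α U t) : T.IsHolSection α U (s + t) where
  hol := hs.hol.add (T.isOpen_lift U) ht.hol
  mult z z' h := by
    simp only [Pi.add_apply, hs.mult z z' h, ht.mult z z' h]; ring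

theorem IsHolSection.mul {α β : AntiDual V} {U : Opens T.X} {s t : T.lift U → ℂ}
    (hs : T.IsHolSection α U s) (ht : T.IsHolSection β U t) :
    T.IsHolSection (α + β) U (s * t) where
  hol := hs.hol.mul (T.isOpen_lift U) ht.hol
  mult z z' h := by
    simp only [Pi.mul_apply, hs.mult z z' h, ht.mult z z' h, mult_add_left]; ring

theorem isHolSection_zero {α : AntiDual V} {U : Opens T.X} : T.IsHolSection α U 0 where
  hol := isHol_const (T.isOpen_lift U) 0
  mult z z' h := by simp

theorem isHolSection_const {U : Opens T.X} (c : ℂ) : T.IsHolSection 0 U (fun _ => c) where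
  hol := isHol_const (T.isOpen_lift U) c
  mult z z' h := by simp [mult_zero_left]

theorem IsHolSection.restr {α : AntiDual V} {U U' : Opens T.X} (h : U' ≤ U) {s : T.lift U → ℂ}
    (hs : T.IsHolSection α U s) : T.IsHolSection α U' (restr (T.lift_mono h) s) where
  hol := hs.hol.restr (T.isOpen_lift U') _
  mult z z' hz := hs.mult ⟨z, T.lift_mono h z.2⟩ ⟨z', T.lift_mono h z'.2⟩ hz

variable [FiniteDimensional ℂ V]

theorem IsMerSection.add {α : AntiDual V} {U : Opens T.X} {s t : T.regLift U → ℂ}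
    (hs : T.IsMerSection α U s) (ht : T.IsMerSection α U t) : T.IsMerSection α U (s + t) where
  hol := hs.hol.add (T.isOpen_regLift U) ht.hol
  mult z z' h := by
    simp only [Pi.add_apply, hs.mult z z' h, ht.mult z z' h]; ring
  mer z₀ hz₀ := by
    obtain ⟨h, a, hh, ha, H⟩ := hs.mer z₀ hz₀
    obtain ⟨k, b, hk, hb, K⟩ := ht.mer z₀ hz₀
    refine ⟨fun z => h z * k z, fun z => k z * a z + h z * b z, hh.mul hk,
      (hk.mul ha).add (hh.mul hb), ?_⟩
    filter_upwards [H, K] with z Hz Kz hz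
    obtain ⟨h1, h2⟩ := Hz hz
    obtain ⟨k1, k2⟩ := Kz hz
    refine ⟨mul_ne_zero h1 k1, ?_⟩
    rw [← h2, ← k2, Pi.add_apply]; ring

theorem IsMerSection.mul {α β : AntiDual V} {U : Opens T.X} {s t : T.regLift U → ℂ}
    (hs : T.IsMerSection α U s) (ht : T.IsMerSection β U t) :
    T.IsMerSection (α + β) U (s * t) where
  hol := hs.hol.mul (T.isOpen_regLift U) ht.hol
  mult z z' h := by
    simp only [Pi.mul_apply, hs.mult z z' h, ht.mult z z' h, mult_add_left]; ring
  mer z₀ hz₀ := by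
    obtain ⟨h, a, hh, ha, H⟩ := hs.mer z₀ hz₀
    obtain ⟨k, b, hk, hb, K⟩ := ht.mer z₀ hz₀
    refine ⟨fun z => h z * k z, fun z => a z * b z, hh.mul hk, ha.mul hb, ?_⟩
    filter_upwards [H, K] with z Hz Kz hz
    obtain ⟨h1, h2⟩ := Hz hz
    obtain ⟨k1, k2⟩ := Kz hz
    refine ⟨mul_ne_zero h1 k1, ?_⟩
    rw [← h2, ← k2, Pi.mul_apply]; ring

theorem IsHolSection.toMer {α : AntiDual V} {U : Opens T.X} {s : T.lift U → ℂ}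
    (hs : T.IsHolSection α U s) :
    T.IsMerSection α U (TorusAction.restr (T.regLift_subset U) s) where
  hol := hs.hol.restr (T.isOpen_regLift U) _
  mult z z' hz := hs.mult ⟨z, T.regLift_subset U z.2⟩ ⟨z', T.regLift_subset U z'.2⟩ hz
  mer z₀ hz₀ := ⟨fun _ => 1, ext s, analyticAt_const, hs.hol z₀ hz₀,
    Eventually.of_forall fun z hz =>
      ⟨one_ne_zero, by rw [one_mul, ext_apply_mem s hz.1]; rfl⟩⟩

theorem isMerSection_const {U : Opens T.X} (c : ℂ) : T.IsMerSection 0 U (fun _ => c) :=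
  (isHolSection_const c).toMer

theorem isMerSection_zero {α : AntiDual V} {U : Opens T.X} : T.IsMerSection α U 0 :=
  isHolSection_zero.toMer

theorem IsMerSection.restr {α : AntiDual V} {U U' : Opens T.X} (h : U' ≤ U)
    {s : T.regLift U → ℂ} (hs : T.IsMerSection α U s) :
    T.IsMerSection α U' (restr (T.regLift_mono h) s) where
  hol := hs.hol.restr (T.isOpen_regLift U') _
  mult z z' hz := hs.mult ⟨z, T.regLift_mono h z.2⟩ ⟨z', T.regLift_mono h z'.2⟩ hz
  mer z₀ hz₀ := by
    obtain ⟨k, a, hk, ha, H⟩ := hs.mer z₀ (h hz₀)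
    exact ⟨k, a, hk, ha, H.mono fun z Hz hz => Hz (T.regLift_mono h hz)⟩

theorem analyticAt_fderiv_apply {f : V → ℂ} {z : V} (hf : AnalyticAt ℂ f z) (v : V) :
    AnalyticAt ℂ (fun y => fderiv ℂ f y v) z :=
  ((ContinuousLinearMap.apply ℂ ℂ v).analyticAt (fderiv ℂ f z)).fun_comp hf.fderiv

/-- The partial derivative of a function along `v`. -/
def dv {Ω : Set V} (v : V) (s : Ω → ℂ) : Ω → ℂ := fun z => fderiv ℂ (ext s) z v

theorem IsMerSection.dv {α : AntiDual V} {U : Opens T.X} {s : T.regLift U → ℂ}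
    (hs : T.IsMerSection α U s) (v : V) : T.IsMerSection α U (dv v s) where
  hol := isHol_of (T.isOpen_regLift U) (S := fun z => fderiv ℂ (ext s) z v)
    (fun z hz => analyticAt_fderiv_apply (hs.hol z hz) v) fun _ => rfl
  mult z z' h := by
    have e : ∀ᶠ y in 𝓝 (z : V), ext s (y + (z' - z : V)) =
        TorusAction.mult α (z' - z : V) * ext s y := by
      have hc : Tendsto (fun y : V => y + (z' - z : V)) (𝓝 z) (𝓝 z') := by
        have : Continuous fun y : V => y + (z' - z : V) := by fun_prop
        simpa using this.tendsto (z : V)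
      filter_upwards [(T.isOpen_regLift U).mem_nhds z.2,
        hc ((T.isOpen_regLift U).mem_nhds z'.2)] with y hy hy'
      rw [ext_apply_mem s hy, ext_apply_mem s hy']
      have := hs.mult ⟨y, hy⟩ ⟨_, hy'⟩ (by simpa using h)
      simpa using this
    have e2 := Filter.EventuallyEq.fderiv_eq (𝕜 := ℂ) e
    rw [fderiv_comp_add_right, fderiv_const_mul (hs.hol z z.2).differentiableAt,
      add_sub_cancel] at e2
    simp only [TorusAction.dv, e2]
    rfl
  mer z₀ hz₀ := by
    obtain ⟨h, t, hh, ht, H⟩ := hs.mer z₀ hz₀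
    refine ⟨fun z => h z * h z, fun z => h z * fderiv ℂ t z v - fderiv ℂ h z v * t z,
      hh.mul hh, (hh.mul (analyticAt_fderiv_apply ht v)).sub
        ((analyticAt_fderiv_apply hh v).mul ht), ?_⟩
    filter_upwards [H.eventually_nhds, hh.eventually_analyticAt,
      ht.eventually_analyticAt] with z Hz hhz htz hz
    obtain ⟨h1, h2⟩ := Hz.self_of_nhds hz
    refine ⟨mul_ne_zero h1 h1, ?_⟩
    have e : (fun y => h y * ext s y) =ᶠ[𝓝 z] t := by
      filter_upwards [Hz, (T.isOpen_regLift U).mem_nhds hz] with y Hy hy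
      rw [ext_apply_mem s hy]
      exact (Hy hy).2
    have e2 := e.fderiv_eq (𝕜 := ℂ)
    rw [fderiv_fun_mul hhz.differentiableAt (hs.hol z hz).differentiableAt] at e2
    rw [← e2, ← h2, ← ext_apply_mem s hz]
    simp only [TorusAction.dv, add_apply, smul_apply, smul_eq_mul]
    ring

/-- The translate `(w s)(z) = s (w⁻¹ z)` of a function on a `W`-invariant set. -/
def translate {U : Opens T.Y} (w : T.W) (s : T.regLift (T.pre U) → ℂ) : T.regLift (T.pre U) → ℂ :=
  fun z => s ⟨w⁻¹ • (z : V), T.smul_mem_regLift w⁻¹ z.2⟩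

theorem IsMerSection.translate {U : Opens T.Y} {s : T.regLift (T.pre U) → ℂ}
    (hs : T.IsMerSection 0 (T.pre U) s) (w : T.W) :
    T.IsMerSection 0 (T.pre U) (translate w s) where
  hol := isHol_of (T.isOpen_regLift _) (S := fun z => ext s (w⁻¹ • z))
    (fun z hz => (hs.hol _ (T.smul_mem_regLift w⁻¹ hz)).fun_comp (T.analytic_smulV w⁻¹ z))
    fun z => (ext_apply_mem s _).symm
  mult z z' h := by
    have := hs.mult ⟨w⁻¹ • (z : V), T.smul_mem_regLift w⁻¹ z.2⟩
      ⟨w⁻¹ • (z' : V), T.smul_mem_regLift w⁻¹ z'.2⟩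
      (by simpa only [← smul_sub] using T.smul_mem w⁻¹ h)
    rw [mult_zero_left] at this ⊢
    exact this
  mer z₀ hz₀ := by
    obtain ⟨h, t, hh, ht, H⟩ := hs.mer (w⁻¹ • z₀) (T.smul_mem_lift w⁻¹ hz₀)
    refine ⟨fun z => h (w⁻¹ • z), fun z => t (w⁻¹ • z), hh.fun_comp (T.analytic_smulV w⁻¹ z₀),
      ht.fun_comp (T.analytic_smulV w⁻¹ z₀), ?_⟩
    filter_upwards [(T.continuous_smulV w⁻¹).continuousAt.eventually H] with z Hz hz
    exact Hz (T.smul_mem_regLift w⁻¹ hz)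

end closure

/-! ### The sheaves of algebras `𝒪_X`, `𝒪_X(*Δ)`, `W ⋉ D_{X_reg}` and `H_{c,X,W}` -/

/-- The algebra of holomorphic functions on `U ⊂ X` (as `Γ`-periodic functions on its preimage). -/
def O (U : Opens T.X) : Subalgebra ℂ (T.lift U → ℂ) where
  carrier := {s | T.IsHolSection 0 U s}
  mul_mem' hs ht := by simpa using IsHolSection.mul hs ht
  add_mem' hs ht := IsHolSection.add hs ht
  algebraMap_mem' c := isHolSection_const c

/-- Restriction of holomorphic functions. -/
def resO {U U' : Opens T.X} (h : U' ≤ U) (f : T.O U) : T.O U' :=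
  ⟨restr (T.lift_mono h) f.1, IsHolSection.restr h f.2⟩

/-- The holomorphic connection 1-forms of flat holomorphic connections on `L_α`. Since the
multipliers `χ_α(γ)` are constant, a holomorphic connection on `L_α` is `∇ = d + ξ` for a
holomorphic `Γ`-periodic 1-form `ξ` on `V`; it is flat if and only if `dξ = 0`. -/
structure FlatConnection where
  form : V → V →L[ℂ] ℂ
  hol : AnalyticOnNhd ℂ form Set.univ
  periodic : ∀ (z γ : V), γ ∈ T.Γ → form (z + γ) = form z
  flat : ∀ z u v : V, fderiv ℂ form z u v = fderiv ℂ form z v u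

variable {T} in
/-- The value at `z`, along `v`, of the connection form of the connection on `L ^ w` obtained by
transport of `∇` along `w`. -/
def FlatConnection.transport (ξ : T.FlatConnection) (w : T.W) (z v : V) : ℂ :=
  ξ.form (w⁻¹ • z) (w⁻¹ • v)

/-- Near `z₀ ∈ S`, the 1-form `η` has the shape `r d log ℓ + η'`, with `ℓ` holomorphic having a simple
zero along `S`, and `η'` holomorphic; in particular `η` has a simple pole on `S` with residue `r`. -/
def LogPoleAt (S : Set V) (r : ℂ) (η : V → V →L[ℂ] ℂ) (z₀ : V) : Prop :=
  ∃ (l : V → ℂ) (η' : V → V →L[ℂ] ℂ), AnalyticAt ℂ l z₀ ∧ fderiv ℂ l z₀ ≠ 0 ∧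
    (∀ᶠ z in 𝓝 z₀, z ∈ S ↔ l z = 0) ∧ AnalyticAt ℂ η' z₀ ∧
    ∀ᶠ z in 𝓝 z₀, z ∉ S → η z = (r / l z) • fderiv ℂ l z + η' z

/-- `φ` is a 1-form on `U` (only its values off `H` matter) which is holomorphic off `H` and is
locally near `H` of the form `d log ℓ_H + φ'_H`. -/
structure IsLogForm (U : Opens T.X) (H : T.Hypertorus) (φ : V → V →L[ℂ] ℂ) : Prop where
  hol : AnalyticOnNhd ℂ φ (T.lift U \ T.proj ⁻¹' H.1)
  periodic : ∀ z ∈ T.lift U, T.proj z ∉ H.1 → ∀ γ ∈ T.Γ, φ (z + γ) = φ z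
  log : ∀ z ∈ T.lift U, T.proj z ∈ H.1 → LogPoleAt (T.proj ⁻¹' H.1) 1 φ z

theorem IsLogForm.mono {T : TorusAction V} {U U' : Opens T.X} {H : T.Hypertorus}
    {φ : V → V →L[ℂ] ℂ} (hφ : T.IsLogForm U H φ) (h : U' ≤ U) : T.IsLogForm U' H φ where
  hol z hz := hφ.hol z ⟨h hz.1, hz.2⟩
  periodic z hz := hφ.periodic z (h hz)
  log z hz := hφ.log z (h hz)

variable [FiniteDimensional ℂ V]

/-- The algebra `𝒪(*Δ)(U)` of functions on `U` with poles on the reflection hypertori. -/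
def OD (U : Opens T.X) : Subalgebra ℂ (T.regLift U → ℂ) where
  carrier := {s | T.IsMerSection 0 U s}
  mul_mem' hs ht := by simpa using IsMerSection.mul hs ht
  add_mem' hs ht := IsMerSection.add hs ht
  algebraMap_mem' c := isMerSection_const c

/-- Restriction of functions with poles on the reflection hypertori. -/
def resOD {U U' : Opens T.X} (h : U' ≤ U) (f : T.OD U) : T.OD U' :=
  ⟨restr (T.regLift_mono h) f.1, IsMerSection.restr h f.2⟩

/-- The inclusion `𝒪(U) → 𝒪(*Δ)(U)`. -/
def toOD {U : Opens T.X} (f : T.O U) : T.OD U :=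
  ⟨restr (T.regLift_subset U) f.1, IsHolSection.toMer f.2⟩

/-- The coefficient `⟨φ, v⟩` of a 1-form `φ` on `U` with a logarithmic pole on `H`. -/
def coef {U : Opens T.X} {H : T.Hypertorus} {φ : V → V →L[ℂ] ℂ} (hφ : T.IsLogForm U H φ) (v : V) :
    T.OD U :=
  ⟨fun z => φ z v,
   { hol := isHol_of (T.isOpen_regLift U) (S := fun z => φ z v)
        (fun z hz => ((ContinuousLinearMap.apply ℂ ℂ v).analyticAt (φ z)).fun_comp
          (hφ.hol z ⟨hz.1, hz.2 H⟩)) fun _ => rfl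
     mult := fun z z' h => by
        have := hφ.periodic z z.2.1 (z.2.2 H) _ h
        rw [add_sub_cancel] at this
        simp [this, mult_zero_left]
     mer := fun z₀ hz₀ => by
        by_cases hH : T.proj z₀ ∈ H.1
        · obtain ⟨l, η', hl, -, hS, hη, he⟩ := hφ.log z₀ hz₀ hH
          refine ⟨l, fun z => fderiv ℂ l z v + l z * η' z v, hl,
            (analyticAt_fderiv_apply hl v).add (hl.mul
              (((ContinuousLinearMap.apply ℂ ℂ v).analyticAt (η' z₀)).fun_comp hη)), ?_⟩
          filter_upwards [hS, he] with z h1 h2 hz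
          have h3 : z ∉ T.proj ⁻¹' H.1 := hz.2 H
          have h4 : l z ≠ 0 := fun h => h3 (h1.2 h)
          refine ⟨h4, ?_⟩
          rw [h2 h3, add_apply, smul_apply, smul_eq_mul]
          field_simp
        · exact ⟨fun _ => 1, fun z => φ z v, analyticAt_const,
            ((ContinuousLinearMap.apply ℂ ℂ v).analyticAt (φ z₀)).fun_comp (hφ.hol z₀ ⟨hz₀, hH⟩),
            Eventually.of_forall fun z hz => ⟨one_ne_zero, one_mul _⟩⟩ }⟩

/-- The operator `∂_v` on `𝒪(*Δ)(U)`. -/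
def dOp (U : Opens T.X) (v : V) : Module.End ℂ (T.OD U) where
  toFun s := ⟨dv v s.1, IsMerSection.dv s.2 v⟩
  map_add' s t := by
    ext z
    have e : ext (s.1 + t.1) =ᶠ[𝓝 (z : V)] ext s.1 + ext t.1 := by
      filter_upwards [(T.isOpen_regLift U).mem_nhds z.2] with y hy
      simp only [Pi.add_apply, ext_apply_mem _ hy]
    change fderiv ℂ (ext (s.1 + t.1)) z v = fderiv ℂ (ext s.1) z v + fderiv ℂ (ext t.1) z v
    rw [e.fderiv_eq, fderiv_add (s.2.hol z z.2).differentiableAt (t.2.hol z z.2).differentiableAt]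
    rfl
  map_smul' c s := by
    ext z
    have e : ext (c • s.1) =ᶠ[𝓝 (z : V)] c • ext s.1 := by
      filter_upwards [(T.isOpen_regLift U).mem_nhds z.2] with y hy
      simp only [Pi.smul_apply, ext_apply_mem _ hy]
    change fderiv ℂ (ext (c • s.1)) z v = c • fderiv ℂ (ext s.1) z v
    rw [e.fderiv_eq, fderiv_const_smul (s.2.hol z z.2).differentiableAt]
    rfl

/-- The action `(w s)(z) = s (w⁻¹ z)` of `w ∈ W` on `𝒪(*Δ)(U)`, `U` being `W`-invariant. -/
def wOp (U : Opens T.Y) (w : T.W) : Module.End ℂ (T.OD (T.pre U)) where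
  toFun s := ⟨translate w s.1, IsMerSection.translate s.2 w⟩
  map_add' _ _ := rfl
  map_smul' _ _ := rfl

/-- Families of linear operators on `𝒪(*Δ)(U')`, where `U'` runs over all open subsets of `U ⊂ X / W`. -/
abbrev Fam (U : Opens T.Y) : Type u :=
  ∀ U' : Set.Iic U, Module.End ℂ (T.OD (T.pre U'.1))

/-- Restriction of families of operators. -/
def resFam {U U' : Opens T.Y} (h : U' ≤ U) : T.Fam U →ₐ[ℂ] T.Fam U' :=
  AlgHom.pi fun U'' => Pi.evalAlgHom ℂ _ (⟨U''.1, le_trans U''.2 h⟩ : Set.Iic U)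

/-- Multiplication by a function. -/
def mulFam {U : Opens T.Y} (f : T.OD (T.pre U)) : T.Fam U :=
  fun U' => LinearMap.mulLeft ℂ (T.resOD (T.pre_mono U'.2) f)

/-- The operator of `w ∈ W`. -/
def wFam (U : Opens T.Y) (w : T.W) : T.Fam U := fun U' => T.wOp U'.1 w

/-- The operator `∂_v`. -/
def dFam (U : Opens T.Y) (v : V) : T.Fam U := fun U' => T.dOp (T.pre U'.1) v

/-- The Dunkl-Opdam operator `D_{v,φ} = ∂_v - ∑ C(H,j) ⟨φ_H, v⟩ g_H ^ j`. -/
def dunklOpdam (C : T.Pairs → ℂ) {U : Opens T.Y} {φ : T.Hypertorus → V → V →L[ℂ] ℂ}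
    (hφ : ∀ H, T.IsLogForm (T.pre U) H (φ H)) (v : V) : T.Fam U :=
  T.dFam U v - ∑ p : T.Pairs, C p • (T.mulFam (T.coef (hφ p.H) v) * T.wFam U (T.refl p))

/-- A family of operators is a morphism of sheaves if it is compatible with restrictions. -/
def IsCompat {U : Opens T.Y} (D : T.Fam U) : Prop :=
  ∀ (U₁ U₂ : Set.Iic U) (h : U₂.1 ≤ U₁.1) (s : T.OD (T.pre U₁.1)),
    T.resOD (T.pre_mono h) (D U₁ s) = D U₂ (T.resOD (T.pre_mono h) s)

theorem resFam_adjoin {G : ∀ U : Opens T.Y, Set (T.Fam U)}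
    (hG : ∀ (U U' : Opens T.Y) (h : U' ≤ U), ∀ D ∈ G U, T.resFam h D ∈ G U')
    {U U' : Opens T.Y} (h : U' ≤ U) {D : T.Fam U} (hD : D ∈ Algebra.adjoin ℂ (G U)) :
    T.resFam h D ∈ Algebra.adjoin ℂ (G U') := by
  have h1 : T.resFam h D ∈ (Algebra.adjoin ℂ (G U)).map (T.resFam h) := ⟨D, hD, rfl⟩
  rw [AlgHom.map_adjoin] at h1
  refine Algebra.adjoin_mono ?_ h1
  rintro _ ⟨E, hE, rfl⟩
  exact hG U U' h E hE

/-- The sheaf of algebras on `X / W`, inside the sheaf of `ℂ`-linear endomorphisms of `𝒪(*Δ)`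
(pushed forward to `X / W`), which is locally generated by `G`: its sections over `U` are the
endomorphisms which near each point of `U` belong to the algebra generated by `G`. -/
def locGen (G : ∀ U : Opens T.Y, Set (T.Fam U))
    (hG : ∀ (U U' : Opens T.Y) (h : U' ≤ U), ∀ D ∈ G U, T.resFam h D ∈ G U') (U : Opens T.Y) :
    Subalgebra ℂ (T.Fam U) where
  carrier := {D | T.IsCompat D ∧ ∀ y ∈ U, ∃ (U' : Opens T.Y) (h : U' ≤ U), y ∈ U' ∧
    T.resFam h D ∈ Algebra.adjoin ℂ (G U')}
  mul_mem' := by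
    rintro D E ⟨hD, hD'⟩ ⟨hE, hE'⟩
    refine ⟨fun U₁ U₂ h s => ?_, fun y hy => ?_⟩
    · change T.resOD (T.pre_mono h) (D U₁ (E U₁ s)) = D U₂ (E U₂ _)
      rw [hD U₁ U₂ h, hE U₁ U₂ h]
    · obtain ⟨U₁, h₁, hy₁, H₁⟩ := hD' y hy
      obtain ⟨U₂, h₂, hy₂, H₂⟩ := hE' y hy
      refine ⟨U₁ ⊓ U₂, inf_le_left.trans h₁, ⟨hy₁, hy₂⟩, ?_⟩
      rw [map_mul]
      exact mul_mem (T.resFam_adjoin hG inf_le_left H₁) (T.resFam_adjoin hG inf_le_right H₂)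
  add_mem' := by
    rintro D E ⟨hD, hD'⟩ ⟨hE, hE'⟩
    refine ⟨fun U₁ U₂ h s => ?_, fun y hy => ?_⟩
    · change T.resOD (T.pre_mono h) (D U₁ s) + T.resOD (T.pre_mono h) (E U₁ s) = D U₂ _ + E U₂ _
      rw [hD U₁ U₂ h, hE U₁ U₂ h]
    · obtain ⟨U₁, h₁, hy₁, H₁⟩ := hD' y hy
      obtain ⟨U₂, h₂, hy₂, H₂⟩ := hE' y hy
      refine ⟨U₁ ⊓ U₂, inf_le_left.trans h₁, ⟨hy₁, hy₂⟩, ?_⟩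
      rw [map_add]
      exact add_mem (T.resFam_adjoin hG inf_le_left H₁) (T.resFam_adjoin hG inf_le_right H₂)
  algebraMap_mem' c :=
    ⟨fun U₁ U₂ h s => rfl, fun y hy => ⟨U, le_rfl, hy, by
      rw [AlgHom.commutes]; exact Subalgebra.algebraMap_mem _ c⟩⟩

theorem mem_locGen {G : ∀ U : Opens T.Y, Set (T.Fam U)}
    {hG : ∀ (U U' : Opens T.Y) (h : U' ≤ U), ∀ D ∈ G U, T.resFam h D ∈ G U'} {U : Opens T.Y}
    {D : T.Fam U} (hc : T.IsCompat D) (hD : D ∈ G U) : D ∈ T.locGen G hG U :=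
  ⟨hc, fun _ hy => ⟨U, le_rfl, hy, T.resFam_adjoin hG le_rfl (Algebra.subset_adjoin hD)⟩⟩

theorem resFam_mem_locGen {G : ∀ U : Opens T.Y, Set (T.Fam U)}
    {hG : ∀ (U U' : Opens T.Y) (h : U' ≤ U), ∀ D ∈ G U, T.resFam h D ∈ G U'} {U U' : Opens T.Y}
    (h : U' ≤ U) {D : T.Fam U} (hD : D ∈ T.locGen G hG U) : T.resFam h D ∈ T.locGen G hG U' :=
  ⟨fun U₁ U₂ h' s => hD.1 ⟨U₁.1, U₁.2.trans h⟩ ⟨U₂.1, U₂.2.trans h⟩ h' s, fun y hy => by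
    obtain ⟨U₁, h₁, hy₁, H₁⟩ := hD.2 y (h hy)
    exact ⟨U₁ ⊓ U', inf_le_right, ⟨hy₁, hy⟩, T.resFam_adjoin hG inf_le_left H₁⟩⟩

theorem isCompat_mulFam {U : Opens T.Y} (f : T.OD (T.pre U)) : T.IsCompat (T.mulFam f) :=
  fun _ _ _ _ => rfl

theorem isCompat_wFam (U : Opens T.Y) (w : T.W) : T.IsCompat (T.wFam U w) :=
  fun _ _ _ _ => rfl

theorem isCompat_dFam (U : Opens T.Y) (v : V) : T.IsCompat (T.dFam U v) := by
  intro U₁ U₂ h s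
  ext z
  have e : ext (T.resOD (T.pre_mono h) s).1 =ᶠ[𝓝 (z : V)] ext s.1 := by
    filter_upwards [(T.isOpen_regLift (T.pre U₂.1)).mem_nhds z.2] with y hy
    rw [ext_apply_mem _ hy, ext_apply_mem _ (T.regLift_mono (T.pre_mono h) hy)]
    rfl
  change fderiv ℂ (ext s.1) z v = fderiv ℂ (ext (T.resOD (T.pre_mono h) s).1) z v
  rw [e.fderiv_eq]

theorem isCompat_dunklOpdam (C : T.Pairs → ℂ) {U : Opens T.Y}
    {φ : T.Hypertorus → V → V →L[ℂ] ℂ} (hφ : ∀ H, T.IsLogForm (T.pre U) H (φ H)) (v : V) :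
    T.IsCompat (T.dunklOpdam C hφ v) := by
  intro U₁ U₂ h s
  have hd := T.isCompat_dFam U v U₁ U₂ h s
  simp only [dunklOpdam, Pi.sub_apply, Finset.sum_apply, LinearMap.sub_apply,
    LinearMap.sum_apply]
  rw [← hd]
  let R : T.OD (T.pre U₁.1) →+ T.OD (T.pre U₂.1) :=
    { toFun := T.resOD (T.pre_mono h), map_zero' := rfl, map_add' := fun _ _ => rfl }
  change R _ = R _ - _
  rw [map_sub, map_sum]
  rfl

theorem resFam_dunklOpdam (C : T.Pairs → ℂ) {U U' : Opens T.Y} (h : U' ≤ U)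
    {φ : T.Hypertorus → V → V →L[ℂ] ℂ} (hφ : ∀ H, T.IsLogForm (T.pre U) H (φ H)) (v : V) :
    T.resFam h (T.dunklOpdam C hφ v) =
      T.dunklOpdam C (fun H => (hφ H).mono (T.pre_mono h)) v := by
  funext U''
  change T.dunklOpdam C hφ v ⟨U''.1, U''.2.trans h⟩ = _
  simp only [dunklOpdam, Pi.sub_apply, Finset.sum_apply]
  rfl

/-- Generators of `W ⋉ D_{X_reg}`: functions with poles on the reflection hypertori, elements of `W`,
and the vector fields `∂_v`. -/
def genWD (U : Opens T.Y) : Set (T.Fam U) :=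
  {D | (∃ f, D = T.mulFam f) ∨ (∃ w, D = T.wFam U w) ∨ ∃ v, D = T.dFam U v}

/-- Generators of `H_{c,X,W}`: holomorphic functions, elements of `W`, Dunkl-Opdam operators. -/
def genH (C : T.Pairs → ℂ) (U : Opens T.Y) : Set (T.Fam U) :=
  {D | (∃ f : T.O (T.pre U), D = T.mulFam (T.toOD f)) ∨ (∃ w, D = T.wFam U w) ∨
    ∃ (φ : T.Hypertorus → V → V →L[ℂ] ℂ) (hφ : ∀ H, T.IsLogForm (T.pre U) H (φ H)) (v : V),
      D = T.dunklOpdam C hφ v}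

/-- The sheaf `W ⋉ D_{X_reg}` on `X / W`, where `D_{X_reg}` is the sheaf of differential operators on
`X` with poles on the reflection hypertori. -/
def WD (U : Opens T.Y) : Subalgebra ℂ (T.Fam U) :=
  T.locGen T.genWD (by
    rintro U U' h _ (⟨f, rfl⟩ | ⟨w, rfl⟩ | ⟨v, rfl⟩)
    · exact Or.inl ⟨T.resOD (T.pre_mono h) f, rfl⟩
    · exact Or.inr (Or.inl ⟨w, rfl⟩)
    · exact Or.inr (Or.inr ⟨v, rfl⟩)) U

/-- The sheaf `H_{c,X,W}` of elliptic Cherednik algebras on `X / W`, where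
`c(H,j) = (exp (-2 π i j / n_H) - 1) C(H,j) / 2`. -/
def Cherednik (C : T.Pairs → ℂ) (U : Opens T.Y) : Subalgebra ℂ (T.Fam U) :=
  T.locGen (T.genH C) (by
    rintro U U' h _ (⟨f, rfl⟩ | ⟨w, rfl⟩ | ⟨φ, hφ, v, rfl⟩)
    · exact Or.inl ⟨T.resO (T.pre_mono h) f, rfl⟩
    · exact Or.inr (Or.inl ⟨w, rfl⟩)
    · exact Or.inr (Or.inr ⟨φ, fun H => (hφ H).mono (T.pre_mono h), v,
        T.resFam_dunklOpdam C h hφ v⟩)) U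

theorem cherednik_le (C : T.Pairs → ℂ) (U : Opens T.Y) : T.Cherednik C U ≤ T.WD U := by
  rintro D ⟨hc, hD⟩
  refine ⟨hc, fun y hy => ?_⟩
  obtain ⟨U', h, hy', H⟩ := hD y hy
  refine ⟨U', h, hy', ?_⟩
  have hle : Algebra.adjoin ℂ (T.genH C U') ≤ Algebra.adjoin ℂ (T.genWD U') := by
    refine Algebra.adjoin_le ?_
    rintro _ (⟨f, rfl⟩ | ⟨w, rfl⟩ | ⟨φ, hφ, v, rfl⟩)
    · exact Algebra.subset_adjoin (Or.inl ⟨_, rfl⟩)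
    · exact Algebra.subset_adjoin (Or.inr (Or.inl ⟨w, rfl⟩))
    · have h1 : T.dFam U' v ∈ T.genWD U' := Or.inr (Or.inr ⟨v, rfl⟩)
      have h2 : ∀ p : T.Pairs, T.mulFam (T.coef (hφ p.H) v) ∈ T.genWD U' :=
        fun p => Or.inl ⟨_, rfl⟩
      have h3 : ∀ w : T.W, T.wFam U' w ∈ T.genWD U' := fun w => Or.inr (Or.inl ⟨w, rfl⟩)
      exact Subalgebra.sub_mem (Algebra.adjoin ℂ (T.genWD U')) (Algebra.subset_adjoin h1)
        (sum_mem fun p _ => Subalgebra.smul_mem _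
          (mul_mem (Algebra.subset_adjoin (h2 p)) (Algebra.subset_adjoin (h3 _))) _)
  exact hle H

/-- The inclusion `H_{c,X,W} ⊂ W ⋉ D_{X_reg}`. -/
def inclWD (C : T.Pairs → ℂ) (U : Opens T.Y) : T.Cherednik C U →ₐ[ℂ] T.WD U :=
  Subalgebra.inclusion (T.cherednik_le C U)

/-- Restriction for `W ⋉ D_{X_reg}`. -/
def resWD {U U' : Opens T.Y} (h : U' ≤ U) (D : T.WD U) : T.WD U' :=
  ⟨T.resFam h D.1, T.resFam_mem_locGen h D.2⟩

/-- Restriction for `H_{c,X,W}`. -/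
def resCherednik (C : T.Pairs → ℂ) {U U' : Opens T.Y} (h : U' ≤ U) (D : T.Cherednik C U) :
    T.Cherednik C U' :=
  ⟨T.resFam h D.1, T.resFam_mem_locGen h D.2⟩

/-- A function with poles on the reflection hypertori, as a section of `W ⋉ D_{X_reg}`. -/
def funWD {U : Opens T.Y} (f : T.OD (T.pre U)) : T.WD U :=
  ⟨T.mulFam f, T.mem_locGen (T.isCompat_mulFam f) (Or.inl ⟨f, rfl⟩)⟩

/-- An element of `W`, as a section of `W ⋉ D_{X_reg}`. -/
def grpWD (U : Opens T.Y) (w : T.W) : T.WD U :=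
  ⟨T.wFam U w, T.mem_locGen (T.isCompat_wFam U w) (Or.inr (Or.inl ⟨w, rfl⟩))⟩

/-- The vector field `∂_v`, as a section of `W ⋉ D_{X_reg}`. -/
def vecWD (U : Opens T.Y) (v : V) : T.WD U :=
  ⟨T.dFam U v, T.mem_locGen (T.isCompat_dFam U v) (Or.inr (Or.inr ⟨v, rfl⟩))⟩

/-- A holomorphic function, as a section of `H_{c,X,W}`. -/
def funCherednik (C : T.Pairs → ℂ) {U : Opens T.Y} (f : T.O (T.pre U)) : T.Cherednik C U :=
  ⟨T.mulFam (T.toOD f), T.mem_locGen (T.isCompat_mulFam _) (Or.inl ⟨f, rfl⟩)⟩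

/-! ### Coherent sheaves on `X` and category `𝒪` -/

/-- A sheaf of `𝒪_X`-modules on `X`. -/
structure OXModule where
  sec : Opens T.X → Type u
  [grp : ∀ U, AddCommGroup (sec U)]
  [mod : ∀ U, Module (T.O U) (sec U)]
  res : ∀ {U U' : Opens T.X}, U' ≤ U → sec U →+ sec U'
  res_self : ∀ (U : Opens T.X) (s : sec U), res le_rfl s = s
  res_res : ∀ {U U' U'' : Opens T.X} (h : U' ≤ U) (h' : U'' ≤ U') (s : sec U),
    res h' (res h s) = res (h'.trans h) s
  res_smul : ∀ {U U' : Opens T.X} (h : U' ≤ U) (f : T.O U) (s : sec U),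
    res h (f • s) = T.resO h f • res h s
  separated : ∀ (U : Opens T.X) (𝒰 : Set (Opens T.X)) (hle : ∀ U' ∈ 𝒰, U' ≤ U),
    (∀ x ∈ U, ∃ U' ∈ 𝒰, x ∈ U') → ∀ s t : sec U,
      (∀ U' (hU' : U' ∈ 𝒰), res (hle U' hU') s = res (hle U' hU') t) → s = t
  glue : ∀ (U : Opens T.X) (𝒰 : Set (Opens T.X)) (hle : ∀ U' ∈ 𝒰, U' ≤ U),
    (∀ x ∈ U, ∃ U' ∈ 𝒰, x ∈ U') → ∀ s : (∀ U' ∈ 𝒰, sec U'),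
      (∀ U₁ h₁ U₂ h₂, res (inf_le_left : U₁ ⊓ U₂ ≤ U₁) (s U₁ h₁) =
        res (inf_le_right : U₁ ⊓ U₂ ≤ U₂) (s U₂ h₂)) →
      ∃ t : sec U, ∀ U' (hU' : U' ∈ 𝒰), res (hle U' hU') t = s U' hU'

attribute [instance] OXModule.grp OXModule.mod

variable {T} in
/-- A sheaf of `𝒪_X`-modules on the complex manifold `X` is coherent if every point has an open
neighbourhood `U` with an exact sequence of sheaves `𝒪_U^m → 𝒪_U^n → F|_U → 0`. Here the second map is
given by the sections `e i`, and the first one by the matrix `r`. -/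
def OXModule.IsCoherent (F : T.OXModule) : Prop :=
  ∀ x : T.X, ∃ U : Opens T.X, x ∈ U ∧ ∃ (m n : ℕ) (e : Fin n → F.sec U)
    (r : Fin m → Fin n → T.O U),
    (∀ k, ∑ i, r k i • e i = 0) ∧
    (∀ (U' : Opens T.X) (h : U' ≤ U) (s : F.sec U'), ∀ y ∈ U',
      ∃ (U'' : Opens T.X) (h' : U'' ≤ U'), y ∈ U'' ∧ ∃ a : Fin n → T.O U'',
        F.res h' s = ∑ i, a i • F.res (h'.trans h) (e i)) ∧
    (∀ (U' : Opens T.X) (h : U' ≤ U) (a : Fin n → T.O U'),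
      ∑ i, a i • F.res h (e i) = 0 → ∀ y ∈ U',
      ∃ (U'' : Opens T.X) (h' : U'' ≤ U'), y ∈ U'' ∧ ∃ b : Fin m → T.O U'',
        ∀ i, T.resO h' (a i) = ∑ k, b k * T.resO (h'.trans h) (r k i))

/-- A representation of the sheaf of algebras `H_{c,X,W}` on a sheaf `F` of `𝒪_X`-modules: compatible
actions of the algebras of sections over `U ⊂ X / W` on the sections of `F` over the preimage of
`U`, which extend the given action of holomorphic functions. -/
structure CherednikAction (C : T.Pairs → ℂ) (F : T.OXModule) where
  act : ∀ U : Opens T.Y, T.Cherednik C U →+* AddMonoid.End (F.sec (T.pre U))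
  act_res : ∀ {U U' : Opens T.Y} (h : U' ≤ U) (D : T.Cherednik C U) (s : F.sec (T.pre U)),
    F.res (T.pre_mono h) (act U D s) = act U' (T.resCherednik C h D) (F.res (T.pre_mono h) s)
  act_fun : ∀ (U : Opens T.Y) (f : T.O (T.pre U)) (s : F.sec (T.pre U)),
    act U (T.funCherednik C f) s = f • s

variable {T} in
/-- Category `𝒪` consists of the representations of `H_{c,X,W}` on coherent sheaves on `X`. -/
def CherednikAction.InCategoryO {C : T.Pairs → ℂ} {F : T.OXModule}
    (_ : T.CherednikAction C F) : Prop :=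
  F.IsCoherent

/-! ### The sheaf `F = ⨁_w (L^*) ^ w` and the representation `ρ` -/

/-- Sections over `U` of `⨁_w (L^*) ^ w`, where `L = L_α`, so that `(L^*) ^ w = L_{w (-α)}`. -/
def holF (α : AntiDual V) (U : Opens T.X) : Submodule (T.O U) (T.W → T.lift U → ℂ) where
  carrier := {β | ∀ w, T.IsHolSection (T.dualAct w (-α)) U (β w)}
  zero_mem' _ := isHolSection_zero
  add_mem' hs ht w := (hs w).add (ht w)
  smul_mem' f β hβ w := by
    have h := IsHolSection.mul f.2 (hβ w)
    rw [zero_add] at h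
    exact h

/-- Sections over `U` of `⨁_w (L^*) ^ w` with poles on the reflection hypertori. -/
def merF (α : AntiDual V) (U : Opens T.X) : Submodule ℂ (T.W → T.regLift U → ℂ) where
  carrier := {β | ∀ w, T.IsMerSection (T.dualAct w (-α)) U (β w)}
  zero_mem' _ := isMerSection_zero
  add_mem' hs ht w := (hs w).add (ht w)
  smul_mem' c β hβ w := by
    have h := IsMerSection.mul (isMerSection_const c) (hβ w)
    rw [zero_add] at h
    exact h

/-- The coherent sheaf `F = ⨁_w (L^*) ^ w` on `X`. -/
def sheafF (α : AntiDual V) : T.OXModule where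
  sec U := T.holF α U
  res {U U'} h :=
    { toFun := fun β => ⟨fun w => restr (T.lift_mono h) (β.1 w), fun w => (β.2 w).restr h⟩
      map_zero' := rfl
      map_add' := fun _ _ => rfl }
  res_self _ _ := rfl
  res_res _ _ _ := rfl
  res_smul _ _ _ := rfl
  separated U 𝒰 hle hcov s t H := by
    refine Subtype.ext (funext fun w => funext fun z => ?_)
    obtain ⟨U', hU', hz⟩ := hcov (T.proj z) z.2
    have h1 := congrArg Subtype.val (H U' hU')
    exact congrFun (congrFun h1 w) ⟨z, hz⟩
  glue U 𝒰 hle hcov s H := by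
    choose N hN hzN using hcov
    have key : ∀ (U₁ : Opens T.X) (h₁ : U₁ ∈ 𝒰) (U₂ : Opens T.X) (h₂ : U₂ ∈ 𝒰) (w : T.W) (z : V)
        (hz₁ : z ∈ T.lift U₁) (hz₂ : z ∈ T.lift U₂),
        (s U₁ h₁).1 w ⟨z, hz₁⟩ = (s U₂ h₂).1 w ⟨z, hz₂⟩ := by
      intro U₁ h₁ U₂ h₂ w z hz₁ hz₂
      have h1 := congrArg Subtype.val (H U₁ h₁ U₂ h₂)
      exact congrFun (congrFun h1 w) ⟨z, hz₁, hz₂⟩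
    let t : T.W → T.lift U → ℂ := fun w z =>
      (s (N (T.proj z) z.2) (hN _ z.2)).1 w ⟨z, hzN _ z.2⟩
    have ht : ∀ (U₁ : Opens T.X) (h₁ : U₁ ∈ 𝒰) (w : T.W) (z : V) (hz : z ∈ T.lift U)
        (hz₁ : z ∈ T.lift U₁), t w ⟨z, hz⟩ = (s U₁ h₁).1 w ⟨z, hz₁⟩ :=
      fun U₁ h₁ w z hz hz₁ => key _ _ U₁ h₁ w z _ hz₁
    refine ⟨⟨t, fun w => ⟨fun z hz => ?_, fun z z' h => ?_⟩⟩, fun U' hU' => ?_⟩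
    · have h1 := hN (T.proj z) hz
      have h2 : z ∈ T.lift (N (T.proj z) hz) := hzN (T.proj z) hz
      refine (((s _ h1).2 w).hol z h2).congr ?_
      filter_upwards [(T.isOpen_lift _).mem_nhds h2, (T.isOpen_lift U).mem_nhds hz] with y hy hy'
      rw [ext_apply_mem _ hy, ext_apply_mem _ hy', ht _ h1 w y hy' hy]
    · have e : T.proj z' = T.proj z := T.proj_eq_iff.2 h
      have h1 := hN (T.proj z) z.2
      have h2 : (z : V) ∈ T.lift (N (T.proj z) z.2) := hzN (T.proj z) z.2
      have h3 : (z' : V) ∈ T.lift (N (T.proj z) z.2) := by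
        change T.proj z' ∈ N (T.proj z) z.2
        rw [e]; exact h2
      have := ((s _ h1).2 w).mult ⟨z, h2⟩ ⟨z', h3⟩ h
      rw [ht _ h1 w z z.2 h2, ht _ h1 w z' z'.2 h3]
      exact this
    · exact Subtype.ext (funext fun w => funext fun z => ht U' hU' w z _ z.2)

/-- A holomorphic section of `F`, viewed as a section with poles on the reflection hypertori. -/
def holToMer (α : AntiDual V) (U : Opens T.X) (s : T.holF α U) : T.merF α U :=
  ⟨fun w => restr (T.regLift_subset U) (s.1 w), fun w => (s.2 w).toMer⟩

/-- Restriction of sections of `F` with poles on the reflection hypertori. -/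
def resMerF (α : AntiDual V) {U U' : Opens T.X} (h : U' ≤ U) (s : T.merF α U) : T.merF α U' :=
  ⟨fun w => restr (T.regLift_mono h) (s.1 w), fun w => (s.2 w).restr h⟩

/-- A representation of the sheaf of algebras `W ⋉ D_{X_reg}` on the sections of
`F = ⨁_w (L^*) ^ w` with poles on the reflection hypertori. -/
structure MerRep (α : AntiDual V) where
  act : ∀ U : Opens T.Y, T.WD U →ₐ[ℂ] Module.End ℂ (T.merF α (T.pre U))
  act_res : ∀ {U U' : Opens T.Y} (h : U' ≤ U) (D : T.WD U) (s : T.merF α (T.pre U)),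
    T.resMerF α (T.pre_mono h) (act U D s) =
      act U' (T.resWD h D) (T.resMerF α (T.pre_mono h) s)

/-- `f` is a global meromorphic section of `(L ^ g)^* ⊗ L ⊗ V_H^*`, with `g = g_H ^ j` and `L = L_α`,
which has a simple pole on `H`, no other singularities, and residue `1` on `H`.

A point of `H` is fixed by `g`, so that the fibres of `L ^ g` and `L` at this point are canonically
identified, and it makes sense for the residue to be `1`. If `z₀ ∈ V` lies over `H`, then
`z₀ - g⁻¹ z₀ ∈ Γ`, and in the trivializations of `L` and `L ^ g` pulled back to `V` this canonical
identification is the multiplication by `χ_α(z₀ - g⁻¹ z₀)`. -/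
structure IsDunklForm (α : AntiDual V) (p : T.Pairs) (f : V → V →L[ℂ] ℂ) : Prop where
  values : ∀ z v : V, T.gen p.H • v = v → f z v = 0
  hol : AnalyticOnNhd ℂ f (T.proj ⁻¹' p.H.1)ᶜ
  mult : ∀ z : V, T.proj z ∉ p.H.1 → ∀ γ ∈ T.Γ,
    f (z + γ) = mult (α - T.dualAct (T.refl p) α) γ • f z
  residue : ∀ z₀ : V, T.proj z₀ ∈ p.H.1 →
    LogPoleAt (T.proj ⁻¹' p.H.1) (TorusAction.mult α (z₀ - (T.refl p)⁻¹ • z₀)) f z₀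

open scoped Classical in
/-- The section `f_{H,j}^L`, for `L = L_α` (only its values off `H` matter). -/
def dunklForm (α : AntiDual V) (p : T.Pairs) : V → V →L[ℂ] ℂ :=
  if h : ∃ f, T.IsDunklForm α p f then h.choose else 0

/-- `ρ = ρ_{L,∇}` is given on functions, on `W` and on the vector fields `∂_v` by the formulas
`ρ(f) β = f β`, `(ρ(g) β)(x) = β(g⁻¹ x)` (mapping sections of `(L^*) ^ w` to sections of
`(L^*) ^ (g w)`), and, for a section `β` of `(L^*) ^ w`,
`ρ(∂_v) β = ∇_v β + ∑_{(H,j)} C(H,j) ⟨f_{H,j}^{L ^ w}, v⟩ β`, where the term of `(H,j)` is a section of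
`(L^*) ^ (g w)` with `g = g_H ^ j`. The connection on `(L^*) ^ w` is dual to the one on `L ^ w`. -/
structure IsDunklRep (C : T.Pairs → ℂ) (α : AntiDual V) (ξ : T.FlatConnection)
    (ρ : T.MerRep α) : Prop where
  act_fun : ∀ (U : Opens T.Y) (f : T.OD (T.pre U)) (β : T.merF α (T.pre U)) (u : T.W)
    (z : T.regLift (T.pre U)), (ρ.act U (T.funWD f) β).1 u z = f.1 z * β.1 u z
  act_grp : ∀ (U : Opens T.Y) (g : T.W) (β : T.merF α (T.pre U)) (u : T.W)
    (z : T.regLift (T.pre U)),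
    (ρ.act U (T.grpWD U g) β).1 u z = β.1 (g⁻¹ * u) ⟨g⁻¹ • (z : V), T.smul_mem_regLift g⁻¹ z.2⟩
  act_vec : ∀ (U : Opens T.Y) (v : V) (β : T.merF α (T.pre U)) (u : T.W)
    (z : T.regLift (T.pre U)),
    (ρ.act U (T.vecWD U v) β).1 u z =
      dv v (β.1 u) z - ξ.transport u z v * β.1 u z +
        ∑ p : T.Pairs, C p * T.dunklForm (T.dualAct ((T.refl p)⁻¹ * u) α) p z v *
          β.1 ((T.refl p)⁻¹ * u) z

end TorusAction

end

/-! ### Division by a linear form -/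

section Division

variable {E : Type*} [NormedAddCommGroup E] [NormedSpace ℂ E]

/-! The values of ρ on functions, on W and on ∂_v determine it, since these generate the algebra
locally and ρ commutes with restriction. The content is that ρ exists, and that poles cancel on the
subalgebra H_{c,X,W}.

The main analytic principle is `TorusAction.eq_zero_of_multiplier`: a global holomorphic section of
a nontrivial bundle with constant unitary multipliers is zero. Its norm is periodic, hence bounded;
Liouville makes the section constant, and a multiplier different from 1 makes it vanish. Applied to
a difference, the principle gives uniqueness of the Dunkl forms (`IsDunklForm.eq`) and therefore
their W-equivariance (`dunklForm_smulP`). Existence is a problem in one variable: if l is a linear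
equation of H, the multiplier of the bundle factors through l, and the form is F(l)·l, where F is a
Kronecker function for the lattice l(Γ) ⊂ ℂ (`KroneckerFunction.exists_quasiPeriodic`). This shape
also shows that the Dunkl forms are closed.

The essential relation is that the operators ρ(∂_v) commute (`dM_comm`). Terms of first order match
because the Dunkl forms are closed, and because the connection form is constant and its transports
by u and by g⁻¹u, with g ∈ W_H, differ by a multiple of l. Quadratic terms are grouped by the
product w of the two group elements; for fixed w their sum is a section of L_{α − wα} with at most
simple poles on the hypertori. The map (q, p) ↦ (g_q p, q) preserves the product and pairs the
residues so that they cancel (`residue_cancel`). Division by a product of linear forms then removes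
the poles (`exists_local_crossTerm`), and the principle above gives zero for w ≠ 1. For w = 1 the
two forms are proportional, so each term vanishes (`sum_crossTerm_eq_zero`).

The algebra W ⋉ D is defined as an algebra of operators on functions, so compatibility with
relations has to be replaced by well-definedness. For this, each generator is paired with its
proposed image, and the algebra `algPair` generated by the pairs is considered. Its elements have a
normal form, sums of f·p(∂)·g. At a point with trivial stabilizer, functions that are exponentials
near one point of the orbit and zero near the others recover all coefficients from the action on
functions. So the first component of a pair determines the second (`snd_eq_zero`); `algPair` is the
graph of a homomorphism, and local homomorphisms glue (`fstWD_injective`, `fstWD_surjective`).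

On H_{c,X,W}, the pole of the Dunkl form in ρ(∂_v) meets the pole of φ_H g_H^j, and the
normalization of the residues makes them cancel (`exists_local_dunklForm_mul_sub`). Coherence holds
because F is locally free of rank |W|. -/

theorem ContinuousMultilinearMap.sub_eq_sum_update {n : ℕ}
    (f : ContinuousMultilinearMap ℂ (fun _ : Fin n => E) ℂ) (x y : E) :
    f (fun _ => x) - f (fun _ => y) =
      ∑ k : Fin n, f (Function.update (fun i => if i < k then y else x) k (x - y)) := by
  -- The k-th summand changes slot k only: earlier slots already hold y, later ones still hold x.
  -- The sum therefore telescopes.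
  have h : ∀ k : Fin n, f (Function.update (fun i => if i < k then y else x) k (x - y)) =
      f (fun i => if i.val < k.val then y else x) -
        f (fun i => if i.val < k.val + 1 then y else x) := by
    intro k
    rw [f.map_update_sub]
    congr 1
    · congr 1; funext i
      by_cases h : i = k
      · subst h; simp
      · rw [Function.update_of_ne h]; rfl
    · congr 1; funext i
      by_cases h : i = k
      · subst h; simp
      · rw [Function.update_of_ne h]
        have : i.val ≠ k.val := fun e => h (Fin.ext e)
        have e : (i < k) ↔ i.val < k.val + 1 := by rw [Fin.lt_def]; omega
        simp only [e]
  simp only [h]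
  rw [Fin.sum_univ_eq_sum_range (fun k => f (fun i => if i.val < k then y else x) -
        f (fun i => if i.val < k + 1 then y else x)) n, Finset.sum_range_sub']
  simp

/-- The power series of the difference quotient of an analytic function along a projection `P`,
with kernel spanned by `e`. -/
noncomputable def FormalMultilinearSeries.divSeries (p : FormalMultilinearSeries ℂ E ℂ)
    (P : E →L[ℂ] E) (e : E) : FormalMultilinearSeries ℂ E ℂ := fun n =>
  ∑ k : Fin (n + 1), ((p (n + 1)).curryMid k e).compContinuousLinearMap
    (fun i => if i.castSucc < k then P else ContinuousLinearMap.id ℂ E)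

/-- Passing from y to Py one slot at a time leaves y − Py = l(y)e in one slot of each difference.
The scalar l(y) comes out, and what remains is homogeneous of degree n in y. -/
theorem FormalMultilinearSeries.divSeries_apply (p : FormalMultilinearSeries ℂ E ℂ)
    (l : E →L[ℂ] ℂ) (e : E) (n : ℕ) (y : E) :
    l y * p.divSeries (ContinuousLinearMap.id ℂ E - l.smulRight e) e n (fun _ => y) =
      p (n + 1) (fun _ => y) - p (n + 1) (fun _ => y - l y • e) := by
  rw [ContinuousMultilinearMap.sub_eq_sum_update, divSeries, _root_.sum_apply,
    Finset.mul_sum]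
  refine Finset.sum_congr rfl fun k _ => ?_
  rw [sub_sub_cancel, ContinuousMultilinearMap.map_update_smul, smul_eq_mul]
  congr 1
  rw [ContinuousMultilinearMap.compContinuousLinearMap_apply,
    ContinuousMultilinearMap.curryMid_apply]
  congr 1
  funext i
  induction i using Fin.succAboveCases k with
  | x => simp
  | p j =>
    rw [Fin.insertNth_apply_succAbove, Function.update_of_ne (Fin.succAbove_ne k j)]
    by_cases h : j.castSucc < k
    · rw [Fin.succAbove_of_castSucc_lt _ _ h, if_pos h, if_pos h]; simp
    · rw [Fin.succAbove_of_le_castSucc _ _ (not_lt.1 h), if_neg h, if_neg]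
      · rfl
      · have := not_lt.1 h
        rw [Fin.le_def] at this
        rw [Fin.lt_def]
        simp at this ⊢
        omega

/-- There are n + 1 summands, and each composes n slots with P or with the identity; the maximum
with 1 covers both. -/
theorem FormalMultilinearSeries.norm_divSeries_le (p : FormalMultilinearSeries ℂ E ℂ)
    (P : E →L[ℂ] E) (e : E) (n : ℕ) :
    ‖p.divSeries P e n‖ ≤ (n + 1) * (‖p (n + 1)‖ * ‖e‖ * max 1 ‖P‖ ^ n) := by
  refine (norm_sum_le _ _).trans ?_
  have : ∀ k ∈ (Finset.univ : Finset (Fin (n + 1))), ‖((p (n + 1)).curryMid k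
      e).compContinuousLinearMap (fun i => if i.castSucc < k then P else
        ContinuousLinearMap.id ℂ E)‖ ≤ ‖p (n + 1)‖ * ‖e‖ * max 1 ‖P‖ ^ n := by
    intro k _
    refine (ContinuousMultilinearMap.norm_compContinuousLinearMap_le _ _).trans ?_
    refine mul_le_mul ?_ ?_ (Finset.prod_nonneg fun _ _ => norm_nonneg _) (by positivity)
    · refine (ContinuousLinearMap.le_opNorm _ _).trans ?_
      rw [ContinuousMultilinearMap.norm_curryMid]
    · refine (Finset.prod_le_prod (fun _ _ => norm_nonneg _) (g := fun _ => max 1 ‖P‖)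
        fun i _ => ?_).trans (by simp)
      split_ifs
      · exact le_max_right _ _
      · exact ContinuousLinearMap.norm_id_le.trans (le_max_left _ _)
  refine (Finset.sum_le_card_nsmul _ _ _ this).trans ?_
  simp

theorem FormalMultilinearSeries.divSeries_radius_pos {p : FormalMultilinearSeries ℂ E ℂ}
    (hp : 0 < p.radius) (P : E →L[ℂ] E) (e : E) : 0 < (p.divSeries P e).radius := by
  obtain ⟨r, hr0, hr⟩ := ENNReal.lt_iff_exists_nnreal_btwn.1 hp
  have hr0' : 0 < r := by exact_mod_cast hr0
  obtain ⟨C, hC, hb⟩ := p.norm_mul_pow_le_of_lt_radius hr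
  let M : NNReal := max 1 ‖P‖₊
  have hM : 0 < M := lt_of_lt_of_le one_pos (le_max_left _ _)
  have hM' : (M : ℝ) = max 1 ‖P‖ := by simp [M]
  have hMr : (0 : ℝ) < M := by exact_mod_cast hM
  have hrr : (0 : ℝ) < r := by exact_mod_cast hr0'
  -- Dividing r by M absorbs the factor M^n of the norm bound; dividing by 2 absorbs the number n +
  -- 1 ≤ 2^n of summands.
  refine lt_of_lt_of_le (b := ((r / (2 * M) : NNReal) : ENNReal)) ?_ ?_
  · have : 0 < r / (2 * M) := by positivity
    exact_mod_cast this
  · refine FormalMultilinearSeries.le_radius_of_bound _ (C * ‖e‖ / r) fun n => ?_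
    have h1 := p.norm_divSeries_le P e n
    rw [← hM'] at h1
    have h2 : ((r / (2 * M) : NNReal) : ℝ) ^ n * (M : ℝ) ^ n = (r : ℝ) ^ n / 2 ^ n := by
      rw [← mul_pow, ← div_pow]
      congr 1
      push_cast
      field_simp
    have h3 : ((n : ℝ) + 1) ≤ 2 ^ n := by
      exact_mod_cast (Nat.lt_two_pow_self (n := n))
    calc ‖p.divSeries P e n‖ * ((r / (2 * M) : NNReal) : ℝ) ^ n
        ≤ ((n + 1) * (‖p (n + 1)‖ * ‖e‖ * (M : ℝ) ^ n)) * ((r / (2 * M) : NNReal) : ℝ) ^ n := by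
          gcongr
      _ = (n + 1) * (‖p (n + 1)‖ * ‖e‖) *
          (((r / (2 * M) : NNReal) : ℝ) ^ n * (M : ℝ) ^ n) := by ring
      _ = ((n + 1) / 2 ^ n) * ((‖p (n + 1)‖ * (r : ℝ) ^ (n + 1)) * ‖e‖ / r) := by
          rw [h2]; field_simp; ring
      _ ≤ 1 * (C * ‖e‖ / r) := by
          gcongr
          · rw [div_le_one (by positivity)]; exact h3
          · exact hb (n + 1)
      _ = C * ‖e‖ / r := one_mul _

/-- An analytic function which vanishes on a hyperplane is divisible by the equation of the
hyperplane. -/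
theorem AnalyticAt.exists_eq_linear_mul {h : E → ℂ} {z₀ : E} (hh : AnalyticAt ℂ h z₀)
    {l : E →L[ℂ] ℂ} (hl : l ≠ 0) (hz : ∀ᶠ z in 𝓝 z₀, l z = l z₀ → h z = 0) :
    ∃ q : E → ℂ, AnalyticAt ℂ q z₀ ∧ ∀ᶠ z in 𝓝 z₀, h z = (l z - l z₀) * q z := by
  obtain ⟨e, he⟩ : ∃ e, l e = 1 := by
    obtain ⟨x, hx⟩ : ∃ x, l x ≠ 0 := by
      by_contra! H
      exact hl (ContinuousLinearMap.ext H)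
    exact ⟨(l x)⁻¹ • x, by simp [hx]⟩
  obtain ⟨p, hp⟩ := hh
  obtain ⟨r, hp⟩ := hp
  -- Since l e = 1, P projects onto ker l, and z₀ + P(z − z₀) lies on the hyperplane, where h
  -- vanishes. Hence h(z) is the difference of the values of the power series at z − z₀ and P(z −
  -- z₀), which `divSeries` divides by l degree by degree.
  let P : E →L[ℂ] E := ContinuousLinearMap.id ℂ E - l.smulRight e
  let s := p.divSeries P e
  have hs : 0 < s.radius := FormalMultilinearSeries.divSeries_radius_pos (hp.r_pos.trans_le hp.r_le) P e
  have hfs : HasFPowerSeriesOnBall (fun z => s.sum (z - z₀)) s z₀ s.radius := by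
    have := (s.hasFPowerSeriesOnBall hs).comp_sub z₀
    simpa using this
  refine ⟨fun z => s.sum (z - z₀), ⟨s, _, hfs⟩, ?_⟩
  have hPc : Tendsto (fun z : E => z₀ + P (z - z₀)) (𝓝 z₀) (𝓝 z₀) := by
    have : Continuous fun z : E => z₀ + P (z - z₀) := by fun_prop
    simpa using this.tendsto z₀
  have hsub : Tendsto (fun z : E => z - z₀) (𝓝 z₀) (𝓝 0) := by
    have : Continuous fun z : E => z - z₀ := by fun_prop
    simpa using this.tendsto z₀
  have hPsub : Tendsto (fun z : E => P (z - z₀)) (𝓝 z₀) (𝓝 0) := by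
    have : Continuous fun z : E => P (z - z₀) := by fun_prop
    simpa using this.tendsto z₀
  have hlP : ∀ y, l (P y) = 0 := fun y => by simp [P, he]
  filter_upwards [hPc.eventually hz, hsub.eventually (Metric.eball_mem_nhds 0 hp.r_pos),
    hPsub.eventually (Metric.eball_mem_nhds 0 hp.r_pos),
    hsub.eventually (Metric.eball_mem_nhds 0 hs)] with z h1 h2 h3 h4
  have e1 := hp.hasSum h2
  have e2 := hp.hasSum h3
  rw [h1 (by rw [map_add, hlP, add_zero])] at e2
  rw [add_sub_cancel] at e1
  have e3 := (hasSum_nat_add_iff' 1).2 (e1.sub e2)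
  have e4 := ((s.hasFPowerSeriesOnBall hs).hasSum h4).mul_left (l (z - z₀))
  rw [zero_add] at e4
  have e5 : (fun n => l (z - z₀) * s n fun _ => z - z₀) =
      fun n => (p (n + 1) fun _ => z - z₀) - p (n + 1) fun _ => P (z - z₀) := by
    funext n
    rw [FormalMultilinearSeries.divSeries_apply]
    rfl
  rw [e5] at e4
  have e6 := e4.unique e3
  rw [← map_sub, e6]
  have : (p 0 fun _ => z - z₀) = p 0 fun _ => P (z - z₀) := congrArg _ (Subsingleton.elim _ _)
  simp [this]

end Division

/-! ### Division by several linear forms and removal of singularities -/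

section Extension

variable {E : Type*} [NormedAddCommGroup E] [NormedSpace ℂ E]

/-- A finite set of linear forms, none of which vanishes on the kernel of `l`, does not vanish at
some vector of the kernel of `l`. -/
theorem exists_apply_eq_zero_forall_ne_zero {ι : Type*} (s : Finset ι) (m : ι → E →L[ℂ] ℂ)
    (l : E →L[ℂ] ℂ) (h : ∀ i ∈ s, ∃ v, l v = 0 ∧ m i v ≠ 0) :
    ∃ v, l v = 0 ∧ ∀ i ∈ s, m i v ≠ 0 := by
  classical
  induction s using Finset.induction_on with
  | empty => exact ⟨0, by simp⟩
  | insert a s ha ih =>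
    obtain ⟨v, hv, hv'⟩ := ih fun i hi => h i (Finset.mem_insert_of_mem hi)
    obtain ⟨u, hu, hu'⟩ := h a (Finset.mem_insert_self a s)
    -- Each condition is an affine equation in t that is not identically satisfied, so it excludes
    -- at most one value of t.
    have hfin : (⋃ i ∈ insert a s, {t : ℂ | m i (v + t • u) = 0}).Finite := by
      refine (insert a s).finite_toSet.biUnion fun i hi => ?_
      by_cases h0 : m i u = 0
      · have h1 : m i v ≠ 0 := by
          rcases Finset.mem_insert.1 hi with rfl | hi
          · exact absurd h0 hu'
          · exact hv' i hi
        refine Set.finite_empty.subset fun t ht => h1 ?_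
        simpa [h0] using ht
      · refine (Set.finite_singleton (-(m i v / m i u))).subset fun t ht => ?_
        have ht' : m i v + t * m i u = 0 := by simpa using ht
        rw [Set.mem_singleton_iff]
        field_simp
        linear_combination ht'
    obtain ⟨t, ht⟩ := hfin.exists_notMem
    refine ⟨v + t • u, by simp [hu, hv], fun i hi h0 => ht ?_⟩
    exact Set.mem_biUnion (Finset.mem_coe.2 hi) h0

/-- Division by a product of pairwise non-proportional linear forms. -/
theorem AnalyticAt.exists_eq_prod_linear_mul {ι : Type*} (s : Finset ι) (l : ι → E →L[ℂ] ℂ)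
    {z₀ : E} (hne : ∀ i ∈ s, l i ≠ 0)
    (hpair : ∀ i ∈ s, ∀ j ∈ s, i ≠ j → ∃ v, l i v = 0 ∧ l j v ≠ 0)
    {h : E → ℂ} (hh : AnalyticAt ℂ h z₀)
    (hz : ∀ i ∈ s, ∀ᶠ z in 𝓝 z₀, l i z = l i z₀ →
      (∀ j ∈ s, j ≠ i → l j z ≠ l j z₀) → h z = 0) :
    ∃ q : E → ℂ, AnalyticAt ℂ q z₀ ∧ ∀ᶠ z in 𝓝 z₀, h z = (∏ i ∈ s, (l i z - l i z₀)) * q z := by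
  classical
  induction s using Finset.induction_on generalizing h with
  | empty => exact ⟨h, hh, by simp⟩
  | insert a s ha ih =>
    -- The vanishing of h is assumed only at points of the hyperplane a off the other hyperplanes.
    -- Moving along v, in the kernel of l a but of no other form, reaches such points, and
    -- continuity gives vanishing on the whole hyperplane.
    have hvan : ∀ᶠ z in 𝓝 z₀, l a z = l a z₀ → h z = 0 := by
      obtain ⟨v, hv, hv'⟩ := exists_apply_eq_zero_forall_ne_zero s l (l a) fun j hj =>
        hpair a (Finset.mem_insert_self a s) j (Finset.mem_insert_of_mem hj)
          fun e => ha (e ▸ hj)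
      filter_upwards [(hz a (Finset.mem_insert_self a s)).eventually_nhds,
        hh.eventually_continuousAt] with z h1 h2 h3
      have hc : Tendsto (fun t : ℂ => z + t • v) (𝓝[≠] 0) (𝓝 z) := by
        have : Continuous fun t : ℂ => z + t • v := by fun_prop
        have := this.tendsto 0
        rw [zero_smul, add_zero] at this
        exact this.mono_left nhdsWithin_le_nhds
      have h4 : ∀ᶠ t in 𝓝[≠] (0 : ℂ), h (z + t • v) = 0 := by
        have h5 : ∀ᶠ t in 𝓝[≠] (0 : ℂ), ∀ j ∈ s, l j (z + t • v) ≠ l j z₀ := by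
          rw [Filter.eventually_all_finset]
          intro j hj
          by_cases h0 : l j z = l j z₀
          · filter_upwards [self_mem_nhdsWithin] with t ht
            have ht' : t ≠ 0 := ht
            simp [h0, ht', hv' j hj]
          · exact (((l j).continuous.tendsto z).comp hc).eventually_ne h0
        filter_upwards [hc.eventually h1, h5] with t h6 h7
        refine h6 (by simp [hv, h3]) fun j hj hja => ?_
        exact h7 j ((Finset.mem_insert.1 hj).resolve_left hja)
      have h8 : Tendsto (fun t : ℂ => h (z + t • v)) (𝓝[≠] 0) (𝓝 (h z)) :=
        h2.tendsto.comp hc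
      exact tendsto_nhds_unique h8 (tendsto_const_nhds.congr' (h4.mono fun t ht => ht.symm))
    obtain ⟨q, hq, hq'⟩ := hh.exists_eq_linear_mul (hne a (Finset.mem_insert_self a s)) hvan
    obtain ⟨k, hk, hk'⟩ := ih (fun i hi => hne i (Finset.mem_insert_of_mem hi))
      (fun i hi j hj => hpair i (Finset.mem_insert_of_mem hi) j (Finset.mem_insert_of_mem hj))
      hq (fun i hi => by
        -- The quotient q inherits the hypothesis for i: at nearby points of the hyperplane i off
        -- the hyperplane a, h vanishes and the factor of l a does not. Continuity along v carries
        -- this to points lying on both.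
        have hia : i ≠ a := fun e => ha (e ▸ hi)
        have hi' := Finset.mem_insert_of_mem (a := i) (b := a) hi
        obtain ⟨v, hv, hv'⟩ := hpair i hi' a (Finset.mem_insert_self a s) hia
        filter_upwards [(hz i hi').eventually_nhds, hq'.eventually_nhds,
          hq.eventually_continuousAt] with z h1 h2 hcont h3 h4
        have hc : Tendsto (fun t : ℂ => z + t • v) (𝓝[≠] 0) (𝓝 z) := by
          have : Continuous fun t : ℂ => z + t • v := by fun_prop
          have := this.tendsto 0
          rw [zero_smul, add_zero] at this
          exact this.mono_left nhdsWithin_le_nhds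
        have h5 : ∀ᶠ t in 𝓝[≠] (0 : ℂ), ∀ j ∈ insert a s, j ≠ i → l j (z + t • v) ≠ l j z₀ := by
          rw [Filter.eventually_all_finset]
          intro j hj
          by_cases h0 : l j z = l j z₀
          · rcases Finset.mem_insert.1 hj with rfl | hj
            · filter_upwards [self_mem_nhdsWithin] with t ht _
              have ht' : t ≠ 0 := ht
              simp [h0, ht', hv']
            · refine Eventually.of_forall fun t hji => absurd h0 (h4 j hj hji)
          · exact ((((l j).continuous.tendsto z).comp hc).eventually_ne h0).mono
              fun t ht _ => ht
        have h4' : ∀ᶠ t in 𝓝[≠] (0 : ℂ), q (z + t • v) = 0 := by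
          filter_upwards [hc.eventually h1, h5, hc.eventually h2] with t h6 h7 h8
          have h9 := h6 (by simp [hv, h3]) h7
          rw [h8, mul_eq_zero, sub_eq_zero] at h9
          exact h9.resolve_left (h7 a (Finset.mem_insert_self a s) hia.symm)
        have h8 : Tendsto (fun t : ℂ => q (z + t • v)) (𝓝[≠] 0) (𝓝 (q z)) :=
          hcont.tendsto.comp hc
        exact tendsto_nhds_unique h8 (tendsto_const_nhds.congr' (h4'.mono fun t ht => ht.symm)))
    refine ⟨k, hk, ?_⟩
    filter_upwards [hq', hk'] with z h1 h2
    rw [h1, h2, Finset.prod_insert ha, mul_assoc]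

/-- A function which near each point of `Ω` extends analytically over the nowhere dense set `Z` has
a global analytic extension. -/
theorem exists_analytic_extension {F : Type*} [NormedAddCommGroup F] [NormedSpace ℂ F]
    {Ω Z : Set E} (hZ : Dense Zᶜ) {G : E → F}
    (h : ∀ z ∈ Ω, ∃ q : E → F, AnalyticAt ℂ q z ∧ ∀ᶠ y in 𝓝 z, y ∉ Z → G y = q y) :
    ∃ Q : E → F, AnalyticOnNhd ℂ Q Ω ∧ (∀ z ∈ Ω, z ∉ Z → Q z = G z) ∧
      ∀ z ∈ Ω, ∀ q : E → F, ContinuousAt q z → (∀ᶠ y in 𝓝 z, y ∉ Z → G y = q y) → Q z = q z := by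
  classical
  have huniq : ∀ (z : E) (q k : E → F), ContinuousAt q z → ContinuousAt k z →
      (∀ᶠ y in 𝓝 z, y ∉ Z → G y = q y) → (∀ᶠ y in 𝓝 z, y ∉ Z → G y = k y) → q z = k z := by
    intro z q k hq hk h1 h2
    have : (𝓝[Zᶜ] z).NeBot := mem_closure_iff_nhdsWithin_neBot.1 (hZ z)
    refine tendsto_nhds_unique (hq.tendsto.mono_left (nhdsWithin_le_nhds (s := Zᶜ)))
      ((hk.tendsto.mono_left nhdsWithin_le_nhds).congr' ?_)
    filter_upwards [self_mem_nhdsWithin, nhdsWithin_le_nhds h1, nhdsWithin_le_nhds h2] with y hy a b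
    rw [← a hy, ← b hy]
  choose! q hq hq' using h
  have hloc : ∀ z ∈ Ω, ∀ k : E → F, ContinuousAt k z → (∀ᶠ y in 𝓝 z, y ∉ Z → G y = k y) →
      q z z = k z := fun z hz k hk h => huniq z _ _ (hq z hz).continuousAt hk (hq' z hz) h
  -- Ω is not assumed open, whereas analyticity at z ∈ Ω concerns a full neighbourhood. So a point
  -- outside Ω receives the value of a local extension whenever one exists; Q then equals q z near
  -- z.
  refine ⟨fun z => if z ∈ Ω then q z z else
    if h : ∃ k : E → F, ContinuousAt k z ∧ ∀ᶠ y in 𝓝 z, y ∉ Z → G y = k y then h.choose z else 0,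
    fun z hz => ?_, fun z hz hzZ => ?_, fun z hz k hk h => ?_⟩
  · refine (hq z hz).congr ?_
    filter_upwards [(hq z hz).eventually_continuousAt, (hq' z hz).eventually_nhds] with y h1 h2
    split_ifs with h3 h4
    · exact (hloc y h3 _ h1 h2).symm
    · exact huniq y _ _ h1 h4.choose_spec.1 h2 h4.choose_spec.2
    · exact absurd ⟨_, h1, h2⟩ h4
  · exact (if_pos hz).trans ((hq' z hz).self_of_nhds hzZ).symm
  · exact (if_pos hz).trans (hloc z hz k hk h)

end Extension

/-! ### Liouville's theorem for sections over the torus -/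

namespace TorusAction

variable {V : Type u} [NormedAddCommGroup V] [NormedSpace ℂ V] (T : TorusAction V)
  [FiniteDimensional ℂ V]

/-- An entire function which is periodic with respect to a lattice is constant. -/
theorem eq_of_periodic {F : Type*} [NormedAddCommGroup F] [NormedSpace ℂ F] {s : V → F}
    (hs : AnalyticOnNhd ℂ s Set.univ) (hper : ∀ z, ∀ γ ∈ T.Γ, s (z + γ) = s z) (z z' : V) :
    s z = s z' := by
  have : FiniteDimensional ℝ V := FiniteDimensional.complexToReal V
  refine Differentiable.apply_eq_apply_of_bounded (fun z => (hs z trivial).differentiableAt) ?_ z z'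
  exact (IsZLattice.isCompact_range_of_periodic T.Γ s
    (continuousOn_univ.1 hs.continuousOn) fun z w hw => hper z w hw).isBounded

/-- A holomorphic section of a nontrivial line bundle with unitary constant multipliers vanishes. -/
theorem eq_zero_of_multiplier {F : Type*} [NormedAddCommGroup F] [NormedSpace ℂ F] {s : V → F}
    (hs : AnalyticOnNhd ℂ s Set.univ) {χ : V → ℂ} (hχ : ∀ γ ∈ T.Γ, ‖χ γ‖ = 1)
    (hmul : ∀ z, ∀ γ ∈ T.Γ, s (z + γ) = χ γ • s z) {γ : V} (hγ : γ ∈ T.Γ) (hne : χ γ ≠ 1) (z : V) :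
    s z = 0 := by
  have : FiniteDimensional ℝ V := FiniteDimensional.complexToReal V
  -- The multipliers have modulus 1, so ‖s‖ is a continuous periodic function.
  have hb : Bornology.IsBounded (Set.range s) := by
    have := (IsZLattice.isCompact_range_of_periodic T.Γ (fun z => ‖s z‖)
      (continuousOn_univ.1 hs.continuousOn).norm
      fun z w hw => by rw [hmul z w hw, norm_smul, hχ w hw, one_mul]).isBounded
    obtain ⟨C, hC⟩ := this.exists_norm_le
    refine isBounded_iff_forall_norm_le.2 ⟨C, ?_⟩
    rintro _ ⟨z, rfl⟩
    simpa using hC _ ⟨z, rfl⟩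
  have h1 := Differentiable.apply_eq_apply_of_bounded
    (fun z => (hs z trivial).differentiableAt) hb (z + γ) z
  rw [hmul z γ hγ] at h1
  have h2 : (χ γ - 1) • s z = 0 := by rw [sub_smul, one_smul, h1, sub_self]
  exact (smul_eq_zero.1 h2).resolve_left (sub_ne_zero.2 hne)

end TorusAction

/-! ### Quasi-periodic functions with simple poles on a lattice -/

namespace KroneckerFunction

variable (Λ : Submodule ℤ ℂ) [DiscreteTopology Λ] [IsZLattice ℝ Λ] (κ : ℂ → ℂ)

/-- The general term of the series defining a meromorphic function with simple poles on `Λ`. -/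
noncomputable def term (l t : ℂ) : ℂ := κ (-l) * (1 / (t + l) - 1 / l + t / l ^ 2)

variable {κ}

/-- The corrections −1/l + t/l² cancel the leading terms of 1/(t + l): the bracket equals t²/(l²(t +
l)), of cubic decay in l. The condition on l gives ‖t + l‖ ≥ ‖l‖/2. -/
theorem norm_term_le (hκ : ∀ t, ‖κ t‖ = 1) {R : ℝ} {l t : ℂ} (ht : ‖t‖ < R) (hl : 2 * R ≤ ‖l‖) :
    ‖term κ l t‖ ≤ 2 * R ^ 2 * ‖l‖⁻¹ ^ 3 := by
  have hR : 0 < R := (norm_nonneg t).trans_lt ht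
  have hlpos : 0 < ‖l‖ := by linarith
  have hl0 : l ≠ 0 := norm_pos_iff.1 hlpos
  have h1 : ‖l‖ / 2 ≤ ‖t + l‖ := by
    have := norm_sub_norm_le l (-t)
    rw [norm_neg, sub_neg_eq_add, add_comm] at this
    linarith
  have htl : t + l ≠ 0 := norm_pos_iff.1 (by linarith)
  have e : 1 / (t + l) - 1 / l + t / l ^ 2 = t ^ 2 / (l ^ 2 * (t + l)) := by
    field_simp
    ring
  rw [term, norm_mul, hκ, one_mul, e, norm_div, norm_mul, norm_pow, norm_pow]
  calc ‖t‖ ^ 2 / (‖l‖ ^ 2 * ‖t + l‖) ≤ R ^ 2 / (‖l‖ ^ 2 * (‖l‖ / 2)) := by gcongr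
    _ = 2 * R ^ 2 * ‖l‖⁻¹ ^ 3 := by field_simp

theorem finite_norm_lt (R : ℝ) : {l : Λ | ‖(l : ℂ)‖ < R}.Finite := by
  have h := Metric.finite_isBounded_inter_isClosed (s := (Λ : Set ℂ)) (K := Metric.ball 0 R)
    (isDiscrete_iff_discreteTopology.2 ‹_›) Metric.isBounded_ball
    (@AddSubgroup.isClosed_of_discrete ℂ _ _ _ _ Λ.toAddSubgroup ‹_›)
  refine Set.Finite.of_finite_image (f := Subtype.val) (h.subset ?_) Subtype.val_injective.injOn
  rintro _ ⟨l, hl, rfl⟩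
  exact ⟨by simpa using hl, l.2⟩

/-- The exponent 3 exceeds the real rank 2 of Λ. -/
theorem summable_cube : Summable fun l : Λ => ‖(l : ℂ)‖⁻¹ ^ 3 := by
  have := ZLattice.summable_norm_pow_inv Λ 3 (by
    rw [ZLattice.rank ℝ Λ, Complex.finrank_real_complex]; norm_num)
  exact this

theorem summable_term (hκ : ∀ t, ‖κ t‖ = 1) (t : ℂ) : Summable fun l : Λ => term κ l t := by
  refine Summable.of_norm_bounded_eventually ((summable_cube Λ).mul_left (2 * (‖t‖ + 1) ^ 2)) ?_
  refine (finite_norm_lt Λ (2 * (‖t‖ + 1))).subset fun l hl => ?_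
  by_contra h
  exact hl (norm_term_le hκ (lt_add_one _) (not_lt.1 h))

/-- Apart from the finitely many l with ‖l‖ < 2R, the terms have no pole in the ball and are
dominated there by a summable multiple of ‖l‖⁻³, so the sum of the others is analytic. -/
theorem exists_sum_add_analytic (hκ : ∀ t, ‖κ t‖ = 1) (R : ℝ) :
    ∃ (S : Finset Λ) (B : ℂ → ℂ), AnalyticOnNhd ℂ B (Metric.ball 0 R) ∧
      (∀ l : Λ, ‖(l : ℂ)‖ < R → l ∈ S) ∧
      ∀ t ∈ Metric.ball (0 : ℂ) R, ∑' l : Λ, term κ l t = ∑ l ∈ S, term κ l t + B t := by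
  classical
  rcases le_or_gt R 0 with hR | hR
  · refine ⟨∅, 0, ?_, fun l hl => absurd (norm_nonneg (l : ℂ)) (by linarith), ?_⟩
    · rw [Metric.ball_eq_empty.2 hR]; exact fun _ h => h.elim
    · rw [Metric.ball_eq_empty.2 hR]; exact fun _ h => h.elim
  let S : Finset Λ := (finite_norm_lt Λ (2 * R)).toFinset
  let b : Λ → ℂ → ℂ := fun l t => if l ∈ S then 0 else term κ l t
  have hS : ∀ l : Λ, l ∉ S → 2 * R ≤ ‖(l : ℂ)‖ := fun l hl => by
    simpa [S] using hl
  refine ⟨S, fun t => ∑' l, b l t, ?_, fun l hl => ?_, fun t ht => ?_⟩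
  · refine DifferentiableOn.analyticOnNhd ?_ Metric.isOpen_ball
    refine Complex.differentiableOn_tsum_of_summable_norm
      ((summable_cube Λ).mul_left (2 * R ^ 2)) (fun l => ?_) Metric.isOpen_ball
      fun l t ht => ?_
    · by_cases hl : l ∈ S
      · simp only [b, if_pos hl]; exact differentiableOn_const 0
      · simp only [b, if_neg hl]
        intro t ht
        have h1 : t + l ≠ 0 := by
          intro h0
          have h2 : ‖t‖ = ‖(l : ℂ)‖ := by rw [eq_neg_of_add_eq_zero_left h0, norm_neg]
          have := hS l hl
          rw [mem_ball_zero_iff] at ht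
          linarith
        unfold term
        refine DifferentiableAt.differentiableWithinAt ?_
        fun_prop (disch := assumption)
    · by_cases hl : l ∈ S
      · simp only [b, if_pos hl, norm_zero]; positivity
      · simp only [b, if_neg hl]
        exact norm_term_le hκ (by simpa using ht) (hS l hl)
  · simp only [S, Set.Finite.mem_toFinset, Set.mem_ofPred_eq]; linarith
  · have hs := summable_term Λ hκ t
    have e : ∀ l : Λ, b l t = term κ l t - if l ∈ S then term κ l t else 0 := by
      intro l; simp only [b]; split_ifs <;> simp
    have h2 : HasSum (fun l : Λ => if l ∈ S then term κ l t else 0) (∑ l ∈ S, term κ l t) := by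
      have := hasSum_sum_of_ne_finset_zero (L := .unconditional Λ) (f := fun l : Λ => if l ∈ S then term κ l t else 0)
        (s := S) (fun l hl => if_neg hl)
      rwa [Finset.sum_congr rfl fun l hl => if_pos hl] at this
    have h3 := (hs.hasSum.sub h2).tsum_eq
    simp only [e]
    rw [h3]
    ring

/-- The series is quasi-periodic up to affine functions. -/
theorem exists_affine (hκ : ∀ t, ‖κ t‖ = 1) (hadd : ∀ s t, κ (s + t) = κ s * κ t) (g : Λ) :
    ∃ A B : ℂ, ∀ t, (∑' l : Λ, term κ l (t + g)) - κ g * ∑' l : Λ, term κ l t = A * t + B := by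
  -- The term of l at t + g and κ(g) times the term of l + g at t have the same polar part, so their
  -- difference is affine in t, with coefficients a and b. With 1/0 = 0 this identity also holds at
  -- the poles and at the indices l = 0, −g.
  let a : Λ → ℂ := fun l => κ (-l) * (1 / (l : ℂ) ^ 2 - 1 / ((l : ℂ) + g) ^ 2)
  let b : Λ → ℂ := fun l => κ (-l) * (-(1 / (l : ℂ)) + 1 / ((l : ℂ) + g) + g / (l : ℂ) ^ 2)
  have h0 : ∀ t, HasSum (fun l : Λ => a l * t + b l)
      ((∑' l : Λ, term κ l (t + g)) - κ g * ∑' l : Λ, term κ l t) := by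
    intro t
    have h1 := (summable_term Λ hκ (t + g)).hasSum
    have h2 := (((Equiv.addRight g).hasSum_iff).2 (summable_term Λ hκ t).hasSum).mul_left (κ g)
    refine (h1.sub h2).congr_fun ?_
    intro l
    have h3 : κ g * κ (-((l : ℂ) + g)) = κ (-l) := by rw [← hadd]; congr 1; ring
    simp only [Function.comp_apply, Equiv.coe_addRight, term, a, b, Submodule.coe_add]
    rw [← mul_assoc, h3, show t + (g : ℂ) + l = t + (l + g) by ring]
    ring
  -- Summability of the coefficients separately is read off from t = 0 and t = 1.
  have hb : Summable b := by simpa using (h0 0).summable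
  have ha : Summable a := by simpa using ((h0 1).summable.sub hb)
  exact ⟨∑' l, a l, ∑' l, b l, fun t => (h0 t).unique ((ha.hasSum.mul_right t).add hb.hasSum)⟩

/-- For a unitary character `κ`, nontrivial on `Λ`, there is a meromorphic function with multiplier
`κ` whose only poles are simple poles on `Λ`, with residue `κ(l)` at `l`. -/
theorem exists_quasiPeriodic (hκ : ∀ t, ‖κ t‖ = 1) (hadd : ∀ s t, κ (s + t) = κ s * κ t)
    {g₀ : ℂ} (hg₀ : g₀ ∈ Λ) (hne : κ g₀ ≠ 1) :
    ∃ F : ℂ → ℂ, (∀ t ∉ Λ, AnalyticAt ℂ F t) ∧ (∀ t, ∀ l ∈ Λ, F (t + l) = κ l * F t) ∧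
      ∀ m ∈ Λ, ∃ k : ℂ → ℂ, AnalyticAt ℂ k m ∧ ∀ᶠ t in 𝓝 m, F t = κ m / (t - m) + k t := by
  have h1 : 1 - κ g₀ ≠ 0 := sub_ne_zero.2 hne.symm
  let G : ℂ → ℂ := fun t => ∑' l : Λ, term κ l t
  obtain ⟨A, B, hAB⟩ := exists_affine Λ hκ hadd ⟨g₀, hg₀⟩
  -- P and Q are found by requiring that G(t) − (Pt + Q) have exact multiplier κ(g₀) under g₀;
  -- comparing coefficients gives two equations, solvable because κ(g₀) ≠ 1.
  let P : ℂ := A / (1 - κ g₀)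
  let Q : ℂ := (B - P * g₀) / (1 - κ g₀)
  have hP : P * (1 - κ g₀) = A := div_mul_cancel₀ _ h1
  have hQ : Q * (1 - κ g₀) = B - P * g₀ := div_mul_cancel₀ _ h1
  let F : ℂ → ℂ := fun t => G t - (P * t + Q)
  have hF0 : ∀ t, F (t + g₀) = κ g₀ * F t := by
    intro t
    have := hAB t
    change G (t + g₀) - κ g₀ * G t = _ at this
    simp only [F]
    linear_combination this - t * hP - hQ
  have hF : ∀ t, ∀ l ∈ Λ, F (t + l) = κ l * F t := by
    intro t l hl
    obtain ⟨A', B', h'⟩ := exists_affine Λ hκ hadd ⟨l, hl⟩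
    let a := A' - P + κ l * P
    let b := B' - P * l - Q + κ l * Q
    have hq : ∀ t, F (t + l) - κ l * F t = a * t + b := by
      intro t
      have := h' t
      change G (t + l) - κ l * G t = _ at this
      simp only [F, a, b]
      linear_combination this
    -- The defect of F under l is an affine function that itself has multiplier κ(g₀) under g₀. As
    -- κ(g₀) ≠ 1, this forces both coefficients to vanish.
    have hq' : ∀ t, a * (t + g₀) + b = κ g₀ * (a * t + b) := by
      intro t
      rw [← hq, ← hq, hF0 t, add_right_comm, hF0 (t + l)]
      ring
    have ha : a = 0 := by
      have e0 := hq' 0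
      have e1 := hq' 1
      have : a * (1 - κ g₀) = 0 := by linear_combination e1 - e0
      exact (mul_eq_zero.1 this).resolve_right h1
    have hb : b = 0 := by
      have e0 := hq' 0
      rw [ha] at e0
      have : b * (1 - κ g₀) = 0 := by linear_combination e0
      exact (mul_eq_zero.1 this).resolve_right h1
    have := hq t
    rw [ha, hb] at this
    linear_combination this
  have hlin : ∀ t, AnalyticAt ℂ (fun t => P * t + Q) t := fun t => by fun_prop
  have hterm : ∀ (l t : ℂ), t + l ≠ 0 → AnalyticAt ℂ (term κ l) t := by
    intro l t h
    unfold term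
    fun_prop (disch := assumption)
  refine ⟨F, fun t ht => ?_, hF, fun m hm => ?_⟩
  · obtain ⟨S, C, hC, -, hS⟩ := exists_sum_add_analytic Λ hκ (‖t‖ + 1)
    have hmem : t ∈ Metric.ball (0 : ℂ) (‖t‖ + 1) := by simp
    have h2 : AnalyticAt ℂ (fun t => ∑ l ∈ S, term κ l t + C t) t := by
      refine AnalyticAt.add (Finset.analyticAt_fun_sum S fun l _ => hterm l t fun h => ht ?_)
        (hC t hmem)
      rw [eq_neg_of_add_eq_zero_left h]; exact neg_mem l.2
    refine (h2.sub (hlin t)).congr ?_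
    filter_upwards [Metric.isOpen_ball.mem_nhds hmem] with y hy
    simp only [F, G, Pi.sub_apply, hS y hy]
  · obtain ⟨S, C, hC, hS', hS⟩ := exists_sum_add_analytic Λ hκ (‖m‖ + 1)
    have hmem : m ∈ Metric.ball (0 : ℂ) (‖m‖ + 1) := by simp
    classical
    -- Only the index −m has a pole at m, and its coefficient is κ(m). For m = 0 the convention 1/0
    -- = 0 removes the correction terms, both in `term` and in the regular part given below.
    let m' : Λ := ⟨-m, neg_mem hm⟩
    have hm' : m' ∈ S := hS' m' (by simp [m'])
    refine ⟨fun t => κ m * (1 / m + t / m ^ 2) + ∑ l ∈ S.erase m', term κ l t + C t - (P * t + Q),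
      ?_, ?_⟩
    · refine AnalyticAt.sub (AnalyticAt.add (AnalyticAt.add (by fun_prop)
        (Finset.analyticAt_fun_sum _ fun l hl => hterm l m fun h => ?_)) (hC m hmem)) (hlin m)
      refine (Finset.mem_erase.1 hl).1 (Subtype.ext ?_)
      simp only [m']
      linear_combination h
    · filter_upwards [Metric.isOpen_ball.mem_nhds hmem] with y hy
      simp only [F, G, hS y hy]
      rw [← Finset.add_sum_erase S _ hm']
      simp only [m', term, neg_neg]
      ring

end KroneckerFunction

/-! ### Reflection hypertori -/

/-- Nonzero elements of a discrete lattice are bounded away from zero. -/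
theorem Submodule.exists_pos_forall_norm_lt {E : Type*} [NormedAddCommGroup E]
    (L : Submodule ℤ E) [DiscreteTopology L] : ∃ ε > 0, ∀ x ∈ L, ‖x‖ < ε → x = 0 := by
  obtain ⟨ε, hε, h⟩ := Metric.exists_ball_inter_eq_singleton_of_mem_discrete
    (isDiscrete_iff_discreteTopology.2 ‹_› : IsDiscrete (L : Set E)) (zero_mem L)
  refine ⟨ε, hε, fun x hx hn => ?_⟩
  have : x ∈ Metric.ball 0 ε ∩ (L : Set E) := ⟨by simpa using hn, hx⟩
  rwa [h] at this

namespace TorusAction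

variable {V : Type u} [NormedAddCommGroup V] [NormedSpace ℂ V] (T : TorusAction V)

theorem smul_smul_complex (w : T.W) (c : ℂ) (v : V) : w • c • v = c • w • v := map_smul w.1 c v

theorem smul_sub_mem_of_mem_stab {H : T.Hypertorus} {g : T.W} (hg : g ∈ T.stab H) {z : V}
    (hz : T.proj z ∈ H.1) : g • z - z ∈ T.Γ :=
  (T.mem_fixedBy_proj g z).1 ((mem_fixingSubgroup_iff T.W).1 hg _ hz)

theorem mem_stab_iff {H : T.Hypertorus} {g : T.W} :
    g ∈ T.stab H ↔ ∀ z, T.proj z ∈ H.1 → g • z - z ∈ T.Γ := by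
  refine ⟨fun hg z hz => T.smul_sub_mem_of_mem_stab hg hz, fun h => ?_⟩
  rw [stab, mem_fixingSubgroup_iff]
  intro y hy
  obtain ⟨z, rfl⟩ := T.proj_surjective y
  exact (T.mem_fixedBy_proj g z).2 (h z hy)

theorem isOpenMap_proj : IsOpenMap T.proj :=
  QuotientAddGroup.isOpenMap_coe (N := T.Γ.toAddSubgroup)

theorem proj_add {γ : V} (hγ : γ ∈ T.Γ) (z : V) : T.proj (z + γ) = T.proj z :=
  T.proj_eq_iff.2 (by simpa using hγ)

/-- Small nonzero t would give arbitrarily short nonzero lattice vectors. This turns statements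
about X, i.e. modulo Γ, into statements about vectors of V. -/
theorem eq_zero_of_forall_smul_mem {u : V} (h : ∀ t : ℂ, t • u ∈ T.Γ) : u = 0 := by
  obtain ⟨ε, hε, hΓ⟩ := T.Γ.exists_pos_forall_norm_lt
  have hc : Continuous fun t : ℂ => t • u := by fun_prop
  have h1 : ∀ᶠ t in 𝓝 (0 : ℂ), ‖t • u‖ < ε := by
    have := (hc.norm.tendsto 0).eventually_lt_const (u := ε) (by simpa using hε)
    exact this
  obtain ⟨t, ht, ht0⟩ := ((h1.filter_mono nhdsWithin_le_nhds).and
    (self_mem_nhdsWithin (a := (0 : ℂ)) (s := {0}ᶜ))).exists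
  exact (smul_eq_zero.1 (hΓ _ (h t) ht)).resolve_left ht0

/-- When l d = 0, iteration gives gⁿ v = v + n l(v) d, so finite order leaves no room for a
nontrivial unipotent g. -/
theorem apply_eq_zero_of_finite {g : T.W} {l : V →L[ℂ] ℂ} {d : V} (hg : ∀ v, g • v = v + l v • d)
    (hld : l d = 0) (v : V) : l v • d = 0 := by
  have hp : ∀ n : ℕ, g ^ n • v = v + (n : ℂ) • l v • d := by
    intro n
    induction n with
    | zero => simp
    | succ n ih =>
      rw [pow_succ', mul_smul, ih, hg, map_add, map_smul, map_smul, hld]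
      push_cast
      simp only [add_smul, smul_zero, add_zero, one_smul]
      abel
  obtain ⟨n, hn, h⟩ := (isOfFinOrder_of_finite g).exists_pow_eq_one
  have := hp n
  rw [h, one_smul, left_eq_add, smul_eq_zero] at this
  exact this.resolve_left (by exact_mod_cast hn.ne')

theorem exists_smul_eq_add {g : T.W} {l : V →L[ℂ] ℂ} (hl : l ≠ 0)
    (h : ∀ v, l v = 0 → g • v = v) : ∃ d : V, ∀ v, g • v = v + l v • d := by
  obtain ⟨x, hx⟩ : ∃ x, l x ≠ 0 := by
    by_contra! H
    exact hl (ContinuousLinearMap.ext H)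
  refine ⟨(l x)⁻¹ • (g • x - x), fun v => ?_⟩
  have := h (v - (l v * (l x)⁻¹) • x) (by simp [hx])
  rw [smul_sub, smul_smul_complex, sub_eq_iff_eq_add] at this
  rw [this, smul_smul, smul_sub]
  abel

variable [FiniteDimensional ℂ V]

theorem det_eq_of_smul_eq_add {g : T.W} {l : V →L[ℂ] ℂ} {d : V} (hg : ∀ v, g • v = v + l v • d) :
    LinearMap.det (g.1 : V →ₗ[ℂ] V) = 1 + l d := by
  rw [← ContinuousLinearMap.coe_coe, ← LinearMap.transvection.det]
  congr 1
  ext v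
  exact hg v

/-- The fixed hyperplane is the kernel of some l, so g is the identity plus l ⊗ d. If l d were zero,
g would be unipotent of finite order, hence trivial. -/
theorem IsReflection.exists_form {g : T.W} (hg : IsReflection g.1) :
    ∃ (l : V →L[ℂ] ℂ) (d : V), l ≠ 0 ∧ (∀ v, g • v = v + l v • d) ∧ l d ≠ 0 := by
  obtain ⟨h1, -, P, hP, hP'⟩ := hg
  obtain ⟨f, hf, hfP⟩ := P.exists_le_ker_of_lt_top hP.lt_top
  have hker : P = LinearMap.ker f := by
    rcases hP.le_iff.1 hfP with h | h
    · exact absurd (LinearMap.ker_eq_top.1 h) hf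
    · exact h.symm
  let l : V →L[ℂ] ℂ := LinearMap.toContinuousLinearMap f
  have hl : l ≠ 0 := by simpa [l] using hf
  obtain ⟨d, hd⟩ := T.exists_smul_eq_add (g := g) hl fun v hv => hP' v (hker ▸ hv)
  refine ⟨l, d, hl, hd, fun h => h1 ?_⟩
  ext v
  have := hd v
  rw [T.apply_eq_zero_of_finite hd h v, add_zero] at this
  exact this

/-- `l` is a linear form such that the preimage of `H` in `V` is the union of the `Γ`-translates of
the hyperplane `l = l z₁`. -/
structure IsEquation (H : T.Hypertorus) (l : V →L[ℂ] ℂ) (z₁ : V) : Prop where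
  ne : l ≠ 0
  mem_iff : ∀ z, T.proj z ∈ H.1 ↔ ∃ γ ∈ T.Γ, l z = l z₁ + l γ
  discrete : ∃ ε > 0, ∀ γ ∈ T.Γ, ‖l γ‖ < ε → l γ = 0
  fix : ∀ g ∈ T.stab H, ∀ v, l v = 0 → g • v = v
  exists_ne : ∃ g ∈ T.stab H, g ≠ 1

/-- Writing g = id + l ⊗ d, a point z lies over X^g exactly when l(z) d ∈ Γ. Such values l(z) form a
discrete group, so X^g splits into relatively open pieces indexed by the classes of these values
modulo l(Γ). Each piece is the image of one hyperplane and hence connected, so it is a component. -/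
theorem exists_isEquation (H : T.Hypertorus) : ∃ l z₁, T.IsEquation H l z₁ := by
  obtain ⟨H, g, hg, x, hx, rfl⟩ := H
  obtain ⟨l, d, hl, hd, hld⟩ := IsReflection.exists_form T hg
  obtain ⟨z₁, rfl⟩ := T.proj_surjective x
  have hd0 : d ≠ 0 := fun h => hld (by rw [h, map_zero])
  have hfix : ∀ z, T.proj z ∈ MulAction.fixedBy T.X g ↔ l z • d ∈ T.Γ := by
    intro z
    rw [mem_fixedBy_proj, hd, add_sub_cancel_left]
  -- ε is a lower bound for the distance between two distinct values t with t d ∈ Γ.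
  obtain ⟨ε, hε, hM⟩ : ∃ ε > 0, ∀ t : ℂ, t • d ∈ T.Γ → ‖t‖ < ε → t = 0 := by
    obtain ⟨ε, hε, h⟩ := T.Γ.exists_pos_forall_norm_lt
    have hdn : 0 < ‖d‖ := norm_pos_iff.2 hd0
    refine ⟨ε / ‖d‖, div_pos hε hdn, fun t ht htn => ?_⟩
    have := h _ ht (by rw [norm_smul]; exact (lt_div_iff₀ hdn).1 htn)
    exact (smul_eq_zero.1 this).resolve_right hd0
  have hlΓ : ∀ γ ∈ T.Γ, l γ • d ∈ T.Γ := by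
    intro γ hγ
    have := sub_mem (T.smul_mem g hγ) hγ
    rwa [hd, add_sub_cancel_left] at this
  have hc := (hfix z₁).1 hx
  have hmem : ∀ z, T.proj z ∈ connectedComponentIn (MulAction.fixedBy T.X g) (T.proj z₁) ↔
      ∃ γ ∈ T.Γ, l z = l z₁ + l γ := by
    intro z
    constructor
    · intro hz
      -- U₁ consists of tubes around the translates of the hyperplane through z₁, U₂ of tubes around
      -- the remaining hyperplanes over X^g. The radius ε/2 makes their images in X disjoint, and a
      -- connected set covered by both and meeting the first lies in the first.
      let U₁ : Set V := ⋃ γ ∈ T.Γ, {z | ‖l z - (l z₁ + l γ)‖ < ε / 2}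
      let U₂ : Set V := ⋃ t ∈ {t : ℂ | t • d ∈ T.Γ ∧ ∀ γ ∈ T.Γ, t ≠ l z₁ + l γ},
        {z | ‖l z - t‖ < ε / 2}
      have ho : ∀ t : ℂ, IsOpen {z : V | ‖l z - t‖ < ε / 2} := fun t =>
        isOpen_lt (by fun_prop) continuous_const
      have hU₁ : IsOpen U₁ := isOpen_biUnion fun γ _ => ho _
      have hU₂ : IsOpen U₂ := isOpen_biUnion fun t _ => ho _
      have hdis : Disjoint (T.proj '' U₁) (T.proj '' U₂) := by
        rw [Set.disjoint_left]
        rintro _ ⟨y, hy, rfl⟩ ⟨y', hy', e⟩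
        simp only [U₁, U₂, Set.mem_iUnion, Set.mem_ofPred_eq] at hy hy'
        obtain ⟨γ, hγ, h1⟩ := hy
        obtain ⟨t, ⟨ht, ht'⟩, h2⟩ := hy'
        have hδ := T.proj_eq_iff.1 e
        refine ht' (γ + (y' - y)) (add_mem hγ hδ) ?_
        have h3 : t - (l z₁ + l (γ + (y' - y))) = 0 := by
          refine hM _ ?_ ?_
          · rw [sub_smul, add_smul]
            exact sub_mem ht (add_mem hc (hlΓ _ (add_mem hγ hδ)))
          · have : t - (l z₁ + l (γ + (y' - y))) = (l y - (l z₁ + l γ)) - (l y' - t) := by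
              simp only [map_add, map_sub]; ring
            rw [this]
            exact (norm_sub_le _ _).trans_lt (by linarith)
        exact sub_eq_zero.1 h3
      have hsub : connectedComponentIn (MulAction.fixedBy T.X g) (T.proj z₁) ⊆
          T.proj '' U₁ ∪ T.proj '' U₂ := by
        intro y hy
        obtain ⟨y, rfl⟩ := T.proj_surjective y
        have h1 := (hfix y).1 (connectedComponentIn_subset _ _ hy)
        by_cases h2 : ∃ γ ∈ T.Γ, l y = l z₁ + l γ
        · obtain ⟨γ, hγ, h3⟩ := h2
          refine Or.inl ⟨y, ?_, rfl⟩
          simp only [U₁, Set.mem_iUnion]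
          exact ⟨γ, hγ, by simp [h3, hε]⟩
        · push Not at h2
          refine Or.inr ⟨y, ?_, rfl⟩
          simp only [U₂, Set.mem_iUnion]
          exact ⟨l y, ⟨h1, h2⟩, by simp [hε]⟩
      have hz1 : T.proj z₁ ∈ T.proj '' U₁ := by
        refine ⟨z₁, ?_, rfl⟩
        simp only [U₁, Set.mem_iUnion]
        exact ⟨0, zero_mem _, by simp [hε]⟩
      obtain ⟨y, hy, e⟩ := isPreconnected_connectedComponentIn.subset_left_of_subset_union
        (T.isOpenMap_proj _ hU₁) (T.isOpenMap_proj _ hU₂) hdis hsub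
        ⟨_, mem_connectedComponentIn hx, hz1⟩ hz
      simp only [U₁, Set.mem_iUnion, Set.mem_ofPred_eq] at hy
      obtain ⟨γ, hγ, h1⟩ := hy
      have hδ := T.proj_eq_iff.1 e
      refine ⟨γ - (y - z), sub_mem hγ hδ, sub_eq_zero.1 (hM _ ?_ ?_)⟩
      · rw [sub_smul, add_smul]
        exact sub_mem ((hfix z).1 (connectedComponentIn_subset _ _ hz))
          (add_mem hc (hlΓ _ (sub_mem hγ hδ)))
      · have : l z - (l z₁ + l (γ - (y - z))) = l y - (l z₁ + l γ) := by
          simp only [map_sub]; ring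
        rw [this]; linarith
    · rintro ⟨γ, hγ, h1⟩
      -- The hyperplane through z₁ is convex, so its image is a connected subset of the fixed locus.
      let A : Set V := {y | l y = l z₁}
      have hA : Convex ℝ A := by
        intro a ha b hb s t _ _ hst
        have ha' : l a = l z₁ := ha
        have hb' : l b = l z₁ := hb
        change l (s • a + t • b) = l z₁
        rw [map_add, ← Complex.coe_smul, ← Complex.coe_smul t b, map_smul, map_smul, ha', hb',
          ← add_smul, ← Complex.ofReal_add, hst, Complex.ofReal_one, one_smul]
      have hsub : T.proj '' A ⊆ MulAction.fixedBy T.X g := by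
        rintro _ ⟨y, hy, rfl⟩
        have hy' : l y = l z₁ := hy
        rw [hfix, hy']; exact hc
      refine (hA.isPreconnected.image _ T.continuous_proj.continuousOn).subset_connectedComponentIn
        ⟨z₁, rfl, rfl⟩ hsub ⟨z - γ, ?_, ?_⟩
      · change l (z - γ) = l z₁
        rw [map_sub, h1, add_sub_cancel_right]
      · rw [proj_eq_iff]; simpa using hγ
  refine ⟨l, z₁, hl, hmem, ⟨ε, hε, fun γ hγ => hM _ (hlΓ γ hγ)⟩, fun k hk v hv => ?_, ?_⟩
  -- Both z₁ and z₁ + t v lie over H, so k moves each by a lattice vector; the difference shows t(kv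
  -- − v) ∈ Γ for every t.
  · refine sub_eq_zero.1 (T.eq_zero_of_forall_smul_mem (u := k • v - v) fun t => ?_)
    have h1 := T.smul_sub_mem_of_mem_stab hk (z := z₁) ((hmem _).2 ⟨0, zero_mem _, by simp⟩)
    have h2 := T.smul_sub_mem_of_mem_stab hk (z := z₁ + t • v)
      ((hmem _).2 ⟨0, zero_mem _, by simp [hv]⟩)
    have h3 := sub_mem h2 h1
    rw [smul_add, smul_smul_complex] at h3
    convert h3 using 1
    rw [smul_sub]; abel
  · refine ⟨g, (T.mem_stab_iff).2 fun z hz => ?_, fun h => hg.1 (by rw [h]; rfl)⟩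
    exact (T.mem_fixedBy_proj g z).1 (connectedComponentIn_subset _ _ hz)

variable {T}

namespace IsEquation

variable {H : T.Hypertorus} {l : V →L[ℂ] ℂ} {z₁ : V} (h : T.IsEquation H l z₁)

include h

/-- Discreteness of l(Γ) leaves only one of the translated hyperplanes near z₀. -/
theorem eventually_mem_iff {z₀ : V} (hz₀ : T.proj z₀ ∈ H.1) :
    ∀ᶠ z in 𝓝 z₀, T.proj z ∈ H.1 ↔ l z = l z₀ := by
  obtain ⟨ε, hε, hd⟩ := h.discrete
  obtain ⟨γ, hγ, h1⟩ := (h.mem_iff _).1 hz₀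
  have : ∀ᶠ z in 𝓝 z₀, ‖l z - l z₀‖ < ε := by
    have hc : Continuous fun z => ‖l z - l z₀‖ := by fun_prop
    exact (hc.tendsto z₀).eventually_lt_const (u := ε) (by simpa using hε)
  filter_upwards [this] with z hz
  rw [h.mem_iff]
  constructor
  · rintro ⟨δ, hδ, h2⟩
    have h3 : l z - l z₀ = l (δ - γ) := by rw [h1, h2, map_sub]; ring
    rw [h3] at hz
    rw [← sub_eq_zero, h3]
    exact hd _ (sub_mem hδ hγ) hz
  · intro h2
    exact ⟨γ, hγ, by rw [h2, h1]⟩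

theorem exists_smul_eq {g : T.W} (hg : g ∈ T.stab H) : ∃ d : V, ∀ v, g • v = v + l v • d :=
  T.exists_smul_eq_add h.ne (h.fix g hg)

/-- The determinant is 1 + l d. If it is 1, then g is unipotent of finite order. Hence the
determinant is injective on W_H. -/
theorem eq_one_of_det {g : T.W} (hg : g ∈ T.stab H)
    (hdet : LinearMap.det (g.1 : V →ₗ[ℂ] V) = 1) : g = 1 := by
  obtain ⟨d, hd⟩ := h.exists_smul_eq hg
  rw [T.det_eq_of_smul_eq_add hd, add_eq_left] at hdet
  refine Subtype.ext (LinearEquiv.ext fun v => ?_)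
  have := hd v
  rwa [T.apply_eq_zero_of_finite hd hdet v, add_zero] at this

end IsEquation

/-! ### The cyclic group W_H and its generator -/

theorem det_mul' (g k : T.W) : LinearMap.det ((g * k : T.W).1 : V →ₗ[ℂ] V) =
    LinearMap.det (g.1 : V →ₗ[ℂ] V) * LinearMap.det (k.1 : V →ₗ[ℂ] V) := by
  rw [← map_mul]; rfl

theorem eq_of_det_eq {H : T.Hypertorus} {g k : T.W} (hg : g ∈ T.stab H) (hk : k ∈ T.stab H)
    (hdet : LinearMap.det (g.1 : V →ₗ[ℂ] V) = LinearMap.det (k.1 : V →ₗ[ℂ] V)) : g = k := by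
  obtain ⟨l, z₁, h⟩ := T.exists_isEquation H
  rw [← mul_inv_eq_one]
  refine h.eq_one_of_det (mul_mem hg (inv_mem hk)) ?_
  rw [det_mul', hdet, ← det_mul', mul_inv_cancel]
  exact LinearMap.det_id

/-- The determinant embeds W_H in the group of n_H-th roots of unity; both have n_H elements, so
every root of unity is attained. -/
theorem exists_gen (H : T.Hypertorus) : ∃ g ∈ T.stab H, LinearMap.det (g.1 : V →ₗ[ℂ] V) =
    Complex.exp (2 * Real.pi * Complex.I / T.ord H) := by
  obtain ⟨l, z₁, h⟩ := T.exists_isEquation H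
  have hn : T.ord H ≠ 0 := Nat.card_pos.ne'
  have : NeZero (T.ord H) := ⟨hn⟩
  let φ : T.stab H →* ℂˣ := (LinearEquiv.det).comp ((Subgroup.subtype T.W).comp
    (Subgroup.subtype (T.stab H)))
  have hφ : ∀ g, ((φ g : ℂˣ) : ℂ) = LinearMap.det (g.1.1 : V →ₗ[ℂ] V) :=
    fun g => LinearEquiv.coe_det _
  have hinj : Function.Injective φ := fun a b hab => Subtype.ext
    (eq_of_det_eq a.2 b.2 (by rw [← hφ, ← hφ, hab]))
  have hle : φ.range ≤ rootsOfUnity (T.ord H) ℂ := by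
    rintro _ ⟨g, rfl⟩
    rw [mem_rootsOfUnity, ← map_pow]
    have : g ^ T.ord H = 1 := pow_card_eq_one'
    rw [this, map_one]
  have hcard : Nat.card φ.range = Nat.card (rootsOfUnity (T.ord H) ℂ) := by
    rw [Complex.card_rootsOfUnity, ← Nat.card_congr (MonoidHom.ofInjective hinj).toEquiv]
    rfl
  have heq : φ.range = rootsOfUnity (T.ord H) ℂ := by
    refine SetLike.coe_injective (Set.eq_of_subset_of_ncard_le hle ?_ ?_)
    · exact hcard.symm.le
    · exact Set.finite_coe_iff.1 (Nat.finite_of_card_ne_zero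
        ((Complex.card_rootsOfUnity _).trans_ne hn))
  have hprim := Complex.isPrimitiveRoot_exp (T.ord H) hn
  have hmem : (hprim.isUnit hn).unit ∈ rootsOfUnity (T.ord H) ℂ := by
    rw [mem_rootsOfUnity]; ext; simpa using hprim.pow_eq_one
  rw [← heq] at hmem
  obtain ⟨g, hg⟩ := hmem
  exact ⟨g.1, g.2, by rw [← hφ, hg]; rfl⟩

theorem gen_mem_stab (H : T.Hypertorus) : T.gen H ∈ T.stab H := by
  rw [gen, dif_pos (exists_gen H)]
  exact (exists_gen H).choose_spec.1

theorem det_gen (H : T.Hypertorus) : LinearMap.det ((T.gen H).1 : V →ₗ[ℂ] V) =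
    Complex.exp (2 * Real.pi * Complex.I / T.ord H) := by
  rw [gen, dif_pos (exists_gen H)]
  exact (exists_gen H).choose_spec.2

theorem det_gen_pow (H : T.Hypertorus) (j : ℕ) :
    LinearMap.det ((T.gen H ^ j : T.W).1 : V →ₗ[ℂ] V) =
      Complex.exp (2 * Real.pi * Complex.I / T.ord H) ^ j := by
  induction j with
  | zero => exact LinearMap.det_id
  | succ j ih => rw [pow_succ, det_mul', ih, det_gen, pow_succ]

theorem refl_mem_stab (p : T.Pairs) : T.refl p ∈ T.stab p.H := pow_mem (gen_mem_stab p.H) _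

/-- The determinant of g_H^j is the j-th power of a primitive n_H-th root of unity, and 1 ≤ j < n_H.
-/
theorem refl_ne_one (p : T.Pairs) : T.refl p ≠ 1 := by
  intro h
  have h1 := det_gen_pow p.H p.j
  rw [show T.gen p.H ^ p.j = 1 from h] at h1
  have h2 := (Complex.isPrimitiveRoot_exp (T.ord p.H) Nat.card_pos.ne').dvd_of_pow_eq_one p.j
    (h1.symm.trans LinearMap.det_id)
  exact absurd (Nat.le_of_dvd (by have := p.one_le; omega) h2) (not_le.2 p.lt_ord)

theorem one_lt_ord (H : T.Hypertorus) : 1 < T.ord H := by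
  obtain ⟨l, z₁, h⟩ := T.exists_isEquation H
  obtain ⟨g, hg, hne⟩ := h.exists_ne
  refine Finite.one_lt_card_iff_nontrivial.2 ⟨⟨g, hg⟩, 1, fun h => hne (congrArg Subtype.val h)⟩

theorem gen_ne_one (H : T.Hypertorus) : T.gen H ≠ 1 := by
  have := refl_ne_one (T := T) ⟨H, 1, le_rfl, one_lt_ord H⟩
  simpa [refl] using this

/-! ### The action of `W` on reflection hypertori -/

theorem continuous_smulX (w : T.W) : Continuous fun x : T.X => w • x := by
  have h : Continuous fun z : V => T.proj (w • z) := T.continuous_proj.comp (T.continuous_smulV w)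
  exact continuous_quot_lift _ h

/-- The action of an element of `W` on `X`, as a homeomorphism. -/
def homeo (w : T.W) : T.X ≃ₜ T.X where
  toEquiv := MulAction.toPerm w
  continuous_toFun := continuous_smulX w
  continuous_invFun := continuous_smulX w⁻¹

/-- The action of `W` on reflection hypertori. -/
def smulH (w : T.W) (H : T.Hypertorus) : T.Hypertorus :=
  ⟨(fun x => w • x) '' H.1, by
    obtain ⟨H, g, hg, x, hx, rfl⟩ := H
    refine ⟨w * g * w⁻¹, T.isReflection_conj hg, w • x, ?_, ?_⟩
    · rw [MulAction.mem_fixedBy] at hx ⊢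
      rw [mul_smul, mul_smul, inv_smul_smul, hx]
    · have h1 := (homeo w).image_connectedComponentIn hx
      have h2 : (homeo w) '' MulAction.fixedBy T.X g = MulAction.fixedBy T.X (w * g * w⁻¹) := by
        ext y
        constructor
        · rintro ⟨y, hy, rfl⟩
          change (w * g * w⁻¹) • (w • y) = w • y
          rw [mul_smul, mul_smul, inv_smul_smul, (hy : g • y = y)]
        · intro hy
          refine ⟨w⁻¹ • y, ?_, smul_inv_smul w y⟩
          have hy' : (w * g * w⁻¹) • y = y := hy
          change g • w⁻¹ • y = w⁻¹ • y
          rw [eq_inv_smul_iff, ← mul_smul, ← mul_smul]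
          exact hy'
      rw [h2] at h1
      exact h1⟩

theorem proj_mem_smulH {w : T.W} {H : T.Hypertorus} {z : V} :
    T.proj z ∈ (smulH w H).1 ↔ T.proj (w⁻¹ • z) ∈ H.1 := by
  rw [proj_smul]
  constructor
  · rintro ⟨y, hy, e⟩
    have e' : w • y = T.proj z := e
    rwa [← e', inv_smul_smul]
  · intro h
    exact ⟨_, h, smul_inv_smul w _⟩

theorem mem_stab_smulH {w g : T.W} {H : T.Hypertorus} :
    g ∈ T.stab (smulH w H) ↔ w⁻¹ * g * w ∈ T.stab H := by
  simp only [stab, mem_fixingSubgroup_iff]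
  constructor
  · intro h y hy
    have := h (w • y) ⟨y, hy, rfl⟩
    rw [mul_smul, mul_smul, this, inv_smul_smul]
  · rintro h _ ⟨y, hy, rfl⟩
    have := h y hy
    rw [mul_smul, mul_smul, inv_smul_eq_iff] at this
    exact this

theorem ord_smulH (w : T.W) (H : T.Hypertorus) : T.ord (smulH w H) = T.ord H := by
  refine Nat.card_congr
    { toFun := fun g => ⟨w⁻¹ * g.1 * w, mem_stab_smulH.1 g.2⟩
      invFun := fun g => ⟨w * g.1 * w⁻¹, mem_stab_smulH.2 (by
        have : w⁻¹ * (w * g.1 * w⁻¹) * w = g.1 := by group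
        rw [this]; exact g.2)⟩
      left_inv := fun g => Subtype.ext (by simp only; group)
      right_inv := fun g => Subtype.ext (by simp only; group) }

/-- Both sides belong to the stabilizer of wH and have the same determinant, which determines an
element of that group. -/
theorem gen_smulH (w : T.W) (H : T.Hypertorus) : T.gen (smulH w H) = w * T.gen H * w⁻¹ := by
  refine eq_of_det_eq (gen_mem_stab _) (mem_stab_smulH.2 ?_) ?_
  · have : w⁻¹ * (w * T.gen H * w⁻¹) * w = T.gen H := by group
    rw [this]; exact gen_mem_stab H
  · have h1 : LinearMap.det (w.1 : V →ₗ[ℂ] V) * LinearMap.det ((w⁻¹ : T.W).1 : V →ₗ[ℂ] V) = 1 := by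
      rw [← det_mul', mul_inv_cancel]; exact LinearMap.det_id
    rw [det_gen, ord_smulH, det_mul', det_mul', det_gen]
    linear_combination -Complex.exp (2 * Real.pi * Complex.I / T.ord H) * h1

/-- The action of `W` on the set `𝒮` of pairs `(H, j)`. -/
def smulP (w : T.W) (p : T.Pairs) : T.Pairs :=
  ⟨smulH w p.H, p.j, p.one_le, by rw [ord_smulH]; exact p.lt_ord⟩

theorem refl_smulP (w : T.W) (p : T.Pairs) : T.refl (smulP w p) = w * T.refl p * w⁻¹ := by
  change T.gen (smulH w p.H) ^ p.j = w * T.gen p.H ^ p.j * w⁻¹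
  rw [gen_smulH, conj_pow]

theorem smulP_smulP (w w' : T.W) (p : T.Pairs) : smulP w (smulP w' p) = smulP (w * w') p := by
  have : smulH w (smulH w' p.H) = smulH (w * w') p.H := by
    refine Subtype.ext ?_
    change (fun x => w • x) '' ((fun x => w' • x) '' p.H.1) = (fun x => (w * w') • x) '' p.H.1
    rw [Set.image_image]
    simp only [mul_smul]
  simp only [smulP, this]

theorem one_smulP (p : T.Pairs) : smulP (1 : T.W) p = p := by
  have : smulH (1 : T.W) p.H = p.H := by
    refine Subtype.ext ?_
    change (fun x => (1 : T.W) • x) '' p.H.1 = p.H.1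
    simp
  simp only [smulP, this]

/-- The permutation of `𝒮` defined by an element of `W`. -/
def permP (w : T.W) : T.Pairs ≃ T.Pairs where
  toFun := smulP w
  invFun := smulP w⁻¹
  left_inv p := by rw [smulP_smulP, inv_mul_cancel, one_smulP]
  right_inv p := by rw [smulP_smulP, mul_inv_cancel, one_smulP]

theorem IsInvariant.apply_smulP {C : T.Pairs → ℂ} (hC : T.IsInvariant C) (w : T.W)
    (p : T.Pairs) : C (smulP w p) = C p := hC p (smulP w p) w rfl rfl

end TorusAction

namespace TorusAction

variable {V : Type u} [NormedAddCommGroup V] [NormedSpace ℂ V] {T : TorusAction V}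

/-! ### Multipliers -/

theorem mult_ne_zero (α : AntiDual V) (v : V) : mult α v ≠ 0 := Complex.exp_ne_zero _

theorem norm_mult (α : AntiDual V) (v : V) : ‖mult α v‖ = 1 := by
  have : (2 * Real.pi * Complex.I * ((α v).im : ℂ)) =
      ((2 * Real.pi * (α v).im : ℝ) : ℂ) * Complex.I := by push_cast; ring
  rw [mult, this, Complex.norm_exp_ofReal_mul_I]

theorem mult_add_right (α : AntiDual V) (u v : V) : mult α (u + v) = mult α u * mult α v := by
  rw [mult, mult, mult, ← Complex.exp_add]
  congr 1
  simp only [map_add, Complex.add_im, Complex.ofReal_add]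
  ring

theorem mult_zero_right (α : AntiDual V) : mult α 0 = 1 := by simp [mult]

theorem mult_neg_left (α : AntiDual V) (v : V) : mult (-α) v = (mult α v)⁻¹ := by
  refine eq_inv_of_mul_eq_one_left ?_
  rw [← mult_add_left, neg_add_cancel, mult_zero_left]

theorem mult_neg_right (α : AntiDual V) (v : V) : mult α (-v) = (mult α v)⁻¹ := by
  refine eq_inv_of_mul_eq_one_left ?_
  rw [← mult_add_right, neg_add_cancel, mult_zero_right]

theorem mult_sub_left (α β : AntiDual V) (v : V) : mult (α - β) v = mult α v / mult β v := by
  rw [sub_eq_add_neg, mult_add_left, mult_neg_left, div_eq_mul_inv]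

theorem mult_sub_right (α : AntiDual V) (u v : V) : mult α (u - v) = mult α u / mult α v := by
  rw [sub_eq_add_neg, mult_add_right, mult_neg_right, div_eq_mul_inv]

theorem dualAct_apply (w : T.W) (α : AntiDual V) (v : V) : T.dualAct w α v = α (w⁻¹ • v) := rfl

theorem mult_dualAct (w : T.W) (α : AntiDual V) (v : V) :
    mult (T.dualAct w α) v = mult α (w⁻¹ • v) := rfl

theorem dualAct_mul (w w' : T.W) (α : AntiDual V) :
    T.dualAct (w * w') α = T.dualAct w (T.dualAct w' α) := by
  ext v
  rw [dualAct_apply, dualAct_apply, dualAct_apply, mul_inv_rev, mul_smul]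

theorem dualAct_neg (w : T.W) (α : AntiDual V) : T.dualAct w (-α) = -T.dualAct w α := rfl

theorem dualAct_sub (w : T.W) (α β : AntiDual V) :
    T.dualAct w (α - β) = T.dualAct w α - T.dualAct w β := rfl

theorem exists_mult_ne_one {β : AntiDual V} (h : β ∉ T.dualLattice) :
    ∃ γ ∈ T.Γ, mult β γ ≠ 1 := by
  by_contra! H
  refine h fun γ hγ => ?_
  obtain ⟨n, hn⟩ := Complex.exp_eq_one_iff.1 (H γ hγ)
  refine ⟨n, ?_⟩
  have h2 : (2 * Real.pi * Complex.I : ℂ) ≠ 0 := Complex.two_pi_I_ne_zero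
  have h3 : ((β γ).im : ℂ) = n := by
    apply mul_left_cancel₀ h2
    rw [hn, mul_comm]
  exact_mod_cast h3

theorem dualAct_mem_dualLattice {w : T.W} {β : AntiDual V} (h : β ∈ T.dualLattice) :
    T.dualAct w β ∈ T.dualLattice := fun _ hγ => h _ (T.smul_mem w⁻¹ hγ)

/-- If r fixed the class of uα, then u⁻¹ r u would fix the class of α. So the hypothesis on L passes
to every L^u, and all Dunkl forms occurring in ρ exist and are unique. -/
theorem HasTrivialStabilizer.sub_dualAct_notMem {α : AntiDual V} (hα : T.HasTrivialStabilizer α)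
    (u : T.W) {r : T.W} (hr : r ≠ 1) :
    T.dualAct u α - T.dualAct r (T.dualAct u α) ∉ T.dualLattice := by
  intro h
  refine hα (u⁻¹ * r * u) (fun e => hr ?_) ?_
  · have : r = u * (u⁻¹ * r * u) * u⁻¹ := by group
    rw [this, e]; group
  · have := dualAct_mem_dualLattice (w := u⁻¹) h
    rw [dualAct_sub, ← dualAct_mul, ← dualAct_mul, ← dualAct_mul, inv_mul_cancel] at this
    convert this using 2
    ext v; simp [dualAct_apply]

/-- The multiplication by an element of `W`, as a continuous linear map. -/
noncomputable def actL [FiniteDimensional ℂ V] (w : T.W) : V →L[ℂ] V :=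
  LinearMap.toContinuousLinearMap (w.1 : V →ₗ[ℂ] V)

variable [FiniteDimensional ℂ V]

theorem actL_apply (w : T.W) (v : V) : actL w v = w • v := rfl

/-! ### Points with trivial stabilizer -/

/-- The points of `V` whose images in `X` have trivial stabilizers in `W`. -/
def IsFree (T : TorusAction V) (z : V) : Prop := ∀ g : T.W, g ≠ 1 → g • z - z ∉ T.Γ

/-- By Baire: the excluded set is a countable union of closed affine subspaces g z − z = γ with g ≠
1, none of which has an interior point. -/
theorem dense_isFree (T : TorusAction V) : Dense {z | T.IsFree z} := by
  have : FiniteDimensional ℝ V := FiniteDimensional.complexToReal V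
  have : CompleteSpace V := FiniteDimensional.complete ℂ V
  have hcount : Countable T.Γ := inferInstance
  have e : {z | T.IsFree z} = ⋂ p : {g : T.W // g ≠ 1} × T.Γ, {z | p.1.1 • z - z ≠ p.2.1} := by
    ext z
    simp only [Set.mem_ofPred_eq, Set.mem_iInter, IsFree]
    exact ⟨fun h p hp => h p.1.1 p.1.2 (hp ▸ p.2.2), fun h g hg hz => h (⟨g, hg⟩, ⟨_, hz⟩) rfl⟩
  rw [e]
  refine dense_iInter_of_isOpen (fun p => ?_) fun p => ?_
  · exact isOpen_ne_fun ((T.continuous_smulV p.1.1).sub continuous_id) continuous_const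
  · obtain ⟨⟨g, hg⟩, γ⟩ := p
    rw [show {z : V | g • z - z ≠ γ.1} = {z : V | g • z - z = γ.1}ᶜ from rfl,
      ← interior_eq_empty_iff_dense_compl, Set.eq_empty_iff_forall_notMem]
    intro z hz
    refine hg (Subtype.ext (LinearEquiv.ext fun u => ?_))
    have hc : Continuous fun t : ℂ => z + t • u := by fun_prop
    have h1 : ∀ᶠ t in 𝓝 (0 : ℂ), g • (z + t • u) - (z + t • u) = γ.1 := by
      have h2 := mem_interior_iff_mem_nhds.1 hz
      have h3 := hc.tendsto 0
      rw [zero_smul, add_zero] at h3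
      exact h3.eventually h2
    obtain ⟨t, ht, ht0⟩ := ((h1.filter_mono nhdsWithin_le_nhds).and
      (self_mem_nhdsWithin (a := (0 : ℂ)) (s := {0}ᶜ))).exists
    have h0 : g • z - z = γ.1 := by simpa using h1.self_of_nhds
    rw [smul_add, smul_smul_complex] at ht
    have h4 : t • (g • u - u) = 0 := by
      rw [smul_sub]
      have : t • g • u - t • u = (g • z + t • g • u - (z + t • u)) - (g • z - z) := by abel
      rw [this, ht, h0, sub_self]
    exact sub_eq_zero.1 ((smul_eq_zero.1 h4).resolve_left ht0)

theorem IsFree.notMem {z : V} (hz : T.IsFree z) (H : T.Hypertorus) : T.proj z ∉ H.1 := by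
  obtain ⟨l, z₁, h⟩ := T.exists_isEquation H
  obtain ⟨g, hg, hne⟩ := h.exists_ne
  exact fun h => hz g hne (T.smul_sub_mem_of_mem_stab hg h)

theorem IsFree.mem_reg {z : V} (hz : T.IsFree z) : T.proj z ∈ T.reg := fun H => hz.notMem H

theorem dense_notMem (H : T.Hypertorus) : Dense (T.proj ⁻¹' H.1)ᶜ :=
  T.dense_isFree.mono fun _ hz => IsFree.notMem hz H

theorem dense_reg (T : TorusAction V) : Dense (T.proj ⁻¹' T.reg) :=
  T.dense_isFree.mono fun _ hz => IsFree.mem_reg hz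

/-- If points over H accumulated at z₀ outside, two of them would have distinct values of l at
distance less than ε. That difference lies in l(Γ), against the separation of its elements. -/
theorem isClosed_hypertorus (H : T.Hypertorus) : IsClosed (T.proj ⁻¹' H.1) := by
  obtain ⟨l, z₁, h⟩ := T.exists_isEquation H
  obtain ⟨ε, hε, hd⟩ := h.discrete
  rw [← isOpen_compl_iff, isOpen_iff_mem_nhds]
  intro z₀ hz₀
  by_contra hcon
  have hfr : ∃ᶠ z in 𝓝 z₀, T.proj z ∈ H.1 := by
    intro h1
    refine hcon ?_
    filter_upwards [h1] with z hz using hz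
  have hc : Continuous fun z => ‖l z - l z₀‖ := by fun_prop
  have hsmall : ∀ δ > 0, ∃ z, T.proj z ∈ H.1 ∧ ‖l z - l z₀‖ < δ := by
    intro δ hδ
    exact (hfr.and_eventually ((hc.tendsto z₀).eventually_lt_const (u := δ) (by simpa using hδ))).exists
  obtain ⟨z, hz, hzd⟩ := hsmall (ε / 2) (by linarith)
  have hne : l z - l z₀ ≠ 0 := by
    intro h0
    refine hz₀ ((h.mem_iff z₀).2 ?_)
    rw [← sub_eq_zero.1 h0]
    exact (h.mem_iff z).1 hz
  obtain ⟨y, hy, hyd⟩ := hsmall (min (ε / 2) ‖l z - l z₀‖)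
    (lt_min (by linarith) (norm_pos_iff.2 hne))
  obtain ⟨γ, hγ, e1⟩ := (h.mem_iff z).1 hz
  obtain ⟨δ, hδ, e2⟩ := (h.mem_iff y).1 hy
  have e3 : l (γ - δ) = l z - l y := by rw [e1, e2, map_sub]; ring
  have e4 : l (γ - δ) = 0 := by
    refine hd _ (sub_mem hγ hδ) ?_
    rw [e3, show l z - l y = (l z - l z₀) - (l y - l z₀) by ring]
    exact (norm_sub_le _ _).trans_lt (by linarith [lt_min_iff.1 hyd])
  rw [e3, sub_eq_zero] at e4
  rw [← e4] at hyd
  exact absurd (lt_min_iff.1 hyd).2 (lt_irrefl _)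

/-! ### Logarithmic poles -/

/-- A logarithmic pole on a reflection hypertorus, in terms of a linear equation. -/
theorem LogPoleAt.exists_linear {H : T.Hypertorus} {l : V →L[ℂ] ℂ} {z₁ : V}
    (h : T.IsEquation H l z₁) {z₀ : V} (hz₀ : T.proj z₀ ∈ H.1) {r : ℂ} {η : V → V →L[ℂ] ℂ}
    (hη : LogPoleAt (T.proj ⁻¹' H.1) r η z₀) :
    ∃ η' : V → V →L[ℂ] ℂ, AnalyticAt ℂ η' z₀ ∧
      ∀ᶠ z in 𝓝 z₀, T.proj z ∉ H.1 → η z = (r / (l z - l z₀)) • l + η' z := by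
  obtain ⟨m, η', hm, hm', hS, hη', he⟩ := hη
  -- The local equation m vanishes on the hyperplane, so m = (l − l z₀) q, and q(z₀) ≠ 0 because
  -- dm(z₀) ≠ 0. Then dm/m = dl/(l − l z₀) + dq/q, whose last term joins the regular part.
  obtain ⟨q, hq, hmq⟩ := hm.exists_eq_linear_mul h.ne (by
    filter_upwards [hS, h.eventually_mem_iff hz₀] with z h1 h2 h3
    exact h1.1 (h2.2 h3))
  have hfd : ∀ᶠ z in 𝓝 z₀, fderiv ℂ m z = (l z - l z₀) • fderiv ℂ q z + q z • l := by
    filter_upwards [hmq.eventually_nhds, hq.eventually_analyticAt] with z h1 h2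
    have h1' : m =ᶠ[𝓝 z] fun y => (l y - l z₀) * q y := h1
    rw [h1'.fderiv_eq, fderiv_fun_mul (by fun_prop) h2.differentiableAt, fderiv_sub_const,
      ContinuousLinearMap.fderiv]
  have hq0 : q z₀ ≠ 0 := by
    intro h0
    have := hfd.self_of_nhds
    refine hm' (this.trans (ContinuousLinearMap.ext fun v => ?_))
    simp [h0]
  refine ⟨fun z => η' z + (r / q z) • fderiv ℂ q z, hη'.fun_add
    ((analyticAt_const.div hq hq0).smul hq.fderiv), ?_⟩
  filter_upwards [hfd, hmq, he, h.eventually_mem_iff hz₀, hq.continuousAt.eventually_ne hq0]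
    with z h1 h2 h3 h4 h5 hz
  have h6 : l z - l z₀ ≠ 0 := fun h0 => hz (h4.2 (sub_eq_zero.1 h0))
  rw [h3 hz, h1, h2]
  ext v
  simp only [add_apply, smul_apply, smul_eq_mul]
  field_simp
  ring

/-- The residues prescribed for f and f' agree, so the difference extends to an entire function with
the multipliers of a nontrivial bundle, and such a function is zero. -/
theorem IsDunklForm.eq {α : AntiDual V} {p : T.Pairs} {f f' : V → V →L[ℂ] ℂ}
    (hα : α - T.dualAct (T.refl p) α ∉ T.dualLattice) (hf : T.IsDunklForm α p f)
    (hf' : T.IsDunklForm α p f') {z : V} (hz : T.proj z ∉ p.H.1) : f z = f' z := by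
  obtain ⟨l, z₁, h⟩ := T.exists_isEquation p.H
  obtain ⟨Q, hQ, hQ', -⟩ := exists_analytic_extension (Ω := Set.univ) (dense_notMem p.H)
    (G := fun z => f z - f' z) (fun z₀ _ => by
      by_cases hz₀ : T.proj z₀ ∈ p.H.1
      · obtain ⟨η, hη, e⟩ := LogPoleAt.exists_linear h hz₀ (hf.residue z₀ hz₀)
        obtain ⟨η', hη', e'⟩ := LogPoleAt.exists_linear h hz₀ (hf'.residue z₀ hz₀)
        refine ⟨fun z => η z - η' z, hη.fun_sub hη', ?_⟩
        filter_upwards [e, e'] with z h1 h2 h3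
        rw [h1 h3, h2 h3]; abel
      · exact ⟨_, (hf.hol z₀ hz₀).fun_sub (hf'.hol z₀ hz₀), Eventually.of_forall fun _ _ => rfl⟩)
  obtain ⟨γ, hγ, hne⟩ := exists_mult_ne_one hα
  have hmul : ∀ z, ∀ γ ∈ T.Γ, Q (z + γ) = TorusAction.mult (α - T.dualAct (T.refl p) α) γ • Q z := by
    intro z γ hγ
    have hc : Continuous Q := continuousOn_univ.1 hQ.continuousOn
    have := Continuous.ext_on (dense_notMem p.H) (f := fun z => Q (z + γ))
      (g := fun z => TorusAction.mult (α - T.dualAct (T.refl p) α) γ • Q z) (by fun_prop) (by fun_prop)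
      fun z hz => by
        have hz' : T.proj z ∉ p.H.1 := hz
        have hz2 : T.proj (z + γ) ∉ p.H.1 := by rwa [T.proj_add hγ]
        simp only
        rw [hQ' z trivial hz, hQ' _ trivial hz2, hf.mult z hz' γ hγ, hf'.mult z hz' γ hγ,
          smul_sub]
    exact congrFun this z
  have h0 := T.eq_zero_of_multiplier hQ (fun γ _ => norm_mult _ γ) hmul hγ hne z
  rw [hQ' z trivial hz] at h0
  exact sub_eq_zero.1 h0

/-! ### Existence of the Dunkl forms -/

/-- g_H is the identity plus l ⊗ d with d ≠ 0, so its fixed vectors lie in ker l. It follows that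
multiples of l take values in V_H^*. -/
theorem IsEquation.apply_eq_zero_of_gen {H : T.Hypertorus} {l : V →L[ℂ] ℂ} {z₁ : V}
    (h : T.IsEquation H l z₁) {v : V} (hv : T.gen H • v = v) : l v = 0 := by
  obtain ⟨d, hd⟩ := h.exists_smul_eq (gen_mem_stab H)
  rw [hd, add_eq_left, smul_eq_zero] at hv
  refine hv.resolve_right fun h0 => gen_ne_one H (Subtype.ext (LinearEquiv.ext fun x => ?_))
  have := hd x
  rwa [h0, smul_zero, add_zero] at this

theorem IsEquation.inv_smul_eq {H : T.Hypertorus} {l : V →L[ℂ] ℂ} {z₁ : V}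
    (h : T.IsEquation H l z₁) {g : T.W} (hg : g ∈ T.stab H) {v : V} (hv : l v = 0) :
    g⁻¹ • v = v := h.fix _ (inv_mem hg) v hv

/-- The Dunkl form as a function of the equation of the hypertorus. -/
theorem IsEquation.exists_dunklForm {p : T.Pairs} {l : V →L[ℂ] ℂ} {z₁ : V}
    (h : T.IsEquation p.H l z₁) {α : AntiDual V}
    (hα : α - T.dualAct (T.refl p) α ∉ T.dualLattice) :
    ∃ F : ℂ → ℂ, T.IsDunklForm α p (fun z => F (l z) • l) ∧
      (∀ z, T.proj z ∉ p.H.1 → AnalyticAt ℂ F (l z)) ∧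
      ∀ z₀, T.proj z₀ ∈ p.H.1 → ∃ k : ℂ → ℂ, AnalyticAt ℂ k (l z₀) ∧ ∀ᶠ t in 𝓝 (l z₀),
        F t = mult α (z₀ - (T.refl p)⁻¹ • z₀) / (t - l z₀) + k t := by
  obtain ⟨e, he⟩ : ∃ e, l e = 1 := by
    obtain ⟨x, hx⟩ : ∃ x, l x ≠ 0 := by
      by_contra! H
      exact h.ne (ContinuousLinearMap.ext H)
    exact ⟨(l x)⁻¹ • x, by simp [hx]⟩
  set r := T.refl p with hr
  have hrs : r ∈ T.stab p.H := refl_mem_stab p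
  set β := α - T.dualAct r α with hβ
  -- Elements of W_H fix ker l pointwise, so χ_β factors through l; the resulting character of ℂ is
  -- κ.
  have hβ0 : ∀ v, l v = 0 → β v = 0 := by
    intro v hv
    rw [hβ, LinearMap.sub_apply, dualAct_apply, h.inv_smul_eq hrs hv, sub_self]
  let κ : ℂ → ℂ := fun t => mult β (t • e)
  have hκ : ∀ v, mult β v = κ (l v) := by
    intro v
    have : v = (v - l v • e) + l v • e := by abel
    rw [this, mult_add_right]
    have h0 : mult β (v - l v • e) = 1 := by
      rw [mult, hβ0 _ (by simp [he])]; simp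
    rw [h0, one_mul]
    simp [κ]
  -- l(Γ) is a lattice in ℂ: it is discrete by the separation of the values of l, and it spans
  -- because Γ spans V over ℝ and l is onto.
  let Λ : Submodule ℤ ℂ := T.Γ.map (l.toLinearMap.restrictScalars ℤ)
  have hΛ : DiscreteTopology Λ := by
    obtain ⟨ε, hε, hd⟩ := h.discrete
    refine DiscreteTopology.of_forall_le_norm (E := Λ) hε ?_
    rintro ⟨_, γ, hγ, rfl⟩ hne
    by_contra hlt
    exact hne (Subtype.ext (hd γ hγ (not_le.1 hlt)))
  have hΛ' : IsZLattice ℝ Λ := by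
    refine ⟨?_⟩
    have e1 : (Λ : Set ℂ) = (l.toLinearMap.restrictScalars ℝ) '' (T.Γ : Set V) := rfl
    rw [e1, Submodule.span_image, T.isLattice.span_top, Submodule.map_top, LinearMap.range_eq_top]
    intro t
    exact ⟨t • e, by simp [he]⟩
  obtain ⟨γ₀, hγ₀, hne⟩ := exists_mult_ne_one hα
  obtain ⟨F, hF, hmul, hres⟩ := KroneckerFunction.exists_quasiPeriodic Λ (κ := κ)
    (fun t => norm_mult _ _) (fun s t => by simp only [κ, add_smul, mult_add_right])
    (g₀ := l γ₀) ⟨γ₀, hγ₀, rfl⟩ (by rwa [← hκ])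
  -- F has residue κ(0) = 1 at 0, so c makes the residue at z₁ the prescribed one.
  let c := mult α (z₁ - r⁻¹ • z₁)
  let F' : ℂ → ℂ := fun t => c * F (t - l z₁)
  have hF' : ∀ z, T.proj z ∉ p.H.1 → AnalyticAt ℂ F' (l z) := by
    intro z hz
    refine analyticAt_const.mul (AnalyticAt.fun_comp (g := F) (f := fun t => t - l z₁) (hF _ ?_) (by fun_prop))
    rintro ⟨γ, hγ, e⟩
    refine hz ((h.mem_iff z).2 ⟨γ, hγ, ?_⟩)
    have e' : l γ = l z - l z₁ := e
    rw [e']; ring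
  have hres' : ∀ z₀, T.proj z₀ ∈ p.H.1 → ∃ k : ℂ → ℂ, AnalyticAt ℂ k (l z₀) ∧
      ∀ᶠ t in 𝓝 (l z₀), F' t = mult α (z₀ - r⁻¹ • z₀) / (t - l z₀) + k t := by
    intro z₀ hz₀
    obtain ⟨γ, hγ, e0⟩ := (h.mem_iff z₀).1 hz₀
    have e1 : l z₀ - l z₁ = l γ := by rw [e0]; ring
    obtain ⟨k, hk, hk'⟩ := hres (l z₀ - l z₁) ⟨γ, hγ, e1.symm⟩
    refine ⟨fun t => c * k (t - l z₁), analyticAt_const.mul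
      (AnalyticAt.fun_comp (g := k) (f := fun t => t - l z₁) hk (by fun_prop)), ?_⟩
    have hc : Tendsto (fun t => t - l z₁) (𝓝 (l z₀)) (𝓝 (l z₀ - l z₁)) :=
      (continuous_id.sub continuous_const).tendsto _
    filter_upwards [hc.eventually hk'] with t ht
    -- The prescribed residues at z₀ and z₁ differ exactly by the multiplier of F: z₀ − z₁ − γ lies
    -- in ker l, so it is fixed by r⁻¹.
    have e2 : mult α (z₀ - r⁻¹ • z₀) = c * κ (l z₀ - l z₁) := by
      rw [e1, ← hκ, hβ, mult_sub_left, mult_dualAct, ← mult_sub_right, ← mult_add_right]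
      congr 1
      have e3 := h.inv_smul_eq hrs (v := z₀ - z₁ - γ) (by rw [map_sub, map_sub, e1, sub_self])
      rw [smul_sub, smul_sub] at e3
      have e4 : r⁻¹ • z₀ = z₀ - z₁ - γ + r⁻¹ • γ + r⁻¹ • z₁ := by rw [← e3]; abel
      rw [e4]; abel
    simp only [F', ht, e2, sub_sub_sub_cancel_right]
    ring
  refine ⟨F', ⟨fun z v hv => ?_, fun z hz => ?_, fun z hz γ hγ => ?_, fun z₀ hz₀ => ?_⟩, hF', hres'⟩
  · rw [smul_apply, h.apply_eq_zero_of_gen hv, smul_zero]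
  · exact (AnalyticAt.fun_comp (g := F') (f := fun z => l z) (hF' z hz) (l.analyticAt z)).smul
      analyticAt_const
  · rw [smul_smul, hκ, map_add]
    congr 1
    simp only [F']
    rw [add_sub_right_comm, hmul _ (l γ) ⟨γ, hγ, rfl⟩]
    ring
  · obtain ⟨k, hk, hk'⟩ := hres' z₀ hz₀
    refine ⟨fun z => l z - l z₀, fun z => k (l z) • l,
      (l.analyticAt z₀).fun_sub analyticAt_const, ?_, ?_, ?_, ?_⟩
    · rw [fderiv_sub_const, ContinuousLinearMap.fderiv]; exact h.ne
    · filter_upwards [h.eventually_mem_iff hz₀] with z hz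
      rw [sub_eq_zero]; exact hz
    · exact (AnalyticAt.fun_comp (g := k) (f := fun z => l z) hk (l.analyticAt z₀)).smul
        analyticAt_const
    · filter_upwards [(l.continuous.tendsto z₀).eventually hk'] with z hz _
      rw [hz, fderiv_sub_const, ContinuousLinearMap.fderiv]
      exact add_smul _ _ l

theorem isDunklForm_dunklForm {p : T.Pairs} {α : AntiDual V}
    (hα : α - T.dualAct (T.refl p) α ∉ T.dualLattice) : T.IsDunklForm α p (T.dunklForm α p) := by
  obtain ⟨l, z₁, h⟩ := T.exists_isEquation p.H
  obtain ⟨F, hF, -⟩ := h.exists_dunklForm hα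
  have hex : ∃ f, T.IsDunklForm α p f := ⟨_, hF⟩
  rw [dunklForm, dif_pos hex]
  exact hex.choose_spec

/-- Description of the Dunkl form by a function of one variable. -/
theorem IsEquation.exists_dunklForm_eq {p : T.Pairs} {l : V →L[ℂ] ℂ} {z₁ : V}
    (h : T.IsEquation p.H l z₁) {α : AntiDual V}
    (hα : α - T.dualAct (T.refl p) α ∉ T.dualLattice) :
    ∃ F : ℂ → ℂ, (∀ z, T.proj z ∉ p.H.1 → T.dunklForm α p z = F (l z) • l) ∧
      (∀ z, T.proj z ∉ p.H.1 → AnalyticAt ℂ F (l z)) ∧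
      ∀ z₀, T.proj z₀ ∈ p.H.1 → ∃ k : ℂ → ℂ, AnalyticAt ℂ k (l z₀) ∧ ∀ᶠ t in 𝓝 (l z₀),
        F t = mult α (z₀ - (T.refl p)⁻¹ • z₀) / (t - l z₀) + k t := by
  obtain ⟨F, hF, h1, h2⟩ := h.exists_dunklForm hα
  exact ⟨F, fun z hz => (isDunklForm_dunklForm hα).eq hα hF hz, h1, h2⟩

theorem LogPoleAt.comp_actL {w : T.W} {H : T.Hypertorus} {r : ℂ} {f : V → V →L[ℂ] ℂ} {z₀ : V}
    (h : LogPoleAt (T.proj ⁻¹' H.1) r f (w⁻¹ • z₀)) :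
    LogPoleAt (T.proj ⁻¹' (smulH w H).1) r (fun z => (f (w⁻¹ • z)).comp (actL w⁻¹)) z₀ := by
  obtain ⟨l, η, hl, hl', hS, hη, he⟩ := h
  have hc : Tendsto (fun z : V => w⁻¹ • z) (𝓝 z₀) (𝓝 (w⁻¹ • z₀)) :=
    (T.continuous_smulV w⁻¹).tendsto z₀
  have hfd : ∀ z : V, DifferentiableAt ℂ l (w⁻¹ • z) →
      fderiv ℂ (fun z => l (w⁻¹ • z)) z = (fderiv ℂ l (w⁻¹ • z)).comp (actL w⁻¹) := by
    intro z hz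
    exact (hz.hasFDerivAt.comp z ((actL w⁻¹).hasFDerivAt (x := z))).fderiv
  refine ⟨fun z => l (w⁻¹ • z), fun z => (η (w⁻¹ • z)).comp (actL w⁻¹),
    hl.fun_comp (T.analytic_smulV w⁻¹ z₀), ?_, ?_, ?_, ?_⟩
  · rw [hfd z₀ hl.differentiableAt]
    intro h0
    refine hl' (ContinuousLinearMap.ext fun v => ?_)
    have := congrArg (fun k : V →L[ℂ] ℂ => k (w • v)) h0
    simpa [actL_apply] using this
  · filter_upwards [hc.eventually hS] with z hz
    rw [← hz]
    exact proj_mem_smulH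
  · exact (((ContinuousLinearMap.compL ℂ V V ℂ).flip (actL w⁻¹)).analyticAt _).fun_comp
      (hη.fun_comp (T.analytic_smulV w⁻¹ z₀))
  · filter_upwards [hc.eventually he, hc.eventually hl.eventually_analyticAt] with z hz hz' hz2
    rw [hz fun h => hz2 (proj_mem_smulH.2 h), hfd z hz'.differentiableAt,
      ContinuousLinearMap.add_comp, ContinuousLinearMap.smul_comp]

/-- Since g_{wH} = w g_H w⁻¹, transport by w matches values, multipliers and residues. Together with
uniqueness this makes the Dunkl forms equivariant. -/
theorem IsDunklForm.smul {α : AntiDual V} {p : T.Pairs} {f : V → V →L[ℂ] ℂ}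
    (hf : T.IsDunklForm α p f) (w : T.W) :
    T.IsDunklForm (T.dualAct w α) (smulP w p) (fun z => (f (w⁻¹ • z)).comp (actL w⁻¹)) where
  values z v hv := by
    refine hf.values _ _ ?_
    change T.gen (smulH w p.H) • v = v at hv
    rw [gen_smulH, mul_smul, mul_smul] at hv
    change T.gen p.H • w⁻¹ • v = w⁻¹ • v
    rw [eq_inv_smul_iff]
    exact hv
  hol z hz := by
    have h1 : AnalyticAt ℂ f (w⁻¹ • z) := hf.hol _ fun h => hz (proj_mem_smulH.2 h)
    exact (((ContinuousLinearMap.compL ℂ V V ℂ).flip (actL w⁻¹)).analyticAt _).fun_comp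
      (h1.fun_comp (T.analytic_smulV w⁻¹ z))
  mult z hz γ hγ := by
    have h1 := hf.mult (w⁻¹ • z) (fun h => hz (proj_mem_smulH.2 h)) (w⁻¹ • γ) (T.smul_mem w⁻¹ hγ)
    rw [smul_add, h1, ContinuousLinearMap.smul_comp, refl_smulP, ← dualAct_mul]
    congr 1
    rw [mult_sub_left, mult_sub_left, mult_dualAct, mult_dualAct, mult_dualAct]
    congr 2
    rw [← mul_smul]
    congr 1
    group
  residue z₀ hz₀ := by
    have h1 := LogPoleAt.comp_actL (hf.residue _ (proj_mem_smulH.1 hz₀))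
    have h2 : TorusAction.mult (T.dualAct w α) (z₀ - (T.refl (smulP w p))⁻¹ • z₀) =
        TorusAction.mult α (w⁻¹ • z₀ - (T.refl p)⁻¹ • w⁻¹ • z₀) := by
      rw [mult_dualAct, refl_smulP, smul_sub]
      congr 2
      rw [← mul_smul, ← mul_smul]
      congr 1
      group
    rw [h2]
    exact h1

/-- Equivariance of the Dunkl forms. -/
theorem dunklForm_smulP {α : AntiDual V} {p : T.Pairs}
    (hα : α - T.dualAct (T.refl p) α ∉ T.dualLattice) (w : T.W) {z : V} (hz : T.proj z ∉ p.H.1)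
    (v : V) : T.dunklForm (T.dualAct w α) (smulP w p) (w • z) (w • v) = T.dunklForm α p z v := by
  have h1 : T.dualAct w α - T.dualAct (T.refl (smulP w p)) (T.dualAct w α) ∉ T.dualLattice := by
    intro h
    refine hα ?_
    have := dualAct_mem_dualLattice (w := w⁻¹) h
    rw [dualAct_sub, refl_smulP, ← dualAct_mul, ← dualAct_mul, ← dualAct_mul, inv_mul_cancel] at this
    convert this using 2
    congr 1
    group
  have h2 := (isDunklForm_dunklForm h1).eq h1 ((isDunklForm_dunklForm hα).smul w) (z := w • z)
    (fun h => hz (by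
      have := proj_mem_smulH.1 h
      rwa [inv_smul_smul] at this))
  rw [h2, inv_smul_smul, ContinuousLinearMap.comp_apply, actL_apply, inv_smul_smul]

end TorusAction

namespace TorusAction

variable {V : Type u} [NormedAddCommGroup V] [NormedSpace ℂ V] {T : TorusAction V}
  [FiniteDimensional ℂ V]

/-! ### Local equations of the reflection hypertori -/

/-- A linear form defining the reflection hypertorus `H`. -/
noncomputable def linForm (H : T.Hypertorus) : V →L[ℂ] ℂ := (T.exists_isEquation H).choose

theorem exists_isEquation_linForm (H : T.Hypertorus) : ∃ z₁, T.IsEquation H (linForm H) z₁ :=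
  (T.exists_isEquation H).choose_spec

theorem linForm_ne_zero (H : T.Hypertorus) : linForm H ≠ 0 := by
  obtain ⟨z₁, h⟩ := exists_isEquation_linForm H
  exact h.ne

theorem inv_smul_eq_of_linForm {H : T.Hypertorus} {g : T.W} (hg : g ∈ T.stab H) {v : V}
    (hv : linForm H v = 0) : g⁻¹ • v = v := by
  obtain ⟨z₁, h⟩ := exists_isEquation_linForm H
  exact h.inv_smul_eq hg hv

theorem exists_inv_smul_eq {H : T.Hypertorus} {g : T.W} (hg : g ∈ T.stab H) :
    ∃ d : V, ∀ v, g⁻¹ • v = v + linForm H v • d := by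
  obtain ⟨z₁, h⟩ := exists_isEquation_linForm H
  exact h.exists_smul_eq (inv_mem hg)

theorem mem_iff_of_mem {H : T.Hypertorus} {z₀ : V} (hz₀ : T.proj z₀ ∈ H.1) (z : V) :
    T.proj z ∈ H.1 ↔ ∃ γ ∈ T.Γ, linForm H z = linForm H z₀ + linForm H γ := by
  obtain ⟨z₁, h⟩ := exists_isEquation_linForm H
  obtain ⟨δ, hδ, e⟩ := (h.mem_iff z₀).1 hz₀
  rw [h.mem_iff, e]
  constructor
  · rintro ⟨γ, hγ, e'⟩
    exact ⟨γ - δ, sub_mem hγ hδ, by rw [e', map_sub]; ring⟩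
  · rintro ⟨γ, hγ, e'⟩
    exact ⟨δ + γ, add_mem hδ hγ, by rw [e', map_add]; ring⟩

/-- Two different hypertori through a point have non-proportional equations. -/
theorem exists_linForm_ne {H H' : T.Hypertorus} {z₀ : V} (h : T.proj z₀ ∈ H.1)
    (h' : T.proj z₀ ∈ H'.1) (hne : H ≠ H') : ∃ v, linForm H v = 0 ∧ linForm H' v ≠ 0 := by
  -- Proportional equations give the same hyperplane through z₀, hence the same union of
  -- Γ-translates.
  by_contra! hcon
  obtain ⟨c, hc⟩ : ∃ c : ℂ, ∀ v, linForm H' v = c * linForm H v := by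
    obtain ⟨x, hx⟩ : ∃ x, linForm H x ≠ 0 := by
      by_contra! H0
      exact linForm_ne_zero H (ContinuousLinearMap.ext H0)
    refine ⟨linForm H' x / linForm H x, fun v => ?_⟩
    have := hcon (v - (linForm H v / linForm H x) • x) (by simp [hx])
    rw [map_sub, map_smul, smul_eq_mul, sub_eq_zero] at this
    rw [this]; ring
  have hc0 : c ≠ 0 := by
    intro h0
    exact linForm_ne_zero H' (ContinuousLinearMap.ext fun v => by rw [hc, h0, zero_mul]; rfl)
  refine hne (Subtype.ext (Set.ext fun x => ?_))
  obtain ⟨z, rfl⟩ := T.proj_surjective x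
  rw [mem_iff_of_mem h, mem_iff_of_mem h']
  simp only [hc, ← mul_add, mul_right_inj' hc0]

open scoped Classical in
/-- The equation of `H` near `z₀`. -/
noncomputable def localEq (z₀ : V) (H : T.Hypertorus) (z : V) : ℂ :=
  if T.proj z₀ ∈ H.1 then linForm H z - linForm H z₀ else 1

theorem analyticAt_localEq (z₀ : V) (H : T.Hypertorus) (z : V) :
    AnalyticAt ℂ (localEq z₀ H) z := by
  unfold localEq
  split_ifs
  · exact ((linForm H).analyticAt z).fun_sub analyticAt_const
  · exact analyticAt_const

theorem eventually_mem_iff_localEq (z₀ : V) :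
    ∀ᶠ z in 𝓝 z₀, ∀ H : T.Hypertorus, T.proj z ∈ H.1 ↔ localEq z₀ H z = 0 := by
  rw [Filter.eventually_all]
  intro H
  by_cases h : T.proj z₀ ∈ H.1
  · obtain ⟨z₁, h1⟩ := exists_isEquation_linForm H
    filter_upwards [h1.eventually_mem_iff h] with z hz
    rw [hz, localEq, if_pos h, sub_eq_zero]
  · filter_upwards [(isClosed_hypertorus H).isOpen_compl.mem_nhds h] with z hz
    rw [localEq, if_neg h]
    exact iff_of_false hz one_ne_zero

/-- The form is written with denominator `localEq`, which is 1 away from H. The last clause gives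
the numerator on the whole hyperplane through z₀, not only at z₀; this is the information needed to
cancel residues at generic points. -/
theorem exists_local_dunklForm {p : T.Pairs} {α : AntiDual V}
    (hα : α - T.dualAct (T.refl p) α ∉ T.dualLattice) (z₀ : V) :
    ∃ k : V → ℂ, AnalyticAt ℂ k z₀ ∧
      (∀ᶠ z in 𝓝 z₀, T.proj z ∉ p.H.1 → T.dunklForm α p z = (k z / localEq z₀ p.H z) • linForm p.H) ∧
      (T.proj z₀ ∈ p.H.1 → ∀ z, linForm p.H z = linForm p.H z₀ →
        k z = mult α (z - (T.refl p)⁻¹ • z)) := by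
  obtain ⟨z₁, h⟩ := exists_isEquation_linForm p.H
  obtain ⟨F, hF, hF', hres⟩ := h.exists_dunklForm_eq hα
  by_cases h0 : T.proj z₀ ∈ p.H.1
  · obtain ⟨k, hk, hk'⟩ := hres z₀ h0
    set r := mult α (z₀ - (T.refl p)⁻¹ • z₀) with hr
    -- The numerator is the residue plus (l − l z₀) times the regular part. On the hyperplane it is
    -- the constant r, which equals χ_α(z − g⁻¹z) there because g⁻¹ fixes z − z₀.
    refine ⟨fun z => r + (linForm p.H z - linForm p.H z₀) * k (linForm p.H z), ?_, ?_, ?_⟩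
    · exact analyticAt_const.fun_add ((((linForm p.H).analyticAt z₀).fun_sub analyticAt_const).fun_mul
        (AnalyticAt.fun_comp (g := k) (f := fun z => linForm p.H z) hk ((linForm p.H).analyticAt z₀)))
    · filter_upwards [((linForm p.H).continuous.tendsto z₀).eventually hk',
        h.eventually_mem_iff h0] with z h1 h2 h3
      have h4 : linForm p.H z - linForm p.H z₀ ≠ 0 := fun h => h3 (h2.2 (sub_eq_zero.1 h))
      rw [hF z h3, h1, localEq, if_pos h0]
      congr 1
      field_simp
    · intro _ z hz
      simp only [hz, sub_self, zero_mul, add_zero]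
      rw [hr]
      congr 1
      have h5 := h.inv_smul_eq (refl_mem_stab p) (v := z - z₀) (by rw [map_sub, hz, sub_self])
      rw [smul_sub, sub_eq_iff_eq_add] at h5
      rw [h5]; abel
  · refine ⟨fun z => F (linForm p.H z), AnalyticAt.fun_comp (g := F) (f := fun z => linForm p.H z)
      (hF' z₀ h0) ((linForm p.H).analyticAt z₀), ?_, fun h => absurd h h0⟩
    refine Eventually.of_forall fun z hz => ?_
    rw [hF z hz, localEq, if_neg h0, div_one]

theorem HasTrivialStabilizer.dualAct {α : AntiDual V} (hα : T.HasTrivialStabilizer α) (x : T.W) :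
    T.HasTrivialStabilizer (T.dualAct x α) := fun _ hw => hα.sub_dualAct_notMem x hw

theorem HasTrivialStabilizer.refl_notMem {α : AntiDual V} (hα : T.HasTrivialStabilizer α)
    (p : T.Pairs) : α - T.dualAct (T.refl p) α ∉ T.dualLattice := hα _ (refl_ne_one p)

theorem dunklForm_eq_smul {α : AntiDual V} (hα : T.HasTrivialStabilizer α) (p : T.Pairs) {z : V}
    (hz : T.proj z ∉ p.H.1) : ∃ c : ℂ, T.dunklForm α p z = c • linForm p.H := by
  obtain ⟨z₁, h⟩ := exists_isEquation_linForm p.H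
  obtain ⟨F, hF, -⟩ := h.exists_dunklForm_eq (hα.refl_notMem p)
  exact ⟨_, hF z hz⟩

/-! ### The quadratic relations between the Dunkl forms -/

/-- The `(q, p)`-term of the curvature of the Dunkl connection. -/
noncomputable def crossTerm (C : T.Pairs → ℂ) (α : AntiDual V) (v v' : V) (q p : T.Pairs) (z : V) :
    ℂ :=
  C q * C p * (T.dunklForm (T.dualAct (T.refl p) α) q z v * T.dunklForm α p z v' -
    T.dunklForm (T.dualAct (T.refl p) α) q z v' * T.dunklForm α p z v)

/-- The value of the wedge product of the equations of two hypertori. -/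
noncomputable def wedge (H H' : T.Hypertorus) (v v' : V) : ℂ :=
  linForm H v * linForm H' v' - linForm H v' * linForm H' v

theorem smulH_eq_of_mem_stab {H : T.Hypertorus} {g : T.W} (hg : g ∈ T.stab H) : smulH g H = H := by
  refine Subtype.ext ?_
  change (fun x => g • x) '' H.1 = H.1
  have := (mem_fixingSubgroup_iff T.W).1 hg
  exact (Set.image_congr fun x hx => this x hx).trans (Set.image_id' _)

theorem smulH_smulH (w w' : T.W) (H : T.Hypertorus) : smulH w (smulH w' H) = smulH (w * w') H := by
  refine Subtype.ext ?_
  change (fun x => w • x) '' ((fun x => w' • x) '' H.1) = (fun x => (w * w') • x) '' H.1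
  rw [Set.image_image]
  simp only [mul_smul]

theorem smulH_ne_of_mem_stab {H H' : T.Hypertorus} {g : T.W} (hg : g ∈ T.stab H) (hne : H' ≠ H) :
    smulH g H' ≠ H := by
  intro h
  refine hne ?_
  have h1 := congrArg (smulH g⁻¹) h
  rw [smulH_smulH, inv_mul_cancel, smulH_eq_of_mem_stab (one_mem _),
    smulH_eq_of_mem_stab (inv_mem hg)] at h1
  exact h1

/-- The permutation of pairs of elements of `𝒮` which matches the residues of the curvature. -/
noncomputable def braid : T.Pairs × T.Pairs ≃ T.Pairs × T.Pairs where
  toFun x := (smulP (T.refl x.1) x.2, x.1)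
  invFun x := (x.2, smulP (T.refl x.2)⁻¹ x.1)
  left_inv x := by simp only [smulP_smulP, inv_mul_cancel, one_smulP]
  right_inv x := by simp only [smulP_smulP, mul_inv_cancel, one_smulP]

section Quadratic

variable {C : T.Pairs → ℂ} (hC : T.IsInvariant C) {α : AntiDual V}
  (hα : T.HasTrivialStabilizer α) (v v' : V)

include hα

/-- Cancellation of residues: the residue of the `(q, p)`-term at a generic point of `H_q` cancels
against the residue of the braided term. -/
theorem residue_cancel {q p : T.Pairs} {z : V} (hq : T.proj z ∈ q.H.1) (hp : T.proj z ∉ p.H.1) :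
    mult (T.dualAct (T.refl p) α) (z - (T.refl q)⁻¹ • z) *
        (linForm q.H v * T.dunklForm α p z v' - linForm q.H v' * T.dunklForm α p z v) +
      mult α (z - (T.refl q)⁻¹ • z) *
        (T.dunklForm (T.dualAct (T.refl q) α) (smulP (T.refl q) p) z v * linForm q.H v' -
          T.dunklForm (T.dualAct (T.refl q) α) (smulP (T.refl q) p) z v' * linForm q.H v) = 0 := by
  have hs := refl_mem_stab q
  set r := T.refl q
  obtain ⟨d, hd⟩ := exists_inv_smul_eq hs
  have hγ : z - r⁻¹ • z ∈ T.Γ := by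
    have := neg_mem (T.smul_sub_mem_of_mem_stab (inv_mem hs) hq)
    rwa [neg_sub] at this
  set γ := z - r⁻¹ • z with hγd
  have e1 : r⁻¹ • z = z + -γ := by rw [hγd]; abel
  have hp' : T.proj (r⁻¹ • z) ∉ p.H.1 := by rwa [e1, T.proj_add (neg_mem hγ)]
  -- Equivariance moves r to the arguments. As z lies over H_q, r⁻¹z = z − γ with γ ∈ Γ, which
  -- produces the multiplier; and r⁻¹x = x + l(x)d, whose extra term disappears on antisymmetrizing
  -- in v and v'.
  have key : ∀ x, T.dunklForm (T.dualAct r α) (smulP r p) z x =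
      mult (T.dualAct (T.refl p) α) γ / mult α γ *
        (T.dunklForm α p z x + linForm q.H x * T.dunklForm α p z d) := by
    intro x
    have h1 := dunklForm_smulP (hα.refl_notMem p) r hp' (r⁻¹ • x)
    rw [smul_inv_smul, smul_inv_smul, e1,
      (isDunklForm_dunklForm (hα.refl_notMem p)).mult z hp _ (neg_mem hγ), mult_sub_left,
      mult_neg_right, mult_neg_right] at h1
    rw [h1, hd, smul_apply, map_add, map_smul, smul_eq_mul, smul_eq_mul]
    congr 1
    rw [inv_div_inv]
  rw [key, key]
  have := mult_ne_zero α γ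
  field_simp
  ring

include hC

open scoped Classical in
-- Individual terms have poles, but their sum for a fixed product w does not. Multiplied by all
-- local equations, the sum becomes an analytic numerator N. At a generic point of a hypertorus
-- through z₀ the terms polar there cancel in pairs under `braid`, so N vanishes on every such
-- hypertorus and is divisible by the product of their equations.
theorem exists_local_crossTerm (w : T.W) (z₀ : V) :
    ∃ Q : V → ℂ, AnalyticAt ℂ Q z₀ ∧ ∀ᶠ z in 𝓝 z₀, T.proj z ∈ T.reg →
      (∑ x : T.Pairs × T.Pairs, if T.refl x.1 * T.refl x.2 = w then
        crossTerm C α v v' x.1 x.2 z else 0) = Q z := by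
  have : Fintype T.Hypertorus := Fintype.ofFinite _
  choose k hk hk' hkr using fun p : T.Pairs => exists_local_dunklForm (hα.refl_notMem p) z₀
  choose m hm hm' hmr using fun q p : T.Pairs =>
    exists_local_dunklForm ((hα.dualAct (T.refl p)).refl_notMem q) z₀
  -- This is the (q, p)-term times the product of all local equations, its own two denominators
  -- cancelled. If the two hypertori coincide the forms are proportional, so the term is zero.
  let n : T.Pairs → T.Pairs → V → ℂ := fun q p z =>
    if q.H = p.H then 0 else C q * C p * wedge q.H p.H v v' * (m q p z * k p z) *
      ∏ H ∈ (Finset.univ.erase q.H).erase p.H, localEq z₀ H z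
  let N : V → ℂ := fun z => ∑ x : T.Pairs × T.Pairs, if T.refl x.1 * T.refl x.2 = w then
    n x.1 x.2 z else 0
  have hn : ∀ q p, AnalyticAt ℂ (n q p) z₀ := by
    intro q p
    simp only [n]
    split_ifs
    · exact analyticAt_const
    · exact (analyticAt_const.fun_mul ((hm q p).fun_mul (hk p))).fun_mul
        (Finset.analyticAt_fun_prod _ fun H _ => analyticAt_localEq z₀ H z₀)
  have hN : AnalyticAt ℂ N z₀ := by
    refine Finset.analyticAt_fun_sum _ fun x _ => ?_
    split_ifs
    · exact hn _ _
    · exact analyticAt_const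
  have hall : ∀ᶠ z in 𝓝 z₀, (∀ H : T.Hypertorus, T.proj z ∈ H.1 ↔ localEq z₀ H z = 0) ∧
      (∀ p : T.Pairs, T.proj z ∉ p.H.1 →
        T.dunklForm α p z = (k p z / localEq z₀ p.H z) • linForm p.H) ∧
      ∀ q p : T.Pairs, T.proj z ∉ q.H.1 → T.dunklForm (T.dualAct (T.refl p) α) q z =
        (m q p z / localEq z₀ q.H z) • linForm q.H := by
    refine (eventually_mem_iff_localEq z₀).and (Eventually.and ?_ ?_)
    · exact Filter.eventually_all.2 fun p => hk' p
    · exact Filter.eventually_all.2 fun q => Filter.eventually_all.2 fun p => hm' q p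
  let s : Finset T.Hypertorus := Finset.univ.filter fun H => T.proj z₀ ∈ H.1
  have hmem : ∀ H, H ∈ s ↔ T.proj z₀ ∈ H.1 := fun H => by simp [s]
  obtain ⟨Q, hQ, hQ'⟩ := hN.exists_eq_prod_linear_mul s linForm (fun H _ => linForm_ne_zero H)
    (fun H hH H' hH' hne => exists_linForm_ne ((hmem H).1 hH) ((hmem H').1 hH') hne)
    (fun H hH => by
      rw [hmem] at hH
      filter_upwards [hall] with z ⟨h1, h2, h3⟩ h4 h5
      -- From here z is a point of H lying on no other hypertorus near z₀.
      have hzH : localEq z₀ H z = 0 := by rw [localEq, if_pos hH, h4, sub_self]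
      have hzH' : ∀ H', H' ≠ H → localEq z₀ H' z ≠ 0 := by
        intro H' hne
        rw [localEq]
        split_ifs with h
        · exact sub_ne_zero.2 (h5 H' ((hmem H').2 h) hne)
        · exact one_ne_zero
      let P : ℂ := ∏ H' ∈ Finset.univ.erase H, localEq z₀ H' z
      have hprod : ∀ H', H' ≠ H → ∏ H'' ∈ (Finset.univ.erase H).erase H', localEq z₀ H'' z =
          P / localEq z₀ H' z := by
        intro H' hne
        have := Finset.mul_prod_erase (Finset.univ.erase H) (fun H'' => localEq z₀ H'' z)
          (Finset.mem_erase.2 ⟨hne, Finset.mem_univ H'⟩)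
        rw [eq_div_iff (hzH' H' hne), mul_comm]
        exact this
      -- At z only terms with exactly one factor polar along H survive: t₁ collects those whose
      -- first factor is polar, t₂ those whose second factor is. If neither is polar along H, the
      -- local equation of H remains in the product and annihilates the term.
      let t₁ : T.Pairs → T.Pairs → ℂ := fun q p =>
        if q.H = H ∧ p.H ≠ H then C q * C p * P *
          (mult (T.dualAct (T.refl p) α) (z - (T.refl q)⁻¹ • z) *
            (linForm q.H v * T.dunklForm α p z v' - linForm q.H v' * T.dunklForm α p z v)) else 0
      let t₂ : T.Pairs → T.Pairs → ℂ := fun q p =>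
        if p.H = H ∧ q.H ≠ H then C q * C p * P *
          (mult α (z - (T.refl p)⁻¹ • z) *
            (T.dunklForm (T.dualAct (T.refl p) α) q z v * linForm p.H v' -
              T.dunklForm (T.dualAct (T.refl p) α) q z v' * linForm p.H v)) else 0
      have hsplit : ∀ q p, n q p z = t₁ q p + t₂ q p := by
        intro q p
        by_cases hqp : q.H = p.H
        · have e1 : t₁ q p = 0 := if_neg fun h => h.2 (hqp ▸ h.1)
          have e2 : t₂ q p = 0 := if_neg fun h => h.2 (hqp.trans h.1)
          rw [e1, e2, add_zero]
          exact if_pos hqp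
        simp only [n, if_neg hqp]
        by_cases hq : q.H = H
        · have hp : p.H ≠ H := fun h => hqp (hq.trans h.symm)
          have hz0 : T.proj z₀ ∈ q.H.1 := by rw [hq]; exact hH
          have hzp : T.proj z ∉ p.H.1 := fun h => hzH' _ hp ((h1 _).1 h)
          have e1 : t₁ q p = _ := if_pos ⟨hq, hp⟩
          have e2 : t₂ q p = 0 := if_neg fun h => hp h.1
          rw [e1, e2, add_zero, hq, hprod _ hp, ← hq,
            hmr q p hz0 z (by rw [hq]; exact h4), h2 p hzp, wedge]
          simp only [smul_apply, smul_eq_mul]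
          have := hzH' _ hp
          field_simp
        · by_cases hp : p.H = H
          · have hz0 : T.proj z₀ ∈ p.H.1 := by rw [hp]; exact hH
            have hzq : T.proj z ∉ q.H.1 := fun h => hzH' _ hq ((h1 _).1 h)
            have e1 : t₁ q p = 0 := if_neg fun h => hq h.1
            have e2 : t₂ q p = _ := if_pos ⟨hp, hq⟩
            rw [e1, e2, zero_add, Finset.erase_right_comm, hp,
              hprod _ hq, ← hp,
              hkr p hz0 z (by rw [hp]; exact h4), h3 q p hzq, wedge]
            simp only [smul_apply, smul_eq_mul]
            have := hzH' _ hq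
            field_simp
          · have e1 : t₁ q p = 0 := if_neg fun h => hq h.1
            have e2 : t₂ q p = 0 := if_neg fun h => hp h.1
            rw [e1, e2, add_zero, Finset.prod_eq_zero (i := H) (by
              simp only [Finset.mem_erase, Finset.mem_univ, and_true]
              exact ⟨fun h => hp h.symm, fun h => hq h.symm⟩) hzH, mul_zero]
      have hcancel : ∀ q p, t₁ q p + t₂ (smulP (T.refl q) p) q = 0 := by
        intro q p
        by_cases hq : q.H = H ∧ p.H ≠ H
        · have hzq : T.proj z ∈ q.H.1 := by rw [hq.1]; exact (h1 H).2 hzH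
          have hzp : T.proj z ∉ p.H.1 := fun h => hzH' _ hq.2 ((h1 _).1 h)
          have hne : (smulP (T.refl q) p).H ≠ H :=
            smulH_ne_of_mem_stab (hq.1 ▸ refl_mem_stab q) hq.2
          have e1 : t₁ q p = _ := if_pos hq
          have e2 : t₂ (smulP (T.refl q) p) q = _ := if_pos ⟨hq.1, hne⟩
          rw [e1, e2, hC.apply_smulP]
          linear_combination C q * C p * P * residue_cancel hα v v' hzq hzp
        · have e1 : t₁ q p = 0 := if_neg hq
          have e2 : t₂ (smulP (T.refl q) p) q = 0 := by
            refine if_neg ?_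
            rintro ⟨h6, h7⟩
            refine hq ⟨h6, fun h8 => h7 ?_⟩
            change smulH (T.refl q) p.H = H
            rw [h8]
            exact smulH_eq_of_mem_stab (h6 ▸ refl_mem_stab q)
          rw [e1, e2, add_zero]
      have hsum : N z = (∑ x : T.Pairs × T.Pairs, if T.refl x.1 * T.refl x.2 = w then
          t₁ x.1 x.2 else 0) + ∑ x : T.Pairs × T.Pairs, if T.refl x.1 * T.refl x.2 = w then
          t₂ x.1 x.2 else 0 := by
        rw [← Finset.sum_add_distrib]
        refine Finset.sum_congr rfl fun x _ => ?_
        split_ifs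
        · exact hsplit _ _
        · rw [add_zero]
      -- The braid move preserves the product of the two group elements, hence the summation
      -- condition, and sends each t₁ to the t₂ that cancels it.
      rw [hsum, ← Equiv.sum_comp braid (fun x : T.Pairs × T.Pairs =>
        if T.refl x.1 * T.refl x.2 = w then t₂ x.1 x.2 else 0), ← Finset.sum_add_distrib]
      refine Finset.sum_eq_zero fun x _ => ?_
      have hbr : T.refl (braid x).1 * T.refl (braid x).2 = T.refl x.1 * T.refl x.2 := by
        change T.refl (smulP (T.refl x.1) x.2) * T.refl x.1 = _
        rw [refl_smulP]; group
      rw [hbr]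
      split_ifs
      · exact hcancel _ _
      · rw [add_zero])
  refine ⟨Q, hQ, ?_⟩
  filter_upwards [hall, hQ'] with z ⟨h1, h2, h3⟩ h4 hz
  have hne : ∀ H : T.Hypertorus, localEq z₀ H z ≠ 0 := fun H h => hz H ((h1 H).2 h)
  have hprod : ∏ H ∈ s, (linForm H z - linForm H z₀) = ∏ H : T.Hypertorus, localEq z₀ H z := by
    rw [Finset.prod_filter]
    rfl
  have hPne : ∏ H : T.Hypertorus, localEq z₀ H z ≠ 0 := Finset.prod_ne_zero_iff.2 fun H _ => hne H
  refine mul_left_cancel₀ hPne ?_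
  rw [← hprod, ← h4, hprod, Finset.mul_sum]
  refine Finset.sum_congr rfl fun x _ => ?_
  obtain ⟨q, p⟩ := x
  simp only
  split_ifs
  swap
  · rw [mul_zero]
  rw [crossTerm, h2 p (hz p.H), h3 q p (hz q.H)]
  simp only [n, smul_apply, smul_eq_mul]
  split_ifs with hqp
  · rw [hqp]; ring
  · rw [← Finset.mul_prod_erase Finset.univ _ (Finset.mem_univ q.H),
      ← Finset.mul_prod_erase (Finset.univ.erase q.H) _
        (Finset.mem_erase.2 ⟨fun h => hqp h.symm, Finset.mem_univ p.H⟩), wedge]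
    have := hne q.H
    have := hne p.H
    field_simp

open scoped Classical in
/-- The quadratic relations between the Dunkl forms. -/
theorem sum_crossTerm_eq_zero (w : T.W) {z : V} (hz : T.proj z ∈ T.reg) :
    (∑ x : T.Pairs × T.Pairs, if T.refl x.1 * T.refl x.2 = w then
        crossTerm C α v v' x.1 x.2 z else 0) = 0 := by
  -- If the product is 1, the two reflections are inverse to each other. Comparing their rank one
  -- parts makes the equations proportional, and the wedge vanishes.
  by_cases hw : w = 1
  · refine Finset.sum_eq_zero fun x _ => ?_
    split_ifs with h
    swap
    · rfl
    obtain ⟨q, p⟩ := x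
    obtain ⟨a, ha⟩ := dunklForm_eq_smul hα p (hz p.H)
    obtain ⟨b, hb⟩ := dunklForm_eq_smul (hα.dualAct (T.refl p)) q (hz q.H)
    obtain ⟨z₁, hp⟩ := exists_isEquation_linForm p.H
    obtain ⟨z₂, hq⟩ := exists_isEquation_linForm q.H
    obtain ⟨d, hd⟩ := hp.exists_smul_eq (refl_mem_stab p)
    have hd0 : d ≠ 0 := fun h0 => refl_ne_one p (Subtype.ext (LinearEquiv.ext fun x => by
      have := hd x
      rwa [h0, smul_zero, add_zero] at this))
    obtain ⟨e, he⟩ := hq.exists_smul_eq (refl_mem_stab q)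
    have hrel : ∀ x, linForm p.H x • d = linForm q.H x • (-(T.refl p • e)) := by
      intro x
      have h1 : T.refl p • T.refl q • x = x := by
        rw [← mul_smul, mul_eq_one_comm.1 (h.trans hw), one_smul]
      rw [he, smul_add, hd, smul_smul_complex] at h1
      rw [smul_neg, eq_neg_iff_add_eq_zero]
      have h2 : x + (linForm p.H x • d + linForm q.H x • T.refl p • e) = x := by
        rw [← h1, ← add_assoc]
        simp [h1]
      exact add_eq_left.1 h2
    have hwedge : wedge q.H p.H v v' • d = 0 := by
      rw [wedge, sub_smul, mul_smul, mul_smul, hrel, hrel, smul_comm, sub_self]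
    have hw0 : wedge q.H p.H v v' = 0 := (smul_eq_zero.1 hwedge).resolve_right hd0
    rw [crossTerm, ha, hb]
    simp only [smul_apply, smul_eq_mul]
    rw [wedge] at hw0
    linear_combination C q * C p * a * b * hw0
  -- For w ≠ 1 the sum extends to a global holomorphic section of L_{α − wα}, a nontrivial bundle.
  · obtain ⟨Q, hQ, hQ', -⟩ := exists_analytic_extension (Ω := Set.univ)
      (Z := (T.proj ⁻¹' T.reg)ᶜ) (by rw [compl_compl]; exact T.dense_reg)
      (G := fun z => ∑ x : T.Pairs × T.Pairs, if T.refl x.1 * T.refl x.2 = w then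
        crossTerm C α v v' x.1 x.2 z else 0) (fun z₀ _ => by
        obtain ⟨Q, hQ, h⟩ := exists_local_crossTerm hC hα v v' w z₀
        refine ⟨Q, hQ, ?_⟩
        filter_upwards [h] with z hz hz'
        exact hz (not_not.1 hz'))
    have hQr : ∀ z, T.proj z ∈ T.reg → Q z = ∑ x : T.Pairs × T.Pairs,
        if T.refl x.1 * T.refl x.2 = w then crossTerm C α v v' x.1 x.2 z else 0 :=
      fun z hz => hQ' z trivial (not_not.2 hz)
    have hmul : ∀ z, ∀ γ ∈ T.Γ, Q (z + γ) = mult (α - T.dualAct w α) γ • Q z := by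
      intro z γ hγ
      have hc : Continuous Q := continuousOn_univ.1 hQ.continuousOn
      have := Continuous.ext_on T.dense_reg (f := fun z => Q (z + γ))
        (g := fun z => mult (α - T.dualAct w α) γ • Q z) (by fun_prop) (by fun_prop)
        fun z hz => by
          have hz1 : T.proj z ∈ T.reg := hz
          have hz2 : T.proj (z + γ) ∈ T.reg := by rwa [T.proj_add hγ]
          simp only
          rw [hQr z hz1, hQr _ hz2, Finset.smul_sum]
          refine Finset.sum_congr rfl fun x _ => ?_
          obtain ⟨q, p⟩ := x
          simp only
          split_ifs with h
          -- The twists α − g_pα and g_pα − g_q g_pα add up to α − wα.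
          · rw [crossTerm, crossTerm,
              (isDunklForm_dunklForm (hα.refl_notMem p)).mult z (hz1 p.H) γ hγ,
              (isDunklForm_dunklForm ((hα.dualAct (T.refl p)).refl_notMem q)).mult z (hz1 q.H) γ hγ,
              ← dualAct_mul, h]
            simp only [mult_sub_left, smul_apply, smul_eq_mul]
            have := mult_ne_zero (T.dualAct (T.refl p) α) γ
            have := mult_ne_zero (T.dualAct w α) γ
            field_simp
          · rw [smul_zero]
      exact congrFun this z
    obtain ⟨γ, hγ, hne⟩ := exists_mult_ne_one (hα w hw)
    rw [← hQr z hz]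
    exact T.eq_zero_of_multiplier hQ (fun γ _ => norm_mult _ γ) hmul hγ hne z

end Quadratic

end TorusAction

namespace TorusAction

variable {V : Type u} [NormedAddCommGroup V] [NormedSpace ℂ V] {T : TorusAction V}
  [FiniteDimensional ℂ V]

/-! ### Directional derivatives -/

section Derivative

variable {Ω : Set V} (hΩ : IsOpen Ω) {s t : Ω → ℂ}

include hΩ

theorem dv_eq_of_eventuallyEq {S : V → ℂ} {z : Ω} (h : ∀ᶠ y in 𝓝 (z : V), ∀ hy : y ∈ Ω, s ⟨y, hy⟩ = S y)
    (v : V) : dv v s z = fderiv ℂ S z v := by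
  have e : ext s =ᶠ[𝓝 (z : V)] S := by
    filter_upwards [h, hΩ.mem_nhds z.2] with y hy hy'
    rw [ext_apply_mem s hy', hy hy']
  rw [dv, e.fderiv_eq]

theorem dv_add (hs : IsHol s) (ht : IsHol t) (v : V) : dv v (s + t) = dv v s + dv v t := by
  funext z
  rw [dv_eq_of_eventuallyEq hΩ (S := ext s + ext t) (Eventually.of_forall fun y hy => by
    simp [ext_apply_mem _ hy]), fderiv_add (hs z z.2).differentiableAt (ht z z.2).differentiableAt]
  rfl

theorem dv_const_mul (hs : IsHol s) (c : ℂ) (v : V) :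
    dv v (fun z => c * s z) = fun z => c * dv v s z := by
  funext z
  rw [dv_eq_of_eventuallyEq hΩ (S := fun y => c * ext s y) (Eventually.of_forall fun y hy => by
    simp [ext_apply_mem _ hy]), fderiv_const_mul (hs z z.2).differentiableAt]
  rfl

theorem dv_mul (hs : IsHol s) (ht : IsHol t) (v : V) (z : Ω) :
    dv v (fun z => s z * t z) z = dv v s z * t z + s z * dv v t z := by
  rw [dv_eq_of_eventuallyEq hΩ (S := fun y => ext s y * ext t y)
    (Eventually.of_forall fun y hy => by simp [ext_apply_mem _ hy]),
    fderiv_fun_mul (hs z z.2).differentiableAt (ht z z.2).differentiableAt]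
  simp only [dv, add_apply, smul_apply, smul_eq_mul, ext_apply]
  ring

theorem dv_sum {ι : Type*} (I : Finset ι) {f : ι → Ω → ℂ} (hf : ∀ i ∈ I, IsHol (f i)) (v : V)
    (z : Ω) : dv v (fun z => ∑ i ∈ I, f i z) z = ∑ i ∈ I, dv v (f i) z := by
  rw [dv_eq_of_eventuallyEq hΩ (S := fun y => ∑ i ∈ I, ext (f i) y)
    (Eventually.of_forall fun y hy => by simp [ext_apply_mem _ hy]),
    fderiv_fun_sum fun i hi => (hf i hi z z.2).differentiableAt]
  simp [dv, sum_apply]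

theorem dv_comm (hs : IsHol s) (v v' : V) : dv v (dv v' s) = dv v' (dv v s) := by
  funext z
  have h : ∀ a b : V, dv a (dv b s) z = fderiv ℂ (fderiv ℂ (ext s)) z a b := by
    intro a b
    rw [dv_eq_of_eventuallyEq hΩ (S := fun y => fderiv ℂ (ext s) y b)
      (Eventually.of_forall fun y hy => rfl)]
    rw [fderiv_clm_apply (hs z z.2).fderiv.differentiableAt (by fun_prop)]
    simp
  rw [h, h]
  exact (hs z z.2).contDiffAt.isSymmSndFDerivAt (n := ⊤) (by simp) v v'

theorem IsHol.dv (hs : IsHol s) (v : V) : IsHol (dv v s) :=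
  isHol_of hΩ (S := fun z => fderiv ℂ (ext s) z v)
    (fun z hz => analyticAt_fderiv_apply (hs z hz) v) fun _ => rfl

end Derivative

theorem dv_smul_add {Ω : Set V} (s : Ω → ℂ) (c : ℂ) (v v' : V) (z : Ω) :
    dv (c • v + v') s z = c * dv v s z + dv v' s z := by
  simp [dv]

theorem IsHol.continuous {Ω : Set V} {s : Ω → ℂ} (hs : IsHol s) : Continuous s := by
  have h : Continuous fun z : Ω => ext s z :=
    continuousOn_iff_continuous_domRestrict.1 hs.continuousOn
  simpa only [ext_apply] using h

/-! ### Sections with poles on the reflection hypertori -/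

theorem IsMerSection.const_mul {α : AntiDual V} {U : Opens T.X} {s : T.regLift U → ℂ}
    (hs : T.IsMerSection α U s) (c : ℂ) : T.IsMerSection α U (fun z => c * s z) := by
  have := (isMerSection_const (U := U) c).mul hs
  rwa [zero_add] at this

theorem IsMerSection.sum {α : AntiDual V} {U : Opens T.X} {ι : Type*} (I : Finset ι)
    {s : ι → T.regLift U → ℂ} (hs : ∀ i ∈ I, T.IsMerSection α U (s i)) :
    T.IsMerSection α U (fun z => ∑ i ∈ I, s i z) := by
  classical
  induction I using Finset.induction_on with
  | empty =>
    simp only [Finset.sum_empty]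
    exact isMerSection_zero
  | insert a I ha ih =>
    simp only [Finset.sum_insert ha]
    exact (hs a (Finset.mem_insert_self a I)).add
      (ih fun i hi => hs i (Finset.mem_insert_of_mem hi))

theorem dv_translate {U : Opens T.Y} {s : T.regLift (T.pre U) → ℂ} (hs : IsHol s) (g : T.W) (v : V)
    (z : T.regLift (T.pre U)) :
    dv v (translate g s) z = dv (g⁻¹ • v) s ⟨g⁻¹ • (z : V), T.smul_mem_regLift g⁻¹ z.2⟩ := by
  rw [dv_eq_of_eventuallyEq (T.isOpen_regLift _) (S := fun y => ext s (g⁻¹ • y))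
    (Eventually.of_forall fun y hy => (ext_apply_mem s _).symm)]
  have h := (hs _ (T.smul_mem_regLift g⁻¹ z.2)).differentiableAt.hasFDerivAt.comp (z : V)
    ((actL g⁻¹).hasFDerivAt (x := (z : V)))
  exact congrArg (fun k : V →L[ℂ] ℂ => k v) h.fderiv

theorem IsMerSection.translate_dualAct {α : AntiDual V} {U : Opens T.Y}
    {s : T.regLift (T.pre U) → ℂ} (hs : T.IsMerSection α (T.pre U) s) (w : T.W) :
    T.IsMerSection (T.dualAct w α) (T.pre U) (TorusAction.translate w s) where
  hol := isHol_of (T.isOpen_regLift _) (S := fun z => ext s (w⁻¹ • z))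
    (fun z hz => (hs.hol _ (T.smul_mem_regLift w⁻¹ hz)).fun_comp (T.analytic_smulV w⁻¹ z))
    fun z => (ext_apply_mem s _).symm
  mult z z' h := by
    have := hs.mult ⟨w⁻¹ • (z : V), T.smul_mem_regLift w⁻¹ z.2⟩
      ⟨w⁻¹ • (z' : V), T.smul_mem_regLift w⁻¹ z'.2⟩
      (by simpa only [← smul_sub] using T.smul_mem w⁻¹ h)
    rw [mult_dualAct, smul_sub]
    exact this
  mer z₀ hz₀ := by
    obtain ⟨h, t, hh, ht, H⟩ := hs.mer (w⁻¹ • z₀) (T.smul_mem_lift w⁻¹ hz₀)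
    refine ⟨fun z => h (w⁻¹ • z), fun z => t (w⁻¹ • z), hh.fun_comp (T.analytic_smulV w⁻¹ z₀),
      ht.fun_comp (T.analytic_smulV w⁻¹ z₀), ?_⟩
    filter_upwards [(T.continuous_smulV w⁻¹).continuousAt.eventually H] with z Hz hz
    exact Hz (T.smul_mem_regLift w⁻¹ hz)

/-- The component `⟨f, v⟩` of a Dunkl form. -/
noncomputable def dunklCoef (α : AntiDual V) (p : T.Pairs) (U : Opens T.X) (v : V) :
    T.regLift U → ℂ := fun z => T.dunklForm α p z v

theorem isMerSection_dunklCoef {α : AntiDual V} (hα : T.HasTrivialStabilizer α) (p : T.Pairs)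
    (U : Opens T.X) (v : V) :
    T.IsMerSection (α - T.dualAct (T.refl p) α) U (dunklCoef α p U v) where
  hol := isHol_of (T.isOpen_regLift U) (S := fun z => T.dunklForm α p z v)
    (fun z hz => ((ContinuousLinearMap.apply ℂ ℂ v).analyticAt _).fun_comp
      ((isDunklForm_dunklForm (hα.refl_notMem p)).hol z (hz.2 p.H))) fun _ => rfl
  mult z z' h := by
    have := (isDunklForm_dunklForm (hα.refl_notMem p)).mult z (z.2.2 p.H) _ h
    rw [add_sub_cancel] at this
    simp [dunklCoef, this]
  mer z₀ _ := by
    obtain ⟨k, hk, h1, -⟩ := exists_local_dunklForm (hα.refl_notMem p) z₀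
    refine ⟨localEq z₀ p.H, fun z => k z * linForm p.H v, analyticAt_localEq _ _ _,
      hk.fun_mul analyticAt_const, ?_⟩
    filter_upwards [h1, eventually_mem_iff_localEq z₀] with z h2 h3 hz
    have h4 : localEq z₀ p.H z ≠ 0 := fun h => hz.2 p.H ((h3 p.H).2 h)
    refine ⟨h4, ?_⟩
    rw [dunklCoef, h2 (hz.2 p.H), smul_apply, smul_eq_mul]
    field_simp

/-- The Dunkl forms are closed. -/
theorem dv_dunklCoef_comm {α : AntiDual V} (hα : T.HasTrivialStabilizer α) (p : T.Pairs)
    (U : Opens T.X) (v v' : V) : dv v (dunklCoef α p U v') = dv v' (dunklCoef α p U v) := by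
  funext z
  obtain ⟨z₁, h⟩ := exists_isEquation_linForm p.H
  obtain ⟨F, hF, hF', -⟩ := h.exists_dunklForm_eq (hα.refl_notMem p)
  -- With the form written as F(l)·l, the derivative along a of the b-component is F'(l) l(a) l(b),
  -- symmetric in a and b.
  have key : ∀ a b, dv a (dunklCoef α p U b) z =
      deriv F (linForm p.H z) * linForm p.H a * linForm p.H b := by
    intro a b
    rw [dv_eq_of_eventuallyEq (T.isOpen_regLift U) (S := fun y => F (linForm p.H y) * linForm p.H b)
      (Eventually.of_forall fun y hy => by
        rw [dunklCoef, hF y (hy.2 p.H), smul_apply, smul_eq_mul])]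
    have h1 := ((hF' z (z.2.2 p.H)).differentiableAt.hasDerivAt.comp_hasFDerivAt (z : V)
      ((linForm p.H).hasFDerivAt (x := (z : V)))).mul_const (linForm p.H b)
    have h2 : (fun y => F (linForm p.H y) * linForm p.H b) =
      fun y => (F ∘ linForm p.H) y * linForm p.H b := rfl
    rw [h2, h1.fderiv]
    simp only [smul_apply, smul_eq_mul]
    ring
  rw [key, key]
  ring

/-! ### Constancy of the connection form -/

namespace FlatConnection

variable (ξ : T.FlatConnection)

/-- The connection form is entire and periodic, hence constant; so the transported forms depend on w
and v only. -/
theorem form_eq (z : V) : ξ.form z = ξ.form 0 := T.eq_of_periodic ξ.hol ξ.periodic z 0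

theorem transport_eq (w : T.W) (z v : V) : ξ.transport w z v = ξ.form 0 (w⁻¹ • v) := by
  rw [transport, form_eq]

end FlatConnection

/-- The difference of the transports of the connection form by `u` and `r⁻¹ u`, for `r ∈ W_H`, is
proportional to the equation of `H`. -/
theorem transport_wedge (ξ : T.FlatConnection) {α : AntiDual V} (hα : T.HasTrivialStabilizer α)
    (p : T.Pairs) (u : T.W) {z : V} (hz : T.proj z ∈ T.reg) (v v' : V) :
    ξ.transport u z v * T.dunklForm α p z v' +
        T.dunklForm α p z v * ξ.transport ((T.refl p)⁻¹ * u) z v' =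
      ξ.transport u z v' * T.dunklForm α p z v +
        T.dunklForm α p z v' * ξ.transport ((T.refl p)⁻¹ * u) z v := by
  obtain ⟨c, hc⟩ := dunklForm_eq_smul hα p (hz p.H)
  obtain ⟨z₁, h⟩ := exists_isEquation_linForm p.H
  obtain ⟨d, hd⟩ := h.exists_smul_eq (refl_mem_stab p)
  -- The inverse of g⁻¹u is u⁻¹g, and g is the identity plus l ⊗ d; so the two transports differ by
  -- a multiple of l, to which the Dunkl form is also proportional.
  have key : ∀ x, ξ.transport ((T.refl p)⁻¹ * u) z x =
      ξ.transport u z x + linForm p.H x * ξ.form 0 (u⁻¹ • d) := by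
    intro x
    rw [ξ.transport_eq, ξ.transport_eq, mul_inv_rev, inv_inv, mul_smul, hd, smul_add,
      smul_smul_complex, map_add, map_smul (ξ.form 0) (linForm p.H x), smul_eq_mul]
  rw [key, key, hc]
  simp only [smul_apply, smul_eq_mul]
  ring

/-! ### The operators of the Dunkl representation -/

section Operators

variable (α : AntiDual V)

/-- Multiplication of sections of `F` by functions. -/
def mulM {U : Opens T.X} (f : T.OD U) : Module.End ℂ (T.merF α U) where
  toFun β := ⟨fun u z => f.1 z * β.1 u z, fun u => by
    have := IsMerSection.mul f.2 (β.2 u)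
    rw [zero_add] at this
    exact this⟩
  map_add' β β' := by
    ext u z
    exact mul_add _ _ _
  map_smul' c β := by
    ext u z
    exact mul_left_comm _ _ _

/-- The action of `W` on sections of `F`. -/
def wM (U : Opens T.Y) (g : T.W) : Module.End ℂ (T.merF α (T.pre U)) where
  toFun β := ⟨fun u => translate g (β.1 (g⁻¹ * u)), fun u => by
    have := IsMerSection.translate_dualAct (β.2 (g⁻¹ * u)) g
    rwa [← dualAct_mul, mul_inv_cancel_left] at this⟩
  map_add' _ _ := rfl
  map_smul' _ _ := rfl

variable {α} in
/-- The Dunkl operators on sections of `F`. -/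
noncomputable def dM (C : T.Pairs → ℂ) (hα : T.HasTrivialStabilizer α) (ξ : T.FlatConnection)
    (U : Opens T.X) (v : V) : Module.End ℂ (T.merF α U) where
  toFun β := ⟨fun u z => dv v (β.1 u) z - ξ.transport u z v * β.1 u z +
      ∑ p : T.Pairs, C p * T.dunklForm (T.dualAct ((T.refl p)⁻¹ * u) α) p z v *
        β.1 ((T.refl p)⁻¹ * u) z, fun u => by
    simp only [ξ.transport_eq, sub_eq_add_neg, ← neg_mul]
    refine ((IsMerSection.dv (β.2 u) v).add ((β.2 u).const_mul _)).add
      (IsMerSection.sum _ fun p _ => ?_)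
    have h1 := ((isMerSection_dunklCoef (hα.dualAct ((T.refl p)⁻¹ * u)) p U v).const_mul (C p)).mul
      (β.2 ((T.refl p)⁻¹ * u))
    rw [← dualAct_mul, mul_inv_cancel_left, dualAct_neg] at h1
    -- The twist of the Dunkl form, added to that of the component g⁻¹u of β, is the twist of the
    -- component u, as required.
    have e : T.dualAct ((T.refl p)⁻¹ * u) α - T.dualAct u α + -T.dualAct ((T.refl p)⁻¹ * u) α =
        T.dualAct u (-α) := by rw [dualAct_neg]; abel
    rw [e] at h1
    exact h1⟩
  map_add' β β' := by
    ext u z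
    have h1 := congrFun (dv_add (T.isOpen_regLift U) (β.2 u).hol (β'.2 u).hol v) z
    change dv v (β.1 u + β'.1 u) z - ξ.transport u z v * (β.1 u z + β'.1 u z) + ∑ p : T.Pairs,
        C p * T.dunklForm (T.dualAct ((T.refl p)⁻¹ * u) α) p z v *
        (β.1 ((T.refl p)⁻¹ * u) z + β'.1 ((T.refl p)⁻¹ * u) z) =
      (dv v (β.1 u) z - ξ.transport u z v * β.1 u z + ∑ p : T.Pairs, _) +
        (dv v (β'.1 u) z - ξ.transport u z v * β'.1 u z + ∑ p : T.Pairs, _)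
    rw [h1]
    simp only [Pi.add_apply, mul_add, Finset.sum_add_distrib]
    ring
  map_smul' c β := by
    ext u z
    have h1 := congrFun (dv_const_mul (T.isOpen_regLift U) (β.2 u).hol c v) z
    change dv v (fun z => c * β.1 u z) z - ξ.transport u z v * (c * β.1 u z) + ∑ p : T.Pairs,
        C p * T.dunklForm (T.dualAct ((T.refl p)⁻¹ * u) α) p z v *
        (c * β.1 ((T.refl p)⁻¹ * u) z) =
      c * (dv v (β.1 u) z - ξ.transport u z v * β.1 u z + ∑ p : T.Pairs, _)
    rw [h1, mul_add, mul_sub, Finset.mul_sum]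
    simp only [mul_left_comm c]

end Operators

end TorusAction

namespace TorusAction

variable {V : Type u} [NormedAddCommGroup V] [NormedSpace ℂ V] {T : TorusAction V}
  [FiniteDimensional ℂ V]

/-! ### Relations between the operators -/

section FunctionRelations

theorem wOp_mul (U : Opens T.Y) (g g' : T.W) : T.wOp U (g * g') = T.wOp U g * T.wOp U g' := by
  ext s z
  change s.1 ⟨(g * g')⁻¹ • (z : V), _⟩ = s.1 ⟨g'⁻¹ • g⁻¹ • (z : V), _⟩
  congr 2

theorem wOp_one (U : Opens T.Y) : T.wOp U 1 = 1 := by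
  ext s z
  change s.1 ⟨(1 : T.W)⁻¹ • (z : V), _⟩ = s.1 z
  congr 2

theorem dOp_apply_mul (U : Opens T.X) (v : V) (f s : T.OD U) :
    T.dOp U v (f * s) = f * T.dOp U v s + T.dOp U v f * s := by
  ext z
  have := dv_mul (T.isOpen_regLift U) f.2.hol s.2.hol v z
  change dv v (fun z => f.1 z * s.1 z) z = f.1 z * dv v s.1 z + dv v f.1 z * s.1 z
  rw [this]; ring

theorem wOp_dOp (U : Opens T.Y) (g : T.W) (v : V) :
    T.wOp U g * T.dOp (T.pre U) v = T.dOp (T.pre U) (g • v) * T.wOp U g := by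
  ext s z
  have := dv_translate s.2.hol g (g • v) z
  rw [inv_smul_smul] at this
  exact this.symm

theorem dOp_comm (U : Opens T.X) (v v' : V) :
    T.dOp U v * T.dOp U v' = T.dOp U v' * T.dOp U v := by
  ext s z
  exact congrFun (dv_comm (T.isOpen_regLift U) s.2.hol v v') z

theorem dOp_smul_add (U : Opens T.X) (c : ℂ) (v v' : V) :
    T.dOp U (c • v + v') = c • T.dOp U v + T.dOp U v' := by
  ext s z
  exact dv_smul_add s.1 c v v' z

end FunctionRelations

section SectionRelations

variable {α : AntiDual V}

theorem mulM_mul {U : Opens T.X} (f f' : T.OD U) : mulM α (f * f') = mulM α f * mulM α f' := by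
  ext β u z
  exact mul_assoc _ _ _

theorem mulM_add {U : Opens T.X} (f f' : T.OD U) : mulM α (f + f') = mulM α f + mulM α f' := by
  ext β u z
  exact add_mul _ _ _

theorem mulM_smul {U : Opens T.X} (c : ℂ) (f : T.OD U) : mulM α (c • f) = c • mulM α f := by
  ext β u z
  exact mul_assoc _ _ _

theorem mulM_one {U : Opens T.X} : mulM α (1 : T.OD U) = 1 := by
  ext β u z
  exact one_mul _

theorem wM_mul (U : Opens T.Y) (g g' : T.W) : wM α U (g * g') = wM α U g * wM α U g' := by
  ext β u z
  change β.1 ((g * g')⁻¹ * u) ⟨(g * g')⁻¹ • (z : V), _⟩ = β.1 (g'⁻¹ * (g⁻¹ * u)) ⟨g'⁻¹ • g⁻¹ • (z : V), _⟩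
  have e : (g * g')⁻¹ * u = g'⁻¹ * (g⁻¹ * u) := by group
  rw [e]
  congr 2

theorem wM_one (U : Opens T.Y) : wM α U 1 = 1 := by
  ext β u z
  change β.1 ((1 : T.W)⁻¹ * u) ⟨(1 : T.W)⁻¹ • (z : V), _⟩ = β.1 u z
  have e : (1 : T.W)⁻¹ * u = u := by group
  rw [e]
  congr 2

variable (C : T.Pairs → ℂ) (hα : T.HasTrivialStabilizer α) (ξ : T.FlatConnection)

theorem dM_apply (U : Opens T.X) (v : V) (β : T.merF α U) (u : T.W) (z : T.regLift U) :
    (dM C hα ξ U v β).1 u z = dv v (β.1 u) z - ξ.transport u z v * β.1 u z +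
      ∑ p : T.Pairs, C p * T.dunklForm (T.dualAct ((T.refl p)⁻¹ * u) α) p z v *
        β.1 ((T.refl p)⁻¹ * u) z := rfl

/-- Only the derivative contributes to the commutator: the Dunkl terms change the component of β but
not the point of evaluation, so they commute with functions. -/
theorem dM_mulM (U : Opens T.X) (v : V) (f : T.OD U) :
    dM C hα ξ U v * mulM α f = mulM α f * dM C hα ξ U v + mulM α (T.dOp U v f) := by
  ext β u z
  have h1 := dv_mul (T.isOpen_regLift U) f.2.hol (β.2 u).hol v z
  change (dM C hα ξ U v (mulM α f β)).1 u z = f.1 z * (dM C hα ξ U v β).1 u z + dv v f.1 z * β.1 u z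
  rw [dM_apply, dM_apply]
  change dv v (fun z => f.1 z * β.1 u z) z - ξ.transport u z v * (f.1 z * β.1 u z) +
    ∑ p : T.Pairs, C p * T.dunklForm (T.dualAct ((T.refl p)⁻¹ * u) α) p z v *
        (f.1 z * β.1 ((T.refl p)⁻¹ * u) z) = _
  rw [h1, mul_add, Finset.mul_sum]
  simp only [mul_left_comm (f.1 z)]
  ring

theorem dM_smul_add (U : Opens T.X) (c : ℂ) (v v' : V) :
    dM C hα ξ U (c • v + v') = c • dM C hα ξ U v + dM C hα ξ U v' := by
  ext β u z
  change (dM C hα ξ U (c • v + v') β).1 u z = c * (dM C hα ξ U v β).1 u z + (dM C hα ξ U v' β).1 u z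
  rw [dM_apply, dM_apply, dM_apply, dv_smul_add]
  simp only [ξ.transport_eq, smul_add, smul_smul_complex, map_add, map_smul, smul_eq_mul, mul_add,
    add_mul, Finset.sum_add_distrib, mul_sub, Finset.mul_sum]
  rw [Finset.sum_congr rfl fun p _ => show C p * (c * (T.dunklForm (T.dualAct ((T.refl p)⁻¹ * u) α)
    p z) v) * β.1 ((T.refl p)⁻¹ * u) z = c * (C p * (T.dunklForm (T.dualAct ((T.refl p)⁻¹ * u) α)
    p z) v * β.1 ((T.refl p)⁻¹ * u) z) by ring]
  ring

/-- Reindexing 𝒮 by g, the equivariance of the Dunkl forms and the invariance of C match the two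
sums term by term. -/
theorem wM_dM {C : T.Pairs → ℂ} (hC : T.IsInvariant C) (U : Opens T.Y) (g : T.W) (v : V) :
    wM α U g * dM C hα ξ (T.pre U) v = dM C hα ξ (T.pre U) (g • v) * wM α U g := by
  ext β u z
  change (dM C hα ξ (T.pre U) v β).1 (g⁻¹ * u) ⟨g⁻¹ • (z : V), T.smul_mem_regLift g⁻¹ z.2⟩ =
    (dM C hα ξ (T.pre U) (g • v) (wM α U g β)).1 u z
  rw [dM_apply, dM_apply]
  have h1 := dv_translate (β.2 (g⁻¹ * u)).hol g (g • v) z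
  rw [inv_smul_smul] at h1
  change _ = dv (g • v) (translate g (β.1 (g⁻¹ * u))) z - ξ.transport u z (g • v) *
    β.1 (g⁻¹ * u) ⟨g⁻¹ • (z : V), T.smul_mem_regLift g⁻¹ z.2⟩ +
    ∑ p : T.Pairs, C p * T.dunklForm (T.dualAct ((T.refl p)⁻¹ * u) α) p z (g • v) *
        β.1 (g⁻¹ * ((T.refl p)⁻¹ * u)) ⟨g⁻¹ • (z : V), T.smul_mem_regLift g⁻¹ z.2⟩
  rw [h1]
  conv_rhs => rw [← Equiv.sum_comp (permP g)]
  congr 1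
  · congr 2
    rw [ξ.transport_eq, ξ.transport_eq, mul_inv_rev, inv_inv, mul_smul]
  · refine Finset.sum_congr rfl fun p _ => ?_
    change _ = C (smulP g p) * T.dunklForm (T.dualAct ((T.refl (smulP g p))⁻¹ * u) α) (smulP g p)
      z (g • v) * β.1 (g⁻¹ * ((T.refl (smulP g p))⁻¹ * u)) _
    have e1 : (T.refl (smulP g p))⁻¹ * u = g * ((T.refl p)⁻¹ * (g⁻¹ * u)) := by
      rw [refl_smulP]; group
    have hz : T.proj (g⁻¹ • (z : V)) ∉ p.H.1 := (T.smul_mem_regLift g⁻¹ z.2).2 p.H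
    have h2 := dunklForm_smulP ((hα.dualAct ((T.refl p)⁻¹ * (g⁻¹ * u))).refl_notMem p) g hz v
    rw [smul_inv_smul, ← dualAct_mul] at h2
    rw [e1, hC.apply_smulP, inv_mul_cancel_left, h2]

/-- The Dunkl operators commute. -/
theorem dM_comm {C : T.Pairs → ℂ} (hC : T.IsInvariant C) (U : Opens T.X) (v v' : V) :
    dM C hα ξ U v * dM C hα ξ U v' = dM C hα ξ U v' * dM C hα ξ U v := by
  classical
  ext β u z
  change (dM C hα ξ U v (dM C hα ξ U v' β)).1 u z = (dM C hα ξ U v' (dM C hα ξ U v β)).1 u z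
  have hO := T.isOpen_regLift U
  let a : T.Pairs → AntiDual V := fun p => T.dualAct ((T.refl p)⁻¹ * u) α
  have ha : ∀ p, T.HasTrivialStabilizer (a p) := fun p => hα.dualAct _
  let f : T.Pairs → V → T.regLift U → ℂ := fun p x => dunklCoef (a p) p U x
  let b : T.Pairs → T.regLift U → ℂ := fun p => β.1 ((T.refl p)⁻¹ * u)
  have hf : ∀ p x, IsHol (f p x) := fun p x => (isMerSection_dunklCoef (ha p) p U x).hol
  have hb : ∀ p, IsHol (b p) := fun p => (β.2 _).hol
  have hβ : IsHol (β.1 u) := (β.2 u).hol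
  -- Q is the part quadratic in the Dunkl forms, separated from the terms linear in them.
  let Q : V → V → ℂ := fun x y => ∑ q : T.Pairs, ∑ p : T.Pairs, C q * C p *
    (T.dunklForm (a q) q z x * T.dunklForm (T.dualAct ((T.refl p)⁻¹ * ((T.refl q)⁻¹ * u)) α) p z y) *
      β.1 ((T.refl p)⁻¹ * ((T.refl q)⁻¹ * u)) z
  have key : ∀ x y, (dM C hα ξ U x (dM C hα ξ U y β)).1 u z =
      dv x (dv y (β.1 u)) z - ξ.transport u z y * dv x (β.1 u) z
        - ξ.transport u z x * dv y (β.1 u) z + ξ.transport u z x * ξ.transport u z y * β.1 u z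
        + ∑ p : T.Pairs, C p * (dv x (f p y) z * b p z + f p y z * dv x (b p) z
          + f p x z * dv y (b p) z - (ξ.transport u z x * f p y z +
            f p x z * ξ.transport ((T.refl p)⁻¹ * u) z y) * b p z) + Q x y := by
    intro x y
    rw [dM_apply]
    have e1 : (dM C hα ξ U y β).1 u = dv y (β.1 u) + ((fun z => -ξ.form 0 (u⁻¹ • y) * β.1 u z) +
        fun z => ∑ p : T.Pairs, C p * (f p y z * b p z)) := by
      funext z
      rw [dM_apply, ξ.transport_eq]
      simp only [Pi.add_apply, f, dunklCoef, a, b, mul_assoc]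
      ring
    have hfb : ∀ p, IsHol fun z => C p * (f p y z * b p z) := fun p =>
      (isHol_const hO (C p)).mul hO ((hf p y).mul hO (hb p))
    have hξβ : IsHol fun z => -ξ.form 0 (u⁻¹ • y) * β.1 u z := (isHol_const hO _).mul hO hβ
    have hsum : IsHol fun z => ∑ p : T.Pairs, C p * (f p y z * b p z) := by
      refine isHol_of hO (S := fun z => ∑ p : T.Pairs, ext (fun z => C p * (f p y z * b p z)) z)
        (fun z hz => Finset.analyticAt_fun_sum _ fun p _ => hfb p z hz) fun z => ?_
      simp [ext_apply]
    have e2 : dv x ((dM C hα ξ U y β).1 u) z = dv x (dv y (β.1 u)) z -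
        ξ.transport u z y * dv x (β.1 u) z +
        ∑ p : T.Pairs, C p * (dv x (f p y) z * b p z + f p y z * dv x (b p) z) := by
      rw [e1, dv_add hO (hβ.dv hO y) (hξβ.add hO hsum), dv_add hO hξβ hsum,
        dv_const_mul hO hβ]
      simp only [Pi.add_apply]
      rw [dv_sum hO _ fun p _ => hfb p, ξ.transport_eq]
      have : ∀ p, dv x (fun z => C p * (f p y z * b p z)) z =
          C p * (dv x (f p y) z * b p z + f p y z * dv x (b p) z) := by
        intro p
        refine (congrFun (dv_const_mul hO ((hf p y).mul hO (hb p)) (C p) x) z).trans ?_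
        exact congrArg (C p * ·) (dv_mul hO (hf p y) (hb p) x z)
      simp only [this]
      ring
    rw [e2, dM_apply C hα ξ U y β u z]
    simp only [dM_apply C hα ξ U y β]
    have e3 : ∀ q : T.Pairs, C q * T.dunklForm (T.dualAct ((T.refl q)⁻¹ * u) α) q z x *
        (dv y (β.1 ((T.refl q)⁻¹ * u)) z - ξ.transport ((T.refl q)⁻¹ * u) z y *
          β.1 ((T.refl q)⁻¹ * u) z + ∑ p : T.Pairs, C p * T.dunklForm
            (T.dualAct ((T.refl p)⁻¹ * ((T.refl q)⁻¹ * u)) α) p z y *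
            β.1 ((T.refl p)⁻¹ * ((T.refl q)⁻¹ * u)) z) =
        C q * (f q x z * dv y (b q) z - f q x z * ξ.transport ((T.refl q)⁻¹ * u) z y * b q z) +
        ∑ p : T.Pairs, C q * C p * (T.dunklForm (a q) q z x *
          T.dunklForm (T.dualAct ((T.refl p)⁻¹ * ((T.refl q)⁻¹ * u)) α) p z y) *
          β.1 ((T.refl p)⁻¹ * ((T.refl q)⁻¹ * u)) z := by
      intro q
      rw [mul_add, Finset.mul_sum]
      congr 1
      · simp only [f, b, dunklCoef, a]; ring
      · exact Finset.sum_congr rfl fun p _ => by simp only [a]; ring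
    simp only [e3, Finset.sum_add_distrib, Q]
    have e4 : ∑ p : T.Pairs, C p * T.dunklForm (T.dualAct ((T.refl p)⁻¹ * u) α) p z y *
        β.1 ((T.refl p)⁻¹ * u) z = ∑ p : T.Pairs, C p * (f p y z * b p z) :=
      Finset.sum_congr rfl fun p _ => by simp only [f, b, dunklCoef, a]; ring
    rw [e4]
    have e5 : ∑ p : T.Pairs, C p * (dv x (f p y) z * b p z + f p y z * dv x (b p) z
          + f p x z * dv y (b p) z - (ξ.transport u z x * f p y z +
            f p x z * ξ.transport ((T.refl p)⁻¹ * u) z y) * b p z) =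
        ∑ p : T.Pairs, C p * (dv x (f p y) z * b p z + f p y z * dv x (b p) z) -
        ξ.transport u z x * ∑ p : T.Pairs, C p * (f p y z * b p z) +
        ∑ p : T.Pairs, C p * (f p x z * dv y (b p) z -
          f p x z * ξ.transport ((T.refl p)⁻¹ * u) z y * b p z) := by
      rw [Finset.mul_sum, ← Finset.sum_sub_distrib, ← Finset.sum_add_distrib]
      exact Finset.sum_congr rfl fun p _ => by ring
    rw [e5]
    ring
  have hQ : Q v v' = Q v' v := by
    have : Fintype T.W := Fintype.ofFinite _
    rw [← sub_eq_zero]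
    -- The double sum is grouped by the component x of β that it involves; then g_q g_p = u x⁻¹, and
    -- each group is a quadratic relation for the bundle L^x.
    have h1 : Q v v' - Q v' v = ∑ x : T.W, β.1 x z * ∑ y : T.Pairs × T.Pairs,
        if T.refl y.1 * T.refl y.2 = u * x⁻¹ then
          crossTerm C (T.dualAct x α) v v' y.1 y.2 z else 0 := by
      simp only [Q, ← Finset.sum_sub_distrib]
      simp only [Finset.mul_sum]
      conv_rhs => rw [Finset.sum_comm]
      rw [Fintype.sum_prod_type]
      refine Finset.sum_congr rfl fun q _ => Finset.sum_congr rfl fun p _ => ?_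
      have hcond : ∀ x : T.W, T.refl q * T.refl p = u * x⁻¹ ↔
          x = (T.refl p)⁻¹ * ((T.refl q)⁻¹ * u) := by
        intro x
        rw [eq_mul_inv_iff_mul_eq]
        constructor
        · intro h; rw [← h]; group
        · intro h; rw [h]; group
      simp only [hcond, mul_ite, mul_zero, Finset.sum_ite_eq', Finset.mem_univ, if_true]
      rw [crossTerm, ← dualAct_mul, mul_inv_cancel_left]
      simp only [a]
      ring
    rw [h1]
    refine Finset.sum_eq_zero fun x _ => ?_
    rw [sum_crossTerm_eq_zero hC (hα.dualAct x) v v' (u * x⁻¹) z.2.2, mul_zero]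
  rw [key, key, hQ, dv_comm hO hβ v v']
  -- The linear terms are symmetric in v and v': derivatives of the forms because these are closed,
  -- connection terms by `transport_wedge`, and the mixed terms by inspection.
  have hterm : ∀ p : T.Pairs, C p * (dv v (f p v') z * b p z + f p v' z * dv v (b p) z
          + f p v z * dv v' (b p) z - (ξ.transport u z v * f p v' z +
            f p v z * ξ.transport ((T.refl p)⁻¹ * u) z v') * b p z) =
        C p * (dv v' (f p v) z * b p z + f p v z * dv v' (b p) z
          + f p v' z * dv v (b p) z - (ξ.transport u z v' * f p v z +
            f p v' z * ξ.transport ((T.refl p)⁻¹ * u) z v) * b p z) := by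
    intro p
    have h2 := transport_wedge ξ (ha p) p u z.2.2 v v'
    have h3 : dv v (f p v') = dv v' (f p v) := dv_dunklCoef_comm (ha p) p U v v'
    rw [h3]
    change C p * (dv v' (f p v) z * b p z + f p v' z * dv v (b p) z
          + f p v z * dv v' (b p) z - (ξ.transport u z v * T.dunklForm (a p) p z v' +
            T.dunklForm (a p) p z v * ξ.transport ((T.refl p)⁻¹ * u) z v') * b p z) = _
    rw [h2]
    simp only [f, dunklCoef]
    ring
  simp only [hterm]
  ring

end SectionRelations

end TorusAction

namespace TorusAction

variable {V : Type u} [NormedAddCommGroup V] [NormedSpace ℂ V] {T : TorusAction V}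

/-! ### Evenly covered neighbourhoods -/

/-- `B` is an open set which is mapped injectively to `X`. -/
structure IsInjectiveOn (T : TorusAction V) (B : Set V) : Prop where
  isOpen : IsOpen B
  eq : ∀ y ∈ B, ∀ y' ∈ B, y - y' ∈ T.Γ → y = y'

theorem exists_isInjectiveOn (T : TorusAction V) (z : V) {N : Set V} (hN : N ∈ 𝓝 z) :
    ∃ B ⊆ N, z ∈ B ∧ T.IsInjectiveOn B := by
  obtain ⟨ε, hε, h⟩ := T.Γ.exists_pos_forall_norm_lt
  obtain ⟨δ, hδ, hb⟩ := Metric.mem_nhds_iff.1 hN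
  -- Half the minimal length of a nonzero lattice vector is a small enough radius, since two points
  -- of the ball then differ by less than that length.
  refine ⟨Metric.ball z (min δ (ε / 2)), (Metric.ball_subset_ball (min_le_left _ _)).trans hb,
    Metric.mem_ball_self (by positivity), Metric.isOpen_ball, fun y hy y' hy' hΓ => ?_⟩
  refine sub_eq_zero.1 (h _ hΓ ?_)
  rw [← dist_eq_norm]
  have h1 := (Metric.mem_ball.1 hy).trans_le (min_le_right _ _)
  have h2 := (Metric.mem_ball.1 hy').trans_le (min_le_right _ _)
  linarith [dist_triangle_right y y' z]

namespace IsInjectiveOn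

variable {B : Set V} (hB : T.IsInjectiveOn B)

include hB

/-- The image in `X`. -/
def image : Opens T.X := ⟨T.proj '' B, T.isOpenMap_proj B hB.isOpen⟩

theorem mem_lift_image {z : V} : z ∈ T.lift hB.image ↔ ∃ y ∈ B, z - y ∈ T.Γ := by
  constructor
  · rintro ⟨y, hy, e⟩
    exact ⟨y, hy, T.proj_eq_iff.1 e.symm⟩
  · rintro ⟨y, hy, e⟩
    exact ⟨y, hy, (T.proj_eq_iff.2 e).symm⟩

theorem subset_lift_image {z : V} (hz : z ∈ B) : z ∈ T.lift hB.image := ⟨z, hz, rfl⟩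

/-- A holomorphic function on `B` extends to a section of `L_α` over the image of `B`. -/
theorem exists_isHolSection (α : AntiDual V) {F : V → ℂ} (hF : AnalyticOnNhd ℂ F B) :
    ∃ s : T.lift hB.image → ℂ, T.IsHolSection α hB.image s ∧
      (∀ z (hz : z ∈ B), s ⟨z, hB.subset_lift_image hz⟩ = F z) ∧
      ∀ (z : T.lift hB.image), ∀ y ∈ B, (z : V) - y ∈ T.Γ → s z = mult α (z - y) * F y := by
  -- p(z) is the representative of z in B modulo Γ; it is unique, which makes the extension well
  -- defined and quasi-periodic.
  choose p hp hpΓ using fun z : T.lift hB.image => hB.mem_lift_image.1 z.2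
  have key : ∀ z : T.lift hB.image, ∀ y ∈ B, (z : V) - y ∈ T.Γ → p z = y := by
    intro z y hy h
    refine hB.eq _ (hp z) _ hy ?_
    have := sub_mem h (hpΓ z)
    rwa [sub_sub_sub_cancel_left] at this
  have hs : ∀ (z : T.lift hB.image), ∀ y ∈ B, (z : V) - y ∈ T.Γ →
      mult α (z - p z) * F (p z) = mult α (z - y) * F y := by
    intro z y hy h
    rw [key z y hy h]
  refine ⟨fun z => mult α (z - p z) * F (p z), ⟨fun z hz => ?_, fun z z' h => ?_⟩,
    fun z hz => ?_, hs⟩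
  · obtain ⟨y, hy, hΓ⟩ := hB.mem_lift_image.1 hz
    have hc : Tendsto (fun x => x - (z - y)) (𝓝 z) (𝓝 y) := by
      have : Continuous fun x : V => x - (z - y) := by fun_prop
      simpa using this.tendsto z
    have hFz : AnalyticAt ℂ (fun x => F (x - (z - y))) z := by
      refine AnalyticAt.fun_comp (by simpa using hF y hy) (by fun_prop)
    refine ((analyticAt_const (v := mult α (z - y))).fun_mul hFz).congr ?_
    filter_upwards [hc (hB.isOpen.mem_nhds hy), (T.isOpen_lift _).mem_nhds hz] with x hx hx'
    rw [ext_apply_mem _ hx', hs ⟨x, hx'⟩ _ hx (by simpa using hΓ)]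
    simp
  · have h1 : (z' : V) - p z ∈ T.Γ := by
      have := add_mem h (hpΓ z)
      rwa [sub_add_sub_cancel] at this
    change mult α (z' - p z') * F (p z') = mult α _ * (mult α (z - p z) * F (p z))
    rw [key z' _ (hp z) h1, ← mul_assoc, ← mult_add_right, sub_add_sub_cancel]
  · have := hs ⟨z, hB.subset_lift_image hz⟩ z hz (by simp)
    simpa [mult_zero_right] using this

end IsInjectiveOn

/-! ### Coherence -/

variable [FiniteDimensional ℂ V]

/-- Over an evenly covered open set, extending the constant 1 gives a nowhere vanishing section of
each line bundle, with inverse a section of the dual bundle. So F is free of rank |W| there, and the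
presentation needs no relations. -/
theorem isCoherent_sheafF (α : AntiDual V) : (T.sheafF α).IsCoherent := by
  intro x
  classical
  obtain ⟨z, rfl⟩ := T.proj_surjective x
  obtain ⟨B, -, hz, hB⟩ := T.exists_isInjectiveOn z univ_mem
  choose s hs _ hsm using fun w : T.W => hB.exists_isHolSection (T.dualAct w (-α))
    (F := fun _ => 1) fun _ _ => analyticAt_const
  have hs0 : ∀ w z, s w z ≠ 0 := by
    intro w z
    obtain ⟨y, hy, hΓ⟩ := hB.mem_lift_image.1 z.2
    rw [hsm w z y hy hΓ, mul_one]
    exact mult_ne_zero _ _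
  choose t ht _ htm using fun w : T.W => hB.exists_isHolSection (-T.dualAct w (-α))
    (F := fun _ => 1) fun _ _ => analyticAt_const
  have hst : ∀ w z, s w z * t w z = 1 := by
    intro w z
    obtain ⟨y, hy, hΓ⟩ := hB.mem_lift_image.1 z.2
    rw [hsm w z y hy hΓ, htm w z y hy hΓ, mult_neg_left, mul_one, mul_one,
      mul_inv_cancel₀ (mult_ne_zero _ _)]
  let n := Nat.card T.W
  let i : T.W ≃ Fin n := Finite.equivFin T.W
  let e : Fin n → T.holF α hB.image := fun k =>
    ⟨fun w => if i w = k then s w else 0, fun w => by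
      dsimp only
      split_ifs
      · exact hs w
      · exact isHolSection_zero⟩
  have key : ∀ (U' : Opens T.X) (h : U' ≤ hB.image) (a : Fin n → T.O U') (w : T.W) (z : T.lift U'),
      Subtype.val (p := (· ∈ T.holF α U')) (∑ k, a k • (T.sheafF α).res h (e k)) w z =
        (a (i w)).1 z * s w ⟨z, T.lift_mono h z.2⟩ := by
    intro U' h a w z
    let ev : T.holF α U' →+ ℂ :=
      { toFun := fun β => β.1 w z, map_zero' := rfl, map_add' := fun _ _ => rfl }
    change ev (∑ k, (show T.holF α U' from a k • (T.sheafF α).res h (e k))) = _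
    rw [map_sum]
    have : ∀ k, ev (show T.holF α U' from a k • (T.sheafF α).res h (e k)) =
        if i w = k then (a k).1 z * s w ⟨z, T.lift_mono h z.2⟩ else 0 := by
      intro k
      change (a k).1 z * (if i w = k then s w else 0) ⟨z, T.lift_mono h z.2⟩ = _
      split_ifs
      · rfl
      · exact mul_zero _
    simp only [this, Finset.sum_ite_eq, Finset.mem_univ, if_true]
  refine ⟨hB.image, hB.subset_lift_image hz, 0, n, e, fun k => k.elim0, fun k => k.elim0,
    fun U' h β y hy => ?_, fun U' h a ha y hy => ?_⟩
  · refine ⟨U', le_rfl, hy, fun k => ⟨fun z => t (i.symm k) ⟨z, T.lift_mono h z.2⟩ *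
      β.1 (i.symm k) z, ?_⟩, ?_⟩
    · have := ((ht (i.symm k)).restr h).mul (β.2 (i.symm k))
      rwa [neg_add_cancel] at this
    · refine Subtype.ext (funext fun w => funext fun z => ?_)
      refine Eq.trans ?_ (key U' h _ w z).symm
      simp only [Equiv.symm_apply_apply]
      have := hst w ⟨z, T.lift_mono h z.2⟩
      change β.1 w z = _
      linear_combination -(β.1 w z) * this
  · refine ⟨U', le_rfl, hy, fun k => k.elim0, fun k => ?_⟩
    refine Subtype.ext (funext fun z => ?_)
    have h1 := (congrArg (fun β : T.holF α U' => β.1 (i.symm k) z) ha).symm.trans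
      (key U' h a (i.symm k) z)
    rw [Equiv.apply_symm_apply] at h1
    have h2 := (mul_eq_zero.1 h1.symm).resolve_right (hs0 _ _)
    rw [Finset.univ_eq_empty, Finset.sum_empty]
    exact h2

/-! ### Test functions -/

theorem isOpenMap_toY : IsOpenMap T.toY := by
  intro U hU
  have : ContinuousConstSMul T.W T.X := ⟨continuous_smulX⟩
  exact isOpenMap_quotient_mk'_mul (Γ := T.W) U hU

open scoped Classical in
/-- Near a point of `X` with trivial stabilizer, there is a function which is the exponential of a
linear form near a single point of the orbit. -/
theorem IsFree.exists_test {z₀ : V} (hz₀ : T.IsFree z₀) {U : Opens T.Y} (hU : z₀ ∈ T.lift (T.pre U))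
    (w₀ : T.W) (l : V →L[ℂ] ℂ) : ∃ (U' : Opens T.Y) (_ : U' ≤ U) (_ : z₀ ∈ T.lift (T.pre U'))
      (s : T.OD (T.pre U')), ∀ᶠ z in 𝓝 z₀, ∀ (hz : z ∈ T.regLift (T.pre U')) (w : T.W),
        (T.wOp U' w s).1 ⟨z, hz⟩ = if w = w₀ then Complex.exp (l z) else 0 := by
  classical
  -- Triviality of the stabilizer is an open condition: for points y₁, y₂ near z₀ and g ≠ 1, g y₁
  -- and y₂ stay distinct modulo Γ. Hence the translates of the image of a small B by distinct
  -- elements of W are disjoint.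
  have hfree : ∀ᶠ y in 𝓝 z₀ ×ˢ 𝓝 z₀, ∀ g : T.W, g ≠ 1 → g • y.1 - y.2 ∉ T.Γ := by
    rw [← nhds_prod_eq]
    refine eventually_all.2 fun g => ?_
    by_cases hg : g = 1
    · simp [hg]
    have hc : Continuous fun y : V × V => g • y.1 - y.2 :=
      ((T.continuous_smulV g).comp continuous_fst).sub continuous_snd
    filter_upwards [hc.continuousAt.preimage_mem_nhds
      (T.isClosed_lattice.isOpen_compl.mem_nhds (hz₀ g hg))] with y hy _ using hy
  obtain ⟨N₁, hN₁, N₂, hN₂, hN⟩ := mem_prod_iff.1 hfree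
  obtain ⟨B, hBN, hzB, hB⟩ := T.exists_isInjectiveOn z₀
    (inter_mem (inter_mem hN₁ hN₂) ((T.isOpen_lift _).mem_nhds hU))
  obtain ⟨s, hs, hsB, -⟩ := hB.exists_isHolSection 0 (F := fun z => Complex.exp (l z))
    fun z _ => (l.analyticAt z).cexp
  have hdisj : ∀ (z : V) (w w' : T.W), w • z ∈ T.lift hB.image → w' • z ∈ T.lift hB.image →
      w = w' := by
    intro z w w' h h'
    obtain ⟨y, hy, hΓ⟩ := hB.mem_lift_image.1 h
    obtain ⟨y', hy', hΓ'⟩ := hB.mem_lift_image.1 h'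
    by_contra hne
    refine hN (Set.mk_mem_prod (hBN hy).1.1 (hBN hy').1.2) (w' * w⁻¹)
      (fun e => hne (mul_inv_eq_one.1 e).symm) ?_
    have h1 := T.smul_mem (w' * w⁻¹) hΓ
    have h2 := sub_mem hΓ' h1
    rw [smul_sub, mul_smul, inv_smul_smul] at h2
    simp only
    convert h2 using 1
    rw [mul_smul]
    abel
  let U' : Opens T.Y := ⟨T.toY '' hB.image, isOpenMap_toY _ hB.image.isOpen⟩
  have hmem : ∀ z ∈ T.lift (T.pre U'), ∃ w : T.W, w • z ∈ T.lift hB.image := by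
    rintro z ⟨x, hx, e⟩
    obtain ⟨w, hw⟩ := Quotient.exact (s := MulAction.orbitRel T.W T.X) e
    exact ⟨w, by
      change T.proj (w • z) ∈ hB.image
      rw [T.proj_smul]
      exact (congrArg (· ∈ hB.image) hw).mpr hx⟩
  have hle : U' ≤ U := by
    rintro _ ⟨x, ⟨y, hy, rfl⟩, rfl⟩
    exact (hBN hy).2
  -- The function s transported by w₀⁻¹ to one sheet of the orbit and extended by zero. Then (w
  -- t)(z) = t(w⁻¹z) is evaluated at w₀ w⁻¹ z, which for z near z₀ meets the image of B only when w
  -- = w₀.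
  let t : T.regLift (T.pre U') → ℂ := fun z =>
    if h : w₀ • (z : V) ∈ T.lift hB.image then s ⟨w₀ • (z : V), h⟩ else 0
  -- Near each point t is either a translate of s or zero, since every point of U' lies in exactly
  -- one of the disjoint translates.
  have hcl : ∀ z ∈ T.lift (T.pre U'), ∃ q : V → ℂ, AnalyticAt ℂ q z ∧
      ∀ᶠ y in 𝓝 z, ∀ hy : y ∈ T.regLift (T.pre U'), t ⟨y, hy⟩ = q y := by
    intro z hz
    obtain ⟨w, hw⟩ := hmem z hz
    have hev := (T.continuous_smulV w).continuousAt.preimage_mem_nhds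
      ((T.isOpen_lift hB.image).mem_nhds hw)
    by_cases e : w = w₀
    · subst e
      refine ⟨fun y => ext s (w • y), (hs.hol _ hw).fun_comp (T.analytic_smulV w z), ?_⟩
      filter_upwards [hev] with y hy hy'
      change (if h : _ then _ else _) = _
      have hy : w • y ∈ T.lift hB.image := hy
      rw [dif_pos hy, ext_apply_mem s hy]
    · refine ⟨fun _ => 0, analyticAt_const, ?_⟩
      filter_upwards [hev] with y hy hy'
      change (if h : _ then _ else _) = _
      rw [dif_neg fun h => e (hdisj y _ _ hy h)]
  have ht : T.IsMerSection 0 (T.pre U') t := by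
    refine ⟨fun z hz => ?_, fun z z' h => ?_, fun z hz => ?_⟩
    · obtain ⟨q, hq, he⟩ := hcl z hz.1
      refine hq.congr ?_
      filter_upwards [he, (T.isOpen_regLift _).mem_nhds hz] with y hy hy'
      rw [ext_apply_mem t hy', hy hy']
    · rw [mult_zero_left, one_mul]
      have e : T.proj (w₀ • (z' : V)) = T.proj (w₀ • (z : V)) := by
        rw [T.proj_smul, T.proj_smul, T.proj_eq_iff.2 h]
      have e2 : w₀ • (z' : V) ∈ T.lift hB.image ↔ w₀ • (z : V) ∈ T.lift hB.image := by
        change T.proj (w₀ • (z' : V)) ∈ hB.image ↔ T.proj (w₀ • (z : V)) ∈ hB.image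
        rw [e]
      by_cases h1 : w₀ • (z : V) ∈ T.lift hB.image
      · have h2 := e2.2 h1
        change (if h : _ then _ else _) = (if h : _ then _ else _)
        rw [dif_pos h1, dif_pos h2]
        have := hs.mult ⟨_, h1⟩ ⟨_, h2⟩ (T.proj_eq_iff.1 e)
        rwa [mult_zero_left, one_mul] at this
      · change (if h : _ then _ else _) = (if h : _ then _ else _)
        rw [dif_neg h1, dif_neg fun h => h1 (e2.1 h)]
    · obtain ⟨q, hq, he⟩ := hcl z hz
      exact ⟨fun _ => 1, q, analyticAt_const, hq, he.mono fun y hy hy' =>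
        ⟨one_ne_zero, by rw [one_mul, hy hy']⟩⟩
  refine ⟨U', hle, ⟨T.proj z₀, ⟨z₀, hzB, rfl⟩, rfl⟩, ⟨t, ht⟩, ?_⟩
  filter_upwards [hB.isOpen.mem_nhds hzB] with z hz hz' w
  change (if h : w₀ • w⁻¹ • z ∈ T.lift hB.image then s ⟨_, h⟩ else 0) = _
  by_cases e : w = w₀
  · subst e
    have h1 : w • w⁻¹ • z = z := smul_inv_smul w z
    have h2 : w • w⁻¹ • z ∈ T.lift hB.image := by rw [h1]; exact hB.subset_lift_image hz
    rw [dif_pos h2, if_pos rfl, ← hsB z hz]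
    congr 2
  · rw [if_neg e, dif_neg]
    intro h
    rw [← mul_smul] at h
    have := hdisj z _ 1 h (by rw [one_smul]; exact hB.subset_lift_image hz)
    exact e (mul_inv_eq_one.1 this).symm

end TorusAction

/-! ### Algebras generated by functions, vector fields and a group -/

theorem isLinearMap_of_smul_add {k M N : Type*} [Ring k] [AddCommGroup M] [AddCommGroup N]
    [Module k M] [Module k N] {f : M → N}
    (h : ∀ (c : k) (v v' : M), f (c • v + v') = c • f v + f v') :
    IsLinearMap k f where
  map_add v v' := by simpa using h 1 v v'
  map_smul c v := by
    have h0 : f 0 = 0 := by simpa using h 1 0 0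
    simpa [h0] using h c v 0

section NormalForm

variable {k A : Type*} [CommRing k] [Ring A] [Algebra k A] {ι : Type*}

/-- A is not commutative, so evaluation of polynomials goes through the commutative subalgebra
generated by the x i. -/
theorem MvPolynomial.exists_algHom_of_commute (x : ι → A) (hx : ∀ i j, x i * x j = x j * x i) :
    ∃ φ : MvPolynomial ι k →ₐ[k] A, ∀ i, φ (MvPolynomial.X i) = x i := by
  have h := Algebra.isMulCommutative_adjoin k (s := Set.range x) (by
    rintro _ ⟨i, rfl⟩ _ ⟨j, rfl⟩
    exact hx i j)
  let : CommRing (Algebra.adjoin k (Set.range x)) :=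
    { (Algebra.adjoin k (Set.range x)).toRing with
      mul_comm := h.is_comm.comm }
  refine ⟨(Algebra.adjoin k (Set.range x)).val.comp
    (MvPolynomial.aeval fun i => ⟨x i, Algebra.subset_adjoin ⟨i, rfl⟩⟩), fun i => ?_⟩
  simp

variable {R G : Type*} [CommRing R] [Algebra k R] [Group G] {m : R →ₐ[k] A} {w : G →* A}
  {φ : MvPolynomial ι k →ₐ[k] A}

theorem exists_mul_eq_of_forall_X {a : G}
    (h : ∀ i, ∃ p, w a * φ (MvPolynomial.X i) = φ p * w a) (p : MvPolynomial ι k) :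
    ∃ p', w a * φ p = φ p' * w a := by
  induction p using MvPolynomial.induction_on with
  | C c =>
    refine ⟨MvPolynomial.C c, ?_⟩
    rw [← MvPolynomial.algebraMap_eq, AlgHom.commutes]
    exact (Algebra.commutes c (w a)).symm
  | add p q hp hq =>
    obtain ⟨p', hp⟩ := hp
    obtain ⟨q', hq⟩ := hq
    exact ⟨p' + q', by rw [map_add, map_add, mul_add, add_mul, hp, hq]⟩
  | mul_X p i hp =>
    obtain ⟨p', hp⟩ := hp
    obtain ⟨q', hq⟩ := h i
    exact ⟨p' * q', by rw [map_mul, map_mul, ← mul_assoc, hp, mul_assoc, hq, mul_assoc]⟩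

/-- Every element of the algebra is a combination of products of functions, constant coefficient
differential operators, and group elements, in this order. -/
theorem adjoin_le_span_normalForm {S : Set A} (hwm : ∀ g f, ∃ f', w g * m f = m f' * w g)
    (hwφ : ∀ g i, ∃ p, w g * φ (MvPolynomial.X i) = φ p * w g)
    (hS : ∀ x ∈ S, (∃ f, x = m f) ∨ (∃ g, x = w g) ∨
      ∃ p, x = φ p ∧ ∀ f, ∃ f', x * m f = m f * x + m f') :
    (Algebra.adjoin k S : Set A) ⊆
      Submodule.span k {x | ∃ f p g, x = m f * φ p * w g} := by
  set N := Submodule.span k {x | ∃ f p g, x = m f * φ p * w g}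
  -- It suffices that the span N contains 1 and is stable under left multiplication by generators:
  -- functions multiply on the left, group elements are moved to the right, and a vector field
  -- passes a function at the cost of another function.
  have hgen : ∀ x ∈ S, ∀ y ∈ N, x * y ∈ N := by
    intro x hx y hy
    induction hy using Submodule.span_induction with
    | zero => rw [mul_zero]; exact zero_mem _
    | add y z _ _ hy hz => rw [mul_add]; exact add_mem hy hz
    | smul c y _ hy => rw [mul_smul_comm]; exact Submodule.smul_mem _ c hy
    | mem y hy =>
      obtain ⟨f, p, g, rfl⟩ := hy
      obtain ⟨f', rfl⟩ | ⟨g', rfl⟩ | ⟨q, hq, hqf⟩ := hS x hx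
      · exact Submodule.subset_span ⟨f' * f, p, g, by rw [map_mul]; simp only [mul_assoc]⟩
      · obtain ⟨f', hf'⟩ := hwm g' f
        obtain ⟨p', hp'⟩ := exists_mul_eq_of_forall_X (hwφ g') p
        refine Submodule.subset_span ⟨f', p', g' * g, ?_⟩
        rw [mul_assoc, ← mul_assoc (w g'), hf', mul_assoc (m f'), ← mul_assoc (w g'), hp', map_mul]
        simp only [mul_assoc]
      · obtain ⟨f', hf'⟩ := hqf f
        rw [mul_assoc, ← mul_assoc x, hf', add_mul]
        refine add_mem (Submodule.subset_span ⟨f, q * p, g, ?_⟩)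
          (Submodule.subset_span ⟨f', p, g, by rw [mul_assoc]⟩)
        rw [hq, map_mul]
        simp only [mul_assoc]
  intro x hx
  have h1 : (1 : A) ∈ N := Submodule.subset_span ⟨1, 1, 1, by simp⟩
  have key : ∀ y ∈ N, x * y ∈ N := by
    induction hx using Algebra.adjoin_induction with
    | mem x hx => exact hgen x hx
    | algebraMap c =>
      intro y hy
      rw [← Algebra.smul_def]
      exact Submodule.smul_mem _ c hy
    | add x x' _ _ hx hx' =>
      intro y hy
      rw [add_mul]
      exact add_mem (hx y hy) (hx' y hy)
    | mul x x' _ _ hx hx' =>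
      intro y hy
      rw [mul_assoc]
      exact hx _ (hx' y hy)
  simpa using key 1 h1

end NormalForm

namespace TorusAction

variable {V : Type u} [NormedAddCommGroup V] [NormedSpace ℂ V] {T : TorusAction V}
  [FiniteDimensional ℂ V]

/-! ### Pairs of operators on functions and on sections of `F` -/

section Pairs

variable {α : AntiDual V} (C : T.Pairs → ℂ) (hα : T.HasTrivialStabilizer α) (ξ : T.FlatConnection)

variable (T α) in
/-- Families of operators on functions, together with families of operators on sections of `F`. -/
abbrev FamPair (U : Opens T.Y) : Type u :=
  T.Fam U × ∀ U' : Set.Iic U, Module.End ℂ (T.merF α (T.pre U'.1))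

/-- Restriction of pairs of families of operators. -/
def resPair {U U' : Opens T.Y} (h : U' ≤ U) : FamPair T α U →ₐ[ℂ] FamPair T α U' :=
  AlgHom.prodMap (T.resFam h)
    (AlgHom.pi fun U'' => Pi.evalAlgHom ℂ _ (⟨U''.1, le_trans U''.2 h⟩ : Set.Iic U))

theorem mulFam_mul {U : Opens T.Y} (f f' : T.OD (T.pre U)) :
    T.mulFam (f * f') = T.mulFam f * T.mulFam f' := by
  funext U'
  ext s z
  exact mul_assoc (f.1 _) (f'.1 _) (s.1 z)

theorem mulFam_add {U : Opens T.Y} (f f' : T.OD (T.pre U)) :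
    T.mulFam (f + f') = T.mulFam f + T.mulFam f' := by
  funext U'
  ext s z
  exact add_mul (f.1 _) (f'.1 _) (s.1 z)

theorem mulFam_smul {U : Opens T.Y} (c : ℂ) (f : T.OD (T.pre U)) :
    T.mulFam (c • f) = c • T.mulFam f := by
  funext U'
  ext s z
  exact mul_assoc c (f.1 _) (s.1 z)

theorem mulFam_one {U : Opens T.Y} : T.mulFam (1 : T.OD (T.pre U)) = 1 := by
  funext U'
  ext s z
  exact one_mul (s.1 z)

variable (α) in
/-- Multiplication by functions. -/
def mulPair (U : Opens T.Y) : T.OD (T.pre U) →ₐ[ℂ] FamPair T α U :=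
  AlgHom.ofLinearMap
    { toFun := fun f => (T.mulFam f, fun U' => mulM α (T.resOD (T.pre_mono U'.2) f))
      map_add' := fun f f' => Prod.ext (mulFam_add f f')
        (funext fun U' => mulM_add (T.resOD (T.pre_mono U'.2) f) (T.resOD (T.pre_mono U'.2) f'))
      map_smul' := fun c f => Prod.ext (mulFam_smul c f)
        (funext fun U' => mulM_smul c (T.resOD (T.pre_mono U'.2) f)) }
    (Prod.ext mulFam_one (funext fun _ => mulM_one))
    (fun f f' => Prod.ext (mulFam_mul f f')
      (funext fun U' => mulM_mul (T.resOD (T.pre_mono U'.2) f) (T.resOD (T.pre_mono U'.2) f')))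

variable (α) in
/-- The action of `W`. -/
def wPair (U : Opens T.Y) : T.W →* FamPair T α U where
  toFun g := (T.wFam U g, fun U' => wM α U'.1 g)
  map_one' := Prod.ext (funext fun U' => wOp_one U'.1) (funext fun U' => wM_one U'.1)
  map_mul' g g' := Prod.ext (funext fun U' => wOp_mul U'.1 g g') (funext fun U' => wM_mul U'.1 g g')

theorem isLinearMap_dOp (U : Opens T.X) : IsLinearMap ℂ (T.dOp U) :=
  isLinearMap_of_smul_add (f := T.dOp U) (dOp_smul_add U)

theorem isLinearMap_dM (U : Opens T.X) : IsLinearMap ℂ (dM C hα ξ U) :=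
  isLinearMap_of_smul_add (f := dM C hα ξ U) (dM_smul_add C hα ξ U)

/-- The vector fields, and their images under the Dunkl representation. -/
noncomputable def dPair (U : Opens T.Y) : V →ₗ[ℂ] FamPair T α U where
  toFun v := (T.dFam U v, fun U' => dM C hα ξ (T.pre U'.1) v)
  map_add' v v' := Prod.ext (funext fun U' => (isLinearMap_dOp (T.pre U'.1)).map_add v v')
    (funext fun U' => (isLinearMap_dM C hα ξ (T.pre U'.1)).map_add v v')
  map_smul' c v := Prod.ext (funext fun U' => (isLinearMap_dOp (T.pre U'.1)).map_smul c v)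
    (funext fun U' => (isLinearMap_dM C hα ξ (T.pre U'.1)).map_smul c v)

/-- The generators of `W ⋉ D_{X_reg}`, together with their images under the Dunkl representation. -/
def genPair (U : Opens T.Y) : Set (FamPair T α U) :=
  {x | (∃ f, x = mulPair α U f) ∨ (∃ w, x = wPair α U w) ∨ ∃ v, x = dPair C hα ξ U v}

/-- The algebra generated by `genPair`. -/
def algPair (U : Opens T.Y) : Subalgebra ℂ (FamPair T α U) :=
  Algebra.adjoin ℂ (genPair C hα ξ U)

theorem resPair_mem {U U' : Opens T.Y} (h : U' ≤ U) {x : FamPair T α U}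
    (hx : x ∈ algPair C hα ξ U) : resPair h x ∈ algPair C hα ξ U' := by
  have h1 : resPair h x ∈ (algPair C hα ξ U).map (resPair h) := ⟨x, hx, rfl⟩
  rw [algPair, AlgHom.map_adjoin] at h1
  refine Algebra.adjoin_mono ?_ h1
  rintro _ ⟨_, ⟨f, rfl⟩ | ⟨w, rfl⟩ | ⟨v, rfl⟩, rfl⟩
  · exact Or.inl ⟨T.resOD (T.pre_mono h) f, rfl⟩
  · exact Or.inr (Or.inl ⟨w, rfl⟩)
  · exact Or.inr (Or.inr ⟨v, rfl⟩)

theorem map_fst_algPair (U : Opens T.Y) :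
    (algPair C hα ξ U).map (AlgHom.fst ℂ _ _) = Algebra.adjoin ℂ (T.genWD U) := by
  rw [algPair, AlgHom.map_adjoin]
  congr 1
  ext D
  constructor
  · rintro ⟨_, ⟨f, rfl⟩ | ⟨w, rfl⟩ | ⟨v, rfl⟩, rfl⟩
    · exact Or.inl ⟨f, rfl⟩
    · exact Or.inr (Or.inl ⟨w, rfl⟩)
    · exact Or.inr (Or.inr ⟨v, rfl⟩)
  · rintro (⟨f, rfl⟩ | ⟨w, rfl⟩ | ⟨v, rfl⟩)
    · exact ⟨mulPair α U f, Or.inl ⟨f, rfl⟩, rfl⟩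
    · exact ⟨wPair α U w, Or.inr (Or.inl ⟨w, rfl⟩), rfl⟩
    · exact ⟨dPair C hα ξ U v, Or.inr (Or.inr ⟨v, rfl⟩), rfl⟩

theorem fst_mem_adjoin {U : Opens T.Y} {x : FamPair T α U} (hx : x ∈ algPair C hα ξ U) :
    x.1 ∈ Algebra.adjoin ℂ (T.genWD U) := by
  rw [← map_fst_algPair C hα ξ U]
  exact ⟨x, hx, rfl⟩

theorem exists_mem_algPair {U : Opens T.Y} {D : T.Fam U}
    (hD : D ∈ Algebra.adjoin ℂ (T.genWD U)) : ∃ x ∈ algPair C hα ξ U, x.1 = D := by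
  rw [← map_fst_algPair C hα ξ U] at hD
  exact hD

/-- A family of operators on sections of `F` is compatible with restrictions. -/
def IsCompatF {U : Opens T.Y} (E : ∀ U' : Set.Iic U, Module.End ℂ (T.merF α (T.pre U'.1))) : Prop :=
  ∀ (U₁ U₂ : Set.Iic U) (h : U₂.1 ≤ U₁.1) (s : T.merF α (T.pre U₁.1)),
    T.resMerF α (T.pre_mono h) (E U₁ s) = E U₂ (T.resMerF α (T.pre_mono h) s)

theorem dv_restr {Ω Ω' : Set V} (hΩ' : IsOpen Ω') (h : Ω' ⊆ Ω) (s : Ω → ℂ) (v : V) :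
    dv v (restr h s) = restr h (dv v s) := by
  funext z
  exact dv_eq_of_eventuallyEq hΩ' (S := ext s)
    (Eventually.of_forall fun y hy => (ext_apply_mem s (h hy)).symm) v

theorem isCompatF_of_mem {U : Opens T.Y} {x : FamPair T α U} (hx : x ∈ algPair C hα ξ U) :
    IsCompatF x.2 := by
  induction hx using Algebra.adjoin_induction with
  | mem x hx =>
    obtain ⟨f, rfl⟩ | ⟨w, rfl⟩ | ⟨v, rfl⟩ := hx
    · exact fun _ _ _ _ => rfl
    · exact fun _ _ _ _ => rfl
    · intro U₁ U₂ h s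
      ext u z
      have := congrFun (dv_restr (T.isOpen_regLift (T.pre U₂.1)) (T.regLift_mono (T.pre_mono h))
        (s.1 u) v) z
      change dv v (s.1 u) ⟨z, _⟩ - _ + _ =
        dv v (restr (T.regLift_mono (T.pre_mono h)) (s.1 u)) z - _ + _
      rw [this]
      rfl
  | algebraMap c => exact fun _ _ _ _ => rfl
  | add x y _ _ hx hy =>
    intro U₁ U₂ h s
    change T.resMerF α (T.pre_mono h) (x.2 U₁ s) + T.resMerF α (T.pre_mono h) (y.2 U₁ s) =
      x.2 U₂ _ + y.2 U₂ _
    rw [hx U₁ U₂ h, hy U₁ U₂ h]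
  | mul x y _ _ hx hy =>
    intro U₁ U₂ h s
    change T.resMerF α (T.pre_mono h) (x.2 U₁ (y.2 U₁ s)) = x.2 U₂ (y.2 U₂ _)
    rw [hx U₁ U₂ h, hy U₁ U₂ h]

end Pairs

end TorusAction

namespace TorusAction

variable {V : Type u} [NormedAddCommGroup V] [NormedSpace ℂ V] {T : TorusAction V}
  [FiniteDimensional ℂ V]

/-! ### Elements of the algebra as differential-difference operators -/

section Faithful

variable {α : AntiDual V} {C : T.Pairs → ℂ} (hC : T.IsInvariant C) (hα : T.HasTrivialStabilizer α)
  (ξ : T.FlatConnection)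

/-- The value at `z` of an operator applied to a function. -/
def evalFun {U : Opens T.Y} (U' : Set.Iic U) (s : T.OD (T.pre U'.1)) (z : T.regLift (T.pre U'.1)) :
    FamPair T α U →ₗ[ℂ] ℂ where
  toFun x := (x.1 U' s).1 z
  map_add' _ _ := rfl
  map_smul' _ _ := rfl

/-- The value at `z` of an operator applied to a section. -/
def evalSec {U : Opens T.Y} (U' : Set.Iic U) (β : T.merF α (T.pre U'.1)) (u : T.W)
    (z : T.regLift (T.pre U'.1)) : FamPair T α U →ₗ[ℂ] ℂ where
  toFun x := (x.2 U' β).1 u z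
  map_add' _ _ := rfl
  map_smul' _ _ := rfl

include hC

theorem dPair_comm (U : Opens T.Y) (v v' : V) :
    dPair C hα ξ U v * dPair C hα ξ U v' = dPair C hα ξ U v' * dPair C hα ξ U v :=
  Prod.ext (funext fun U' => dOp_comm (T.pre U'.1) v v')
    (funext fun U' => dM_comm hα ξ hC (T.pre U'.1) v v')

theorem wPair_dPair (U : Opens T.Y) (g : T.W) (v : V) :
    wPair α U g * dPair C hα ξ U v = dPair C hα ξ U (g • v) * wPair α U g :=
  Prod.ext (funext fun U' => wOp_dOp U'.1 g v) (funext fun U' => wM_dM hα ξ hC U'.1 g v)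

omit hC

theorem wPair_mulPair (U : Opens T.Y) (g : T.W) (f : T.OD (T.pre U)) :
    wPair α U g * mulPair α U f = mulPair α U (T.wOp U g f) * wPair α U g := rfl

theorem dPair_mulPair (U : Opens T.Y) (v : V) (f : T.OD (T.pre U)) :
    dPair C hα ξ U v * mulPair α U f =
      mulPair α U f * dPair C hα ξ U v + mulPair α U (T.dOp (T.pre U) v f) := by
  have h : ∀ U' : Set.Iic U, T.dOp (T.pre U'.1) v (T.resOD (T.pre_mono U'.2) f) =
      T.resOD (T.pre_mono U'.2) (T.dOp (T.pre U) v f) := fun U' =>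
    (T.isCompat_dFam U v ⟨U, le_refl U⟩ U' U'.2 f).symm
  refine Prod.ext (funext fun U' => LinearMap.ext fun s => ?_) (funext fun U' => ?_)
  · change T.dOp (T.pre U'.1) v (T.resOD (T.pre_mono U'.2) f * s) =
      T.resOD (T.pre_mono U'.2) f * T.dOp (T.pre U'.1) v s +
        T.resOD (T.pre_mono U'.2) (T.dOp (T.pre U) v f) * s
    rw [dOp_apply_mul, h]
  · change dM C hα ξ (T.pre U'.1) v * mulM α (T.resOD (T.pre_mono U'.2) f) =
      mulM α (T.resOD (T.pre_mono U'.2) f) * dM C hα ξ (T.pre U'.1) v +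
        mulM α (T.resOD (T.pre_mono U'.2) (T.dOp (T.pre U) v f))
    rw [dM_mulM, h]

include hC

omit hC

/-- `x` is given at each point by a combination of products of differential operators with constant
coefficients and elements of `W`. -/
def HasSymbol [Fintype T.W] {U : Opens T.Y} {ι : Type*}
    (φ : MvPolynomial ι ℂ →ₐ[ℂ] FamPair T α U) (x : FamPair T α U) : Prop :=
  ∃ q : V → T.W → MvPolynomial ι ℂ,
    (∀ U' s z, evalFun U' s z x =
      ∑ g, (evalFun U' (T.wOp U'.1 g s) z ∘ₗ φ.toLinearMap) (q z g)) ∧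
    ∀ U' β u z, evalSec U' β u z x =
      ∑ g, (evalSec U' (wM α U'.1 g β) u z ∘ₗ φ.toLinearMap) (q z g)

section HasSymbol

variable [Fintype T.W] {U : Opens T.Y} {ι : Type*} {φ : MvPolynomial ι ℂ →ₐ[ℂ] FamPair T α U}

theorem hasSymbol_zero : HasSymbol φ 0 :=
  ⟨fun _ _ => 0, fun U' s z => by simp only [LinearMap.map_zero, Finset.sum_const_zero],
    fun U' β u z => by simp only [LinearMap.map_zero, Finset.sum_const_zero]⟩

theorem HasSymbol.add {x y : FamPair T α U} (hx : HasSymbol φ x) (hy : HasSymbol φ y) :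
    HasSymbol φ (x + y) := by
  obtain ⟨q, h1, h2⟩ := hx
  obtain ⟨q', h1', h2'⟩ := hy
  refine ⟨fun z g => q z g + q' z g, fun U' s z => ?_, fun U' β u z => ?_⟩
  · rw [LinearMap.map_add, h1, h1', ← Finset.sum_add_distrib]
    exact Finset.sum_congr rfl fun g _ => (LinearMap.map_add _ _ _).symm
  · rw [LinearMap.map_add, h2, h2', ← Finset.sum_add_distrib]
    exact Finset.sum_congr rfl fun g _ => (LinearMap.map_add _ _ _).symm

theorem HasSymbol.smul {x : FamPair T α U} (hx : HasSymbol φ x) (c : ℂ) : HasSymbol φ (c • x) := by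
  obtain ⟨q, h1, h2⟩ := hx
  refine ⟨fun z g => c • q z g, fun U' s z => ?_, fun U' β u z => ?_⟩
  · rw [LinearMap.map_smul, h1, Finset.smul_sum]
    exact Finset.sum_congr rfl fun g _ => (LinearMap.map_smul _ _ _).symm
  · rw [LinearMap.map_smul, h2, Finset.smul_sum]
    exact Finset.sum_congr rfl fun g _ => (LinearMap.map_smul _ _ _).symm

theorem hasSymbol_mul_mul (f : T.OD (T.pre U)) (p : MvPolynomial ι ℂ) (g : T.W) :
    HasSymbol φ (mulPair α U f * φ p * wPair α U g) := by
  classical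
  -- The coefficient f is frozen at its value at z. The same symbol serves for both components of
  -- the pair.
  refine ⟨fun z h => if h = g then ext f.1 z • p else 0, fun U' s z => ?_, fun U' β u z => ?_⟩
  · rw [Finset.sum_eq_single g (fun h _ hh => by
        dsimp only
        rw [if_neg hh, LinearMap.map_zero])
      (fun h => absurd (Finset.mem_univ g) h)]
    dsimp only
    rw [if_pos rfl, LinearMap.map_smul, ext_apply_mem f.1 (T.regLift_mono (T.pre_mono U'.2) z.2)]
    rfl
  · rw [Finset.sum_eq_single g (fun h _ hh => by
        dsimp only
        rw [if_neg hh, LinearMap.map_zero])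
      (fun h => absurd (Finset.mem_univ g) h)]
    dsimp only
    rw [if_pos rfl, LinearMap.map_smul, ext_apply_mem f.1 (T.regLift_mono (T.pre_mono U'.2) z.2)]
    rfl

end HasSymbol

include hC

/-- The commutation relations hold for pairs, so every pair has the normal form Σ f·p(∂)·g.
Evaluated at a point, it depends only on polynomials indexed by W, shared by the operator on
functions and by the operator on sections. -/
theorem exists_hasSymbol [Fintype T.W] (U : Opens T.Y) {ι : Type*} [Fintype ι]
    (b : Module.Basis ι ℂ V) :
    ∃ φ : MvPolynomial ι ℂ →ₐ[ℂ] FamPair T α U,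
      (∀ i, φ (MvPolynomial.X i) = dPair C hα ξ U (b i)) ∧
      ∀ x ∈ algPair C hα ξ U, HasSymbol φ x := by
  obtain ⟨φ, hφ⟩ := MvPolynomial.exists_algHom_of_commute (k := ℂ)
    (fun i => dPair C hα ξ U (b i)) fun i j => dPair_comm hC hα ξ U _ _
  have hd : ∀ v, ∃ p, dPair C hα ξ U v = φ p := by
    intro v
    refine ⟨∑ i, b.repr v i • MvPolynomial.X i, ?_⟩
    conv_lhs => rw [← b.sum_repr v, map_sum]
    rw [map_sum]
    refine Finset.sum_congr rfl fun i _ => ?_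
    rw [LinearMap.map_smul, ← hφ]
    exact (φ.toLinearMap.map_smul _ _).symm
  refine ⟨φ, hφ, fun x hx => ?_⟩
  have hx' := adjoin_le_span_normalForm (m := mulPair α U) (w := wPair α U) (φ := φ)
    (S := genPair C hα ξ U) (fun g f => ⟨_, wPair_mulPair U g f⟩)
    (fun g i => by
      obtain ⟨p, hp⟩ := hd (g • b i)
      exact ⟨p, by rw [hφ, ← hp, wPair_dPair hC]⟩)
    (by
      rintro x (h | h | ⟨v, rfl⟩)
      · exact Or.inl h
      · exact Or.inr (Or.inl h)
      · obtain ⟨p, hp⟩ := hd v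
        exact Or.inr (Or.inr ⟨p, hp, fun f => ⟨_, dPair_mulPair hα ξ U v f⟩⟩)) hx
  clear hx
  induction hx' using Submodule.span_induction with
  | zero => exact hasSymbol_zero
  | add x y _ _ hx hy => exact hx.add hy
  | smul c x _ hx => exact hx.smul c
  | mem x hx =>
    obtain ⟨f, p, g, rfl⟩ := hx
    exact hasSymbol_mul_mul f p g

omit hC

/-- Exponentials are eigenfunctions of constant coefficient operators, with eigenvalue the value of
the polynomial at (l(b i)). Letting l vary recovers the polynomial. -/
theorem evalFun_exp {U : Opens T.Y} {ι : Type*} {b : ι → V}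
    {φ : MvPolynomial ι ℂ →ₐ[ℂ] FamPair T α U}
    (hφ : ∀ i, φ (MvPolynomial.X i) = dPair C hα ξ U (b i)) (U' : Set.Iic U)
    (s : T.OD (T.pre U'.1)) (c : ℂ) (l : V →L[ℂ] ℂ) {z₀ : V}
    (hs : ∀ᶠ z in 𝓝 z₀, ∀ hz, s.1 ⟨z, hz⟩ = c * Complex.exp (l z)) (p : MvPolynomial ι ℂ) :
    ∀ᶠ z in 𝓝 z₀, ∀ hz, evalFun U' s ⟨z, hz⟩ (φ p) =
      MvPolynomial.eval (fun i => l (b i)) p * (c * Complex.exp (l z)) := by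
  induction p using MvPolynomial.induction_on with
  | C a =>
    filter_upwards [hs] with z hz hz'
    rw [MvPolynomial.eval_C, ← hz hz', ← MvPolynomial.algebraMap_eq, AlgHom.commutes]
    rfl
  | add p q hp hq =>
    filter_upwards [hp, hq] with z hp hq hz
    rw [map_add, map_add, map_add, hp, hq, add_mul]
  | mul_X p i hp =>
    filter_upwards [hp.eventually_nhds] with z hz hz'
    rw [mul_comm p, map_mul φ, hφ, map_mul (MvPolynomial.eval _), MvPolynomial.eval_X]
    have h1 : evalFun U' s ⟨z, hz'⟩ (dPair C hα ξ U (b i) * φ p) =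
        dv (b i) ((φ p).1 U' s).1 ⟨z, hz'⟩ := rfl
    rw [h1, dv_eq_of_eventuallyEq (T.isOpen_regLift _) hz]
    have h2 := (((l.hasFDerivAt (x := z)).cexp.const_mul c).const_mul
      (MvPolynomial.eval (fun i => l (b i)) p)).fderiv
    rw [h2]
    simp only [smul_apply, smul_eq_mul]
    ring

include hC

/-- An operator on sections of `F` is determined by the corresponding operator on functions. -/
theorem snd_eq_zero {U : Opens T.Y} {x : FamPair T α U} (hx : x ∈ algPair C hα ξ U) (h : x.1 = 0) :
    x.2 = 0 := by
  classical
  have : Fintype T.W := Fintype.ofFinite _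
  let b := Module.finBasis ℂ V
  obtain ⟨φ, hφ, H⟩ := exists_hasSymbol hC hα ξ U b
  obtain ⟨q, h1, h2⟩ := H x hx
  -- At a free point the test function for g isolates the polynomial attached to g, and the choice
  -- of l prescribes the point a at which it is evaluated. An operator that is zero on functions
  -- therefore has zero symbol there.
  have hq : ∀ z₀, T.IsFree z₀ → z₀ ∈ T.lift (T.pre U) → ∀ g, q z₀ g = 0 := by
    intro z₀ hz₀ hU g
    refine MvPolynomial.funext fun a => ?_
    let l : V →L[ℂ] ℂ := LinearMap.toContinuousLinearMap (b.constr ℂ a)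
    have hl : (fun i => l (b i)) = a := by
      funext i
      exact b.constr_basis ℂ a i
    obtain ⟨U', hU', hzU', s, hs⟩ := hz₀.exists_test hU g l
    have hzr : z₀ ∈ T.regLift (T.pre U') := ⟨hzU', hz₀.mem_reg⟩
    have h3 := h1 ⟨U', hU'⟩ s ⟨z₀, hzr⟩
    simp only [LinearMap.comp_apply, AlgHom.toLinearMap_apply] at h3
    have h4 : ∀ g', evalFun ⟨U', hU'⟩ (T.wOp U' g' s) ⟨z₀, hzr⟩ (φ (q z₀ g')) =
        MvPolynomial.eval a (q z₀ g') * ((if g' = g then 1 else 0) * Complex.exp (l z₀)) := by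
      intro g'
      have := (evalFun_exp hα ξ hφ ⟨U', hU'⟩ (T.wOp U' g' s) (if g' = g then 1 else 0) l
        (hs.mono fun z hz hz' => by rw [hz hz' g']; split_ifs <;> simp) (q z₀ g')).self_of_nhds hzr
      rwa [hl] at this
    simp only [h4, ite_mul, one_mul, zero_mul, mul_ite, mul_zero, Finset.sum_ite_eq',
      Finset.mem_univ, if_true] at h3
    have h5 : evalFun ⟨U', hU'⟩ s ⟨z₀, hzr⟩ x = 0 := by
      change (x.1 ⟨U', hU'⟩ s).1 ⟨z₀, hzr⟩ = 0
      rw [h]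
      rfl
    rw [h5] at h3
    rw [map_zero]
    exact (mul_eq_zero.1 h3.symm).resolve_right (Complex.exp_ne_zero _)
  funext U'
  refine LinearMap.ext fun β => Subtype.ext (funext fun u => ?_)
  have hcont : Continuous ((x.2 U' β).1 u) := ((x.2 U' β).2 u).hol.continuous
  have hdense : Dense {z : T.regLift (T.pre U'.1) | T.IsFree z} :=
    -- Free points are dense, so the continuous function given by the second component vanishes
    -- everywhere.
    T.dense_isFree.preimage (T.isOpen_regLift (T.pre U'.1)).isOpenMap_subtype_val
  refine hcont.ext_on hdense continuous_const fun z hz => ?_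
  have h3 := h2 U' β u z
  have h4 : ∀ g, q z g = 0 := hq z hz (T.lift_mono (T.pre_mono U'.2) z.2.1)
  simp only [h4, LinearMap.map_zero, Finset.sum_const_zero] at h3
  exact h3

/-- Thus `algPair` is the graph of a map defined on the algebra generated by `genWD`; this is the
well-definedness of ρ. -/
theorem snd_eq_snd {U : Opens T.Y} {x y : FamPair T α U} (hx : x ∈ algPair C hα ξ U)
    (hy : y ∈ algPair C hα ξ U) (h : x.1 = y.1) : x.2 = y.2 := by
  have h1 := snd_eq_zero hC hα ξ ((algPair C hα ξ U).add_mem hx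
    ((algPair C hα ξ U).smul_mem hy (-1))) (by
      funext U'
      refine LinearMap.ext fun s => Subtype.ext (funext fun z => ?_)
      change (x.1 U' s).1 z + (-1) * (y.1 U' s).1 z = 0
      rw [h]
      ring)
  funext U'
  refine LinearMap.ext fun β => Subtype.ext (funext fun u => funext fun z => ?_)
  have h2 : (x.2 U' β).1 u z + (-1) * (y.2 U' β).1 u z = 0 :=
    congrFun (congrFun (congrArg Subtype.val (LinearMap.congr_fun (congrFun h1 U') β)) u) z
  linear_combination h2

end Faithful

end TorusAction

theorem AlgHom.exists_apply_eq_of_bijective {k A B B' : Type*} [CommSemiring k] [Semiring A]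
    [Semiring B] [Semiring B'] [Algebra k A] [Algebra k B] [Algebra k B'] (f : A →ₐ[k] B)
    (g : A →ₐ[k] B') (hf : Function.Injective f) (hf' : Function.Surjective f) :
    ∃ a : B →ₐ[k] B', ∀ x, a (f x) = g x :=
  ⟨g.comp (AlgEquiv.ofBijective f ⟨hf, hf'⟩).symm.toAlgHom, fun x =>
    congrArg g ((AlgEquiv.ofBijective f ⟨hf, hf'⟩).symm_apply_apply x)⟩

namespace TorusAction

variable {V : Type u} [NormedAddCommGroup V] [NormedSpace ℂ V] {T : TorusAction V}
  [FiniteDimensional ℂ V]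

/-! ### The Dunkl representation -/

section Representation

variable {α : AntiDual V}

theorem IsMerSection.of_local {U : Opens T.X} {s : T.regLift U → ℂ}
    (h : ∀ z₀ ∈ T.lift U, ∃ (U' : Opens T.X) (h : U' ≤ U), z₀ ∈ T.lift U' ∧
      T.IsMerSection α U' (TorusAction.restr (T.regLift_mono h) s)) : T.IsMerSection α U s where
  hol z hz := by
    obtain ⟨U', h', hz', hs⟩ := h z hz.1
    refine (hs.hol z ⟨hz', hz.2⟩).congr ?_
    filter_upwards [(T.isOpen_regLift U').mem_nhds ⟨hz', hz.2⟩] with y hy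
    rw [ext_apply_mem _ hy, ext_apply_mem _ (T.regLift_mono h' hy)]
    rfl
  mult z z' hz := by
    obtain ⟨U', h', hz', hs⟩ := h z z.2.1
    have h1 : (z' : V) ∈ T.lift U' := by
      change T.proj z' ∈ U'
      rw [T.proj_eq_iff.2 hz]
      exact hz'
    exact hs.mult ⟨z, hz', z.2.2⟩ ⟨z', h1, z'.2.2⟩ hz
  mer z₀ hz₀ := by
    obtain ⟨U', h', hz', hs⟩ := h z₀ hz₀
    obtain ⟨a, t, ha, ht, H⟩ := hs.mer z₀ hz'
    refine ⟨a, t, ha, ht, ?_⟩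
    filter_upwards [H, (T.isOpen_lift U').mem_nhds hz'] with z H hz hz2
    exact H ⟨hz, hz2.2⟩

theorem IsCompatF.apply_eq {U : Opens T.Y}
    {E : ∀ U' : Set.Iic U, Module.End ℂ (T.merF α (T.pre U'.1))} (hE : IsCompatF E)
    (U₁ U₂ : Set.Iic U) (h : U₂.1 ≤ U₁.1) (β : T.merF α (T.pre U₁.1)) (u : T.W)
    (z : T.regLift (T.pre U₂.1)) :
    (E U₁ β).1 u ⟨z, T.regLift_mono (T.pre_mono h) z.2⟩ =
      (E U₂ (T.resMerF α (T.pre_mono h) β)).1 u z :=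
  congrArg (fun β : T.merF α (T.pre U₂.1) => β.1 u z) (hE U₁ U₂ h β)

variable {C : T.Pairs → ℂ} (hC : T.IsInvariant C) (hα : T.HasTrivialStabilizer α)
  (ξ : T.FlatConnection)

variable (C) in
/-- Pairs of compatible families of operators which locally belong to `algPair`. -/
def locPair (U : Opens T.Y) : Subalgebra ℂ (FamPair T α U) where
  carrier := {x | (T.IsCompat x.1 ∧ IsCompatF x.2) ∧ ∀ y ∈ U, ∃ (U' : Opens T.Y) (h : U' ≤ U),
    y ∈ U' ∧ resPair h x ∈ algPair C hα ξ U'}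
  mul_mem' := by
    rintro D E ⟨⟨hD₁, hD₂⟩, hD'⟩ ⟨⟨hE₁, hE₂⟩, hE'⟩
    refine ⟨⟨fun U₁ U₂ h s => ?_, fun U₁ U₂ h s => ?_⟩, fun y hy => ?_⟩
    · change T.resOD (T.pre_mono h) (D.1 U₁ (E.1 U₁ s)) = D.1 U₂ (E.1 U₂ _)
      rw [hD₁ U₁ U₂ h, hE₁ U₁ U₂ h]
    · change T.resMerF α (T.pre_mono h) (D.2 U₁ (E.2 U₁ s)) = D.2 U₂ (E.2 U₂ _)
      rw [hD₂ U₁ U₂ h, hE₂ U₁ U₂ h]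
    · obtain ⟨U₁, h₁, hy₁, H₁⟩ := hD' y hy
      obtain ⟨U₂, h₂, hy₂, H₂⟩ := hE' y hy
      refine ⟨U₁ ⊓ U₂, inf_le_left.trans h₁, ⟨hy₁, hy₂⟩, ?_⟩
      rw [map_mul]
      exact mul_mem (resPair_mem C hα ξ inf_le_left H₁) (resPair_mem C hα ξ inf_le_right H₂)
  add_mem' := by
    rintro D E ⟨⟨hD₁, hD₂⟩, hD'⟩ ⟨⟨hE₁, hE₂⟩, hE'⟩
    refine ⟨⟨fun U₁ U₂ h s => ?_, fun U₁ U₂ h s => ?_⟩, fun y hy => ?_⟩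
    · change T.resOD (T.pre_mono h) (D.1 U₁ s) + T.resOD (T.pre_mono h) (E.1 U₁ s) =
        D.1 U₂ _ + E.1 U₂ _
      rw [hD₁ U₁ U₂ h, hE₁ U₁ U₂ h]
    · change T.resMerF α (T.pre_mono h) (D.2 U₁ s) + T.resMerF α (T.pre_mono h) (E.2 U₁ s) =
        D.2 U₂ _ + E.2 U₂ _
      rw [hD₂ U₁ U₂ h, hE₂ U₁ U₂ h]
    · obtain ⟨U₁, h₁, hy₁, H₁⟩ := hD' y hy
      obtain ⟨U₂, h₂, hy₂, H₂⟩ := hE' y hy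
      refine ⟨U₁ ⊓ U₂, inf_le_left.trans h₁, ⟨hy₁, hy₂⟩, ?_⟩
      rw [map_add]
      exact add_mem (resPair_mem C hα ξ inf_le_left H₁) (resPair_mem C hα ξ inf_le_right H₂)
  algebraMap_mem' c :=
    ⟨⟨fun _ _ _ _ => rfl, fun _ _ _ _ => rfl⟩, fun y hy => ⟨U, le_rfl, hy, by
      rw [AlgHom.commutes]; exact Subalgebra.algebraMap_mem _ c⟩⟩

theorem mem_locPair {U : Opens T.Y} {x : FamPair T α U} (hx : x ∈ algPair C hα ξ U)
    (h : T.IsCompat x.1) : x ∈ locPair C hα ξ U :=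
  ⟨⟨h, isCompatF_of_mem C hα ξ hx⟩, fun _ hy => ⟨U, le_rfl, hy, resPair_mem C hα ξ le_rfl hx⟩⟩

theorem resPair_mem_locPair {U U' : Opens T.Y} (h : U' ≤ U) {x : FamPair T α U}
    (hx : x ∈ locPair C hα ξ U) : resPair h x ∈ locPair C hα ξ U' :=
  ⟨⟨fun U₁ U₂ h' s => hx.1.1 ⟨U₁.1, U₁.2.trans h⟩ ⟨U₂.1, U₂.2.trans h⟩ h' s,
    fun U₁ U₂ h' s => hx.1.2 ⟨U₁.1, U₁.2.trans h⟩ ⟨U₂.1, U₂.2.trans h⟩ h' s⟩, fun y hy => by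
    obtain ⟨U₁, h₁, hy₁, H₁⟩ := hx.2 y (h hy)
    exact ⟨U₁ ⊓ U', inf_le_right, ⟨hy₁, hy⟩, resPair_mem C hα ξ inf_le_left H₁⟩⟩

variable (C) in
/-- The operator on functions underlying a pair. -/
def fstWD (U : Opens T.Y) : locPair C hα ξ U →ₐ[ℂ] T.WD U :=
  ((AlgHom.fst ℂ _ _).comp (locPair C hα ξ U).val).codRestrict (T.WD U) fun x =>
    ⟨x.2.1.1, fun y hy => by
      obtain ⟨U', h, hy', H⟩ := x.2.2 y hy
      exact ⟨U', h, hy', fst_mem_adjoin C hα ξ H⟩⟩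

include hC

/-- Near each point both pairs belong to `algPair`, where the first component determines the second;
compatibility with restriction carries the equality back to U. -/
theorem fstWD_injective (U : Opens T.Y) : Function.Injective (fstWD C hα ξ U) := by
  rintro ⟨x, hx⟩ ⟨x', hx'⟩ h0
  have h1 : x.1 = x'.1 := congrArg Subtype.val h0
  refine Subtype.ext (Prod.ext h1 (funext fun U' => ?_))
  ext β u z
  obtain ⟨U₁, h, hz, H⟩ := hx.2 _ (U'.2 z.2.1)
  obtain ⟨U₂, h', hz', H'⟩ := hx'.2 _ (U'.2 z.2.1)
  have k₁ : U'.1 ⊓ (U₁ ⊓ U₂) ≤ U₁ := inf_le_right.trans inf_le_left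
  have k₂ : U'.1 ⊓ (U₁ ⊓ U₂) ≤ U₂ := inf_le_right.trans inf_le_right
  have h2 := snd_eq_snd hC hα ξ (resPair_mem C hα ξ k₁ H) (resPair_mem C hα ξ k₂ H')
    (congrArg (T.resFam (inf_le_left.trans U'.2 : U'.1 ⊓ (U₁ ⊓ U₂) ≤ U)) h1)
  let U₃ : Set.Iic U := ⟨U'.1 ⊓ (U₁ ⊓ U₂), Set.mem_Iic.2 (inf_le_left.trans U'.2)⟩
  have h3 : x.2 U₃ = x'.2 U₃ := congrFun h2 (⟨U₃.1, le_refl U₃.1⟩ : Set.Iic U₃.1)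
  have h4 := hx.1.2.apply_eq U' U₃ inf_le_left β u ⟨z, ⟨z.2.1, hz, hz'⟩, z.2.2⟩
  rw [h3] at h4
  exact h4.trans (hx'.1.2.apply_eq U' U₃ inf_le_left β u ⟨z, ⟨z.2.1, hz, hz'⟩, z.2.2⟩).symm

/-- Local lifts exist by construction of `algPair`, agree on overlaps because the second component
is determined by the first, and therefore glue. -/
theorem fstWD_surjective (U : Opens T.Y) : Function.Surjective (fstWD C hα ξ U) := by
  rintro ⟨D, hD⟩
  choose N hN hyN H using hD.2
  choose x hx hxD using fun y hy => exists_mem_algPair C hα ξ (H y hy)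
  have hxc : ∀ y hy, IsCompatF (x y hy).2 := fun y hy => isCompatF_of_mem C hα ξ (hx y hy)
  have key : ∀ (y₁ : T.Y) (h₁ : y₁ ∈ U) (y₂ : T.Y) (h₂ : y₂ ∈ U) (U' : Opens T.Y)
      (k₁ : U' ≤ N y₁ h₁) (k₂ : U' ≤ N y₂ h₂),
      (x y₁ h₁).2 ⟨U', k₁⟩ = (x y₂ h₂).2 ⟨U', k₂⟩ := by
    intro y₁ h₁ y₂ h₂ U' k₁ k₂
    have h3 := snd_eq_snd hC hα ξ (resPair_mem C hα ξ k₁ (hx y₁ h₁))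
      (resPair_mem C hα ξ k₂ (hx y₂ h₂)) (by
        change T.resFam k₁ (x y₁ h₁).1 = T.resFam k₂ (x y₂ h₂).1
        rw [hxD, hxD]
        rfl)
    exact congrFun h3 (⟨U', le_refl U'⟩ : Set.Iic U')
  -- The value at z is computed with the lift chosen around the image of z in X / W; `hE` shows that
  -- any other lift defined near z gives the same value.
  let E : ∀ (U' : Set.Iic U), T.merF α (T.pre U'.1) → T.W → T.regLift (T.pre U'.1) → ℂ :=
    fun U' β u z => ((x _ (U'.2 z.2.1)).2 ⟨U'.1 ⊓ N _ (U'.2 z.2.1), Set.mem_Iic.2 inf_le_right⟩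
      (T.resMerF α (T.pre_mono inf_le_left) β)).1 u ⟨z, ⟨z.2.1, hyN _ (U'.2 z.2.1)⟩, z.2.2⟩
  have hE : ∀ (U' : Set.Iic U) (β : T.merF α (T.pre U'.1)) (u : T.W) (z : T.regLift (T.pre U'.1))
      (y : T.Y) (hy : y ∈ U) (U'' : Opens T.Y) (k : U'' ≤ U'.1) (k' : U'' ≤ N y hy)
      (hz : (z : V) ∈ T.regLift (T.pre U'')), E U' β u z =
        ((x y hy).2 ⟨U'', k'⟩ (T.resMerF α (T.pre_mono k) β)).1 u ⟨z, hz⟩ := by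
    intro U' β u z y hy U'' k k' hz
    have hzU : T.toY (T.proj z) ∈ U := U'.2 z.2.1
    let U₃ : Opens T.Y := U'' ⊓ N _ hzU
    have hz₃ : (z : V) ∈ T.regLift (T.pre U₃) := ⟨⟨hz.1, hyN _ hzU⟩, hz.2⟩
    have e1 := (hxc _ hzU).apply_eq ⟨U'.1 ⊓ N _ hzU, Set.mem_Iic.2 inf_le_right⟩ ⟨U₃, Set.mem_Iic.2 inf_le_right⟩
      (inf_le_inf_right _ k) (T.resMerF α (T.pre_mono inf_le_left) β) u ⟨z, hz₃⟩
    have e2 := (hxc y hy).apply_eq ⟨U'', k'⟩ ⟨U₃, Set.mem_Iic.2 (inf_le_left.trans k')⟩ inf_le_left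
      (T.resMerF α (T.pre_mono k) β) u ⟨z, hz₃⟩
    rw [← key _ hzU y hy U₃ inf_le_right (inf_le_left.trans k')] at e2
    exact e1.trans e2.symm
  let F : ∀ U' : Set.Iic U, Module.End ℂ (T.merF α (T.pre U'.1)) := fun U' =>
    { toFun := fun β => ⟨E U' β, fun u => by
        refine IsMerSection.of_local fun z₀ hz₀ => ?_
        have hzU : T.toY (T.proj z₀) ∈ U := U'.2 hz₀
        let U₃ : Opens T.Y := U'.1 ⊓ N _ hzU
        refine ⟨T.pre U₃, T.pre_mono inf_le_left, ⟨hz₀, hyN _ hzU⟩, ?_⟩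
        have e : restr (T.regLift_mono (T.pre_mono inf_le_left)) (E U' β u) =
            ((x _ hzU).2 ⟨U₃, Set.mem_Iic.2 inf_le_right⟩ (T.resMerF α (T.pre_mono inf_le_left) β)).1 u := by
          funext z
          exact hE U' β u _ _ hzU U₃ inf_le_left inf_le_right z.2
        rw [e]
        exact Subtype.prop ((x _ hzU).2 ⟨U₃, Set.mem_Iic.2 inf_le_right⟩ _) u⟩
      map_add' := fun β β' => by
        ext u z
        exact congrArg (fun γ : T.merF α (T.pre (U'.1 ⊓ N _ (U'.2 z.2.1))) => γ.1 u ⟨z, ⟨z.2.1, hyN _ (U'.2 z.2.1)⟩, z.2.2⟩)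
          (map_add ((x _ (U'.2 z.2.1)).2 ⟨U'.1 ⊓ N _ (U'.2 z.2.1), Set.mem_Iic.2 inf_le_right⟩)
            (T.resMerF α (T.pre_mono inf_le_left) β) (T.resMerF α (T.pre_mono inf_le_left) β'))
      map_smul' := fun c β => by
        ext u z
        exact congrArg (fun γ : T.merF α (T.pre (U'.1 ⊓ N _ (U'.2 z.2.1))) => γ.1 u ⟨z, ⟨z.2.1, hyN _ (U'.2 z.2.1)⟩, z.2.2⟩)
          (map_smul ((x _ (U'.2 z.2.1)).2 ⟨U'.1 ⊓ N _ (U'.2 z.2.1), Set.mem_Iic.2 inf_le_right⟩) c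
            (T.resMerF α (T.pre_mono inf_le_left) β)) }
  refine ⟨⟨(D, F), ⟨hD.1, fun U₁ U₂ h β => ?_⟩, fun y hy => ⟨N y hy, hN y hy, hyN y hy, ?_⟩⟩, rfl⟩
  · ext u z
    have hzU : T.toY (T.proj z) ∈ U := U₂.2 z.2.1
    exact hE U₁ β u ⟨z, T.regLift_mono (T.pre_mono h) z.2⟩ _ hzU (U₂.1 ⊓ N _ hzU)
      (inf_le_left.trans h) inf_le_right ⟨⟨z.2.1, hyN _ hzU⟩, z.2.2⟩
  · have e : resPair (hN y hy) (D, F) = x y hy := by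
      refine Prod.ext (hxD y hy).symm (funext fun U' => ?_)
      ext β u z
      exact hE ⟨U'.1, Set.mem_Iic.2 (U'.2.trans (hN y hy))⟩ β u z y hy U'.1 le_rfl U'.2 z.2
    rw [e]
    exact hx y hy

omit hC

variable (C) in
/-- The operator on sections of `F` underlying a pair. -/
def sndEnd (U : Opens T.Y) : locPair C hα ξ U →ₐ[ℂ] Module.End ℂ (T.merF α (T.pre U)) where
  toFun x := x.1.2 ⟨U, le_refl U⟩
  map_one' := rfl
  map_mul' _ _ := rfl
  map_zero' := rfl
  map_add' _ _ := rfl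
  commutes' _ := rfl

include hC

/-- The first projection is an isomorphism onto W ⋉ D, so ρ is the second projection composed with
its inverse. -/
theorem exists_dunklAct (U : Opens T.Y) : ∃ a : T.WD U →ₐ[ℂ] Module.End ℂ (T.merF α (T.pre U)),
    ∀ x, a (fstWD C hα ξ U x) = sndEnd C hα ξ U x :=
  AlgHom.exists_apply_eq_of_bijective _ _ (fstWD_injective hC hα ξ U) (fstWD_surjective hC hα ξ U)

/-- The action of the algebra of sections over `U` in the Dunkl representation. -/
noncomputable def dunklAct (U : Opens T.Y) : T.WD U →ₐ[ℂ] Module.End ℂ (T.merF α (T.pre U)) :=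
  (exists_dunklAct hC hα ξ U).choose

theorem dunklAct_fstWD (U : Opens T.Y) (x : locPair C hα ξ U) :
    dunklAct hC hα ξ U (fstWD C hα ξ U x) = sndEnd C hα ξ U x :=
  (exists_dunklAct hC hα ξ U).choose_spec x

theorem resMerF_dunklAct {U U' : Opens T.Y} (h : U' ≤ U) (D : T.WD U) (s : T.merF α (T.pre U)) :
    T.resMerF α (T.pre_mono h) (dunklAct hC hα ξ U D s) =
      dunklAct hC hα ξ U' (T.resWD h D) (T.resMerF α (T.pre_mono h) s) := by
  obtain ⟨x, rfl⟩ := fstWD_surjective hC hα ξ U D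
  have h1 := dunklAct_fstWD hC hα ξ U x
  have h2 : dunklAct hC hα ξ U' (T.resWD h (fstWD C hα ξ U x)) =
      sndEnd C hα ξ U' ⟨resPair h x.1, resPair_mem_locPair hα ξ h x.2⟩ :=
    dunklAct_fstWD hC hα ξ U' ⟨resPair h x.1, resPair_mem_locPair hα ξ h x.2⟩
  rw [h1, h2]
  exact x.2.1.2 ⟨U, le_refl U⟩ ⟨U', h⟩ h s

/-- The Dunkl representation. -/
noncomputable def dunklRep : T.MerRep α where
  act := dunklAct hC hα ξ
  act_res := resMerF_dunklAct hC hα ξ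

theorem dunklRep_act (U : Opens T.Y) (x : locPair C hα ξ U) :
    (dunklRep hC hα ξ).act U (fstWD C hα ξ U x) = sndEnd C hα ξ U x :=
  dunklAct_fstWD hC hα ξ U x

theorem isDunklRep_dunklRep : T.IsDunklRep C α ξ (dunklRep hC hα ξ) where
  act_fun U f β u z := by
    have h : mulPair α U f ∈ locPair C hα ξ U := mem_locPair hα ξ
      (Algebra.subset_adjoin (Or.inl ⟨f, rfl⟩)) (T.isCompat_mulFam f)
    rw [show T.funWD f = fstWD C hα ξ U ⟨_, h⟩ from rfl, dunklRep_act]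
    rfl
  act_grp U g β u z := by
    have h : wPair α U g ∈ locPair C hα ξ U := mem_locPair hα ξ
      (Algebra.subset_adjoin (Or.inr (Or.inl ⟨g, rfl⟩))) (T.isCompat_wFam U g)
    rw [show T.grpWD U g = fstWD C hα ξ U ⟨_, h⟩ from rfl, dunklRep_act]
    rfl
  act_vec U v β u z := by
    have h : dPair C hα ξ U v ∈ locPair C hα ξ U := mem_locPair hα ξ
      (Algebra.subset_adjoin (Or.inr (Or.inr ⟨v, rfl⟩))) (T.isCompat_dFam U v)
    rw [show T.vecWD U v = fstWD C hα ξ U ⟨_, h⟩ from rfl, dunklRep_act]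
    rfl

end Representation

theorem adjoin_genWD_le (U : Opens T.Y) : Algebra.adjoin ℂ (T.genWD U) ≤ T.WD U := by
  refine Algebra.adjoin_le ?_
  rintro _ (⟨f, rfl⟩ | ⟨w, rfl⟩ | ⟨v, rfl⟩)
  · exact (T.funWD f).2
  · exact (T.grpWD U w).2
  · exact (T.vecWD U v).2

theorem MerRep.act_eq_of_mem_adjoin {α : AntiDual V} {ρ ρ' : T.MerRep α} (U : Opens T.Y)
    (hfun : ∀ f : T.OD (T.pre U), ρ.act U (T.funWD f) = ρ'.act U (T.funWD f))
    (hgrp : ∀ g, ρ.act U (T.grpWD U g) = ρ'.act U (T.grpWD U g))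
    (hvec : ∀ v, ρ.act U (T.vecWD U v) = ρ'.act U (T.vecWD U v)) {D : T.Fam U}
    (hD : D ∈ Algebra.adjoin ℂ (T.genWD U)) :
    ρ.act U ⟨D, adjoin_genWD_le U hD⟩ = ρ'.act U ⟨D, adjoin_genWD_le U hD⟩ := by
  induction hD using Algebra.adjoin_induction with
  | mem D hD =>
    obtain ⟨f, rfl⟩ | ⟨w, rfl⟩ | ⟨v, rfl⟩ := hD
    · exact hfun f
    · exact hgrp w
    · exact hvec v
  | algebraMap c =>
    exact ((ρ.act U).commutes c).trans ((ρ'.act U).commutes c).symm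
  | add D E hD hE h1 h2 =>
    have e : ∀ r : T.MerRep α, r.act U ⟨D + E, adjoin_genWD_le U (add_mem hD hE)⟩ =
        r.act U ⟨D, adjoin_genWD_le U hD⟩ + r.act U ⟨E, adjoin_genWD_le U hE⟩ := fun r =>
      map_add (r.act U) ⟨D, adjoin_genWD_le U hD⟩ ⟨E, adjoin_genWD_le U hE⟩
    rw [e, e, h1, h2]
  | mul D E hD hE h1 h2 =>
    have e : ∀ r : T.MerRep α, r.act U ⟨D * E, adjoin_genWD_le U (mul_mem hD hE)⟩ =
        r.act U ⟨D, adjoin_genWD_le U hD⟩ * r.act U ⟨E, adjoin_genWD_le U hE⟩ := fun r =>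
      map_mul (r.act U) ⟨D, adjoin_genWD_le U hD⟩ ⟨E, adjoin_genWD_le U hE⟩
    rw [e, e, h1, h2]

/-- Every operator lies locally in the generated algebra, and a section is determined by its
restrictions, so the local equalities suffice. -/
theorem MerRep.ext_of_adjoin {α : AntiDual V} {ρ ρ' : T.MerRep α}
    (h : ∀ (U : Opens T.Y) (D : T.WD U), D.1 ∈ Algebra.adjoin ℂ (T.genWD U) →
      ρ.act U D = ρ'.act U D) : ρ = ρ' := by
  have hact : ρ.act = ρ'.act := by
    funext U
    refine AlgHom.ext fun D => LinearMap.ext fun β => Subtype.ext (funext fun u => funext fun z => ?_)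
    obtain ⟨U', hU', hz, H⟩ := D.2.2 _ z.2.1
    have e1 := ρ.act_res hU' D β
    rw [h U' (T.resWD hU' D) H, ← ρ'.act_res hU' D β] at e1
    exact congrFun (congrFun (congrArg Subtype.val e1) u) ⟨z, ⟨hz, z.2.2⟩⟩
  cases ρ
  cases ρ'
  cases hact
  rfl

theorem IsDunklRep.eq {C : T.Pairs → ℂ} {α : AntiDual V} {ξ : T.FlatConnection}
    {ρ ρ' : T.MerRep α} (h : T.IsDunklRep C α ξ ρ) (h' : T.IsDunklRep C α ξ ρ') : ρ = ρ' := by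
  refine MerRep.ext_of_adjoin fun U D hD => MerRep.act_eq_of_mem_adjoin U
    (fun f => ?_) (fun g => ?_) (fun v => ?_) hD
  · refine LinearMap.ext fun β => Subtype.ext (funext fun u => funext fun z => ?_)
    exact (h.act_fun U f β u z).trans (h'.act_fun U f β u z).symm
  · refine LinearMap.ext fun β => Subtype.ext (funext fun u => funext fun z => ?_)
    exact (h.act_grp U g β u z).trans (h'.act_grp U g β u z).symm
  · refine LinearMap.ext fun β => Subtype.ext (funext fun u => funext fun z => ?_)
    exact (h.act_vec U v β u z).trans (h'.act_vec U v β u z).symm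

end TorusAction

theorem Subalgebra.map_add_sum_eq {k A B ι : Type*} [CommSemiring k] [Semiring A] [Algebra k A]
    [AddCommMonoid B] (S : Subalgebra k A) (ev : S →+ B) (I : Finset ι) (x y : S) (f : ι → S)
    (h : (x : A) + ∑ i ∈ I, (f i : A) = y) : ev x + ∑ i ∈ I, ev (f i) = ev y := by
  have e : x + ∑ i ∈ I, f i = y := Subtype.ext (by
    rw [Subalgebra.coe_add, AddSubmonoidClass.coe_finsetSum, h])
  rw [← e, map_add, map_sum]

namespace TorusAction

variable {V : Type u} [NormedAddCommGroup V] [NormedSpace ℂ V] {T : TorusAction V}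
  [FiniteDimensional ℂ V]

/-! ### Holomorphic sections are preserved by the Cherednik algebra -/

theorem dense_regLift (U : Opens T.X) : Dense {z : T.lift U | T.proj z ∈ T.reg} :=
  T.dense_reg.preimage (T.isOpen_lift U).isOpenMap_subtype_val

/-- The preimage of X_reg is dense and the sections are continuous. -/
theorem holToMer_injective (α : AntiDual V) (U : Opens T.X) :
    Function.Injective (T.holToMer α U) := by
  intro s t h
  refine Subtype.ext (funext fun u => ?_)
  refine (s.2 u).hol.continuous.ext_on (dense_regLift U) (t.2 u).hol.continuous fun z hz => ?_
  exact congrFun (congrFun (congrArg Subtype.val h) u) ⟨z, z.2, hz⟩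

/-- A section with poles on the reflection hypertori which locally extends to a holomorphic function
is a holomorphic section. -/
theorem IsMerSection.exists_isHolSection {α : AntiDual V} {U : Opens T.X} {s : T.regLift U → ℂ}
    (hs : T.IsMerSection α U s) (h : ∀ z₀ ∈ T.lift U, ∃ q : V → ℂ, AnalyticAt ℂ q z₀ ∧
      ∀ᶠ z in 𝓝 z₀, ∀ hz : z ∈ T.regLift U, s ⟨z, hz⟩ = q z) :
    ∃ t : T.lift U → ℂ, T.IsHolSection α U t ∧ TorusAction.restr (T.regLift_subset U) t = s := by
  have hZ : Dense (T.proj ⁻¹' T.reg)ᶜᶜ := by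
    rw [compl_compl]
    exact T.dense_reg
  obtain ⟨Q, hQ, hQ1, hQ2⟩ := exists_analytic_extension (Ω := T.lift U) hZ (G := ext s) (by
    intro z hz
    obtain ⟨q, hq, he⟩ := h z hz
    refine ⟨q, hq, ?_⟩
    filter_upwards [he, (T.isOpen_lift U).mem_nhds hz] with y hy hyU hy2
    have hyr : y ∈ T.regLift U := ⟨hyU, by simpa using hy2⟩
    rw [ext_apply_mem s hyr, hy hyr])
  have hQs : ∀ z (hz : z ∈ T.regLift U), Q z = s ⟨z, hz⟩ := fun z hz => by
    rw [hQ1 z hz.1 (not_not.2 hz.2), ext_apply_mem s hz]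
  refine ⟨fun z => Q z, ⟨isHol_of (T.isOpen_lift U) hQ fun _ => rfl, fun z z' hΓ => ?_⟩,
    funext fun z => hQs z z.2⟩
  have hc : Tendsto (fun y => y - (z' - z : V)) (𝓝 (z' : V)) (𝓝 z) := by
    have : Continuous fun y : V => y - (z' - z : V) := by fun_prop
    simpa using this.tendsto (z' : V)
  -- The multiplier relation holds on the regular part. Its right-hand side is a continuous local
  -- extension of s near z', so it agrees with Q at z' itself.
  have h1 := hQ2 z' z'.2 (fun y => TorusAction.mult α (z' - z : V) * Q (y - (z' - z : V)))
    (continuousAt_const.mul (ContinuousAt.comp (f := fun y : V => y - (z' - z : V)) (g := Q)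
      (by simpa using (hQ z z.2).continuousAt) (by fun_prop))) (by
    filter_upwards [hc ((T.isOpen_lift U).mem_nhds z.2), (T.isOpen_lift U).mem_nhds z'.2] with
      y hy hy' hyr
    have hyr : T.proj y ∈ T.reg := not_not.1 hyr
    have e : T.proj (y - (z' - z : V)) = T.proj y := T.proj_eq_iff.2 (by simpa using neg_mem hΓ)
    have hy1 : y ∈ T.regLift U := ⟨hy', hyr⟩
    have hy2 : y - (z' - z : V) ∈ T.regLift U := ⟨hy, by rwa [e]⟩
    rw [ext_apply_mem s hy1, hQs _ hy2]
    have := hs.mult ⟨_, hy2⟩ ⟨y, hy1⟩ (by simpa using hΓ)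
    simpa using this)
  simpa using h1

theorem exists_holToMer_eq {α : AntiDual V} {U : Opens T.X} (β : T.merF α U)
    (h : ∀ (u : T.W), ∀ z₀ ∈ T.lift U, ∃ q : V → ℂ, AnalyticAt ℂ q z₀ ∧
      ∀ᶠ z in 𝓝 z₀, ∀ hz : z ∈ T.regLift U, β.1 u ⟨z, hz⟩ = q z) :
    ∃ s, T.holToMer α U s = β := by
  choose t ht hts using fun u => (β.2 u).exists_isHolSection (h u)
  exact ⟨⟨t, ht⟩, Subtype.ext (funext hts)⟩

/-- The residues of the Dunkl form and of a logarithmic form cancel. -/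
theorem exists_local_dunklForm_mul_sub {α : AntiDual V} (hα : T.HasTrivialStabilizer α) (p : T.Pairs)
    {U : Opens T.Y} {φ : V → V →L[ℂ] ℂ} (hφ : T.IsLogForm (T.pre U) p.H φ) {b : T.lift (T.pre U) → ℂ}
    (hb : T.IsHolSection (-α) (T.pre U) b) (v : V) {z₀ : V} (hz₀ : z₀ ∈ T.lift (T.pre U)) :
    ∃ q : V → ℂ, AnalyticAt ℂ q z₀ ∧ ∀ᶠ z in 𝓝 z₀, T.proj z ∈ T.reg →
      T.dunklForm α p z v * ext b z - φ z v * ext b ((T.refl p)⁻¹ • z) = q z := by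
  obtain ⟨k, hk, h1, h2⟩ := exists_local_dunklForm (hα.refl_notMem p) z₀
  have hb1 : AnalyticAt ℂ (ext b) z₀ := hb.hol z₀ hz₀
  have hb2 : AnalyticAt ℂ (fun z => ext b ((T.refl p)⁻¹ • z)) z₀ :=
    (hb.hol _ (T.smul_mem_lift _ hz₀)).fun_comp (T.analytic_smulV _ z₀)
  have hev : ∀ {f : V → V →L[ℂ] ℂ}, AnalyticAt ℂ f z₀ → AnalyticAt ℂ (fun z => f z v) z₀ :=
    fun hf => ((ContinuousLinearMap.apply ℂ ℂ v).analyticAt _).fun_comp hf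
  by_cases hH : T.proj z₀ ∈ p.H.1
  · obtain ⟨z₁, h⟩ := exists_isEquation_linForm p.H
    obtain ⟨η, hη, hη'⟩ := (hφ.log z₀ hz₀ hH).exists_linear h hH
    set l := linForm p.H
    -- On the hyperplane g⁻¹z − z is the same lattice vector as at z₀. The multiplier of b then
    -- gives b(g⁻¹z) = χ_α(z − g⁻¹z) b(z), and this factor is the residue prescribed for the Dunkl
    -- form.
    have hvan : ∀ᶠ z in 𝓝 z₀, l z = l z₀ → k z * ext b z - ext b ((T.refl p)⁻¹ • z) = 0 := by
      filter_upwards [(T.isOpen_lift _).mem_nhds hz₀] with z hz hl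
      have e1 : (T.refl p)⁻¹ • (z - z₀) = z - z₀ :=
        inv_smul_eq_of_linForm (refl_mem_stab p) (by rw [map_sub]; exact sub_eq_zero.2 hl)
      have e2 : (T.refl p)⁻¹ • z - z = (T.refl p)⁻¹ • z₀ - z₀ := by
        rw [smul_sub] at e1
        rw [sub_eq_sub_iff_sub_eq_sub]
        exact e1
      have hΓ : (T.refl p)⁻¹ • z - z ∈ T.Γ := by
        rw [e2]
        exact T.smul_sub_mem_of_mem_stab (inv_mem (refl_mem_stab p)) hH
      have e3 := hb.mult ⟨z, hz⟩ ⟨(T.refl p)⁻¹ • z, T.smul_mem_lift _ hz⟩ hΓ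
      rw [ext_apply_mem b hz, ext_apply_mem b (T.smul_mem_lift _ hz), h2 hH z hl, e3,
        mult_neg_left, ← mult_neg_right, neg_sub, sub_self]
    obtain ⟨q, hq, hq'⟩ := ((hk.fun_mul hb1).fun_sub hb2).exists_eq_linear_mul h.ne hvan
    -- The two poles combine to l(v)(k b − b∘g⁻¹)/(l − l z₀), whose numerator is divisible by the
    -- denominator with quotient l(v) q; the regular part η of φ gives the other term.
    refine ⟨fun z => l v * q z - η z v * ext b ((T.refl p)⁻¹ • z),
      (analyticAt_const.fun_mul hq).fun_sub ((hev hη).fun_mul hb2), ?_⟩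
    filter_upwards [h1, hη', hq', eventually_mem_iff_localEq z₀] with z h1 h2 h3 h4 hz
    have h5 : localEq z₀ p.H z = l z - l z₀ := if_pos hH
    have h6 : l z - l z₀ ≠ 0 := by
      rw [← h5]
      exact fun h => hz p.H ((h4 p.H).2 h)
    rw [h1 (hz p.H), h2 (hz p.H), h5, add_apply, smul_apply, smul_apply, smul_eq_mul, smul_eq_mul]
    field_simp
    linear_combination l v * h3
  · refine ⟨fun z => k z * linForm p.H v * ext b z - φ z v * ext b ((T.refl p)⁻¹ • z),
      ((hk.fun_mul analyticAt_const).fun_mul hb1).fun_sub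
        ((hev (hφ.hol z₀ ⟨hz₀, hH⟩)).fun_mul hb2), ?_⟩
    filter_upwards [h1] with z h1 hz
    have h5 : localEq z₀ p.H z = 1 := if_neg hH
    rw [h1 (hz p.H), h5, div_one, smul_apply, smul_eq_mul]

section Cherednik

variable {C : T.Pairs → ℂ} {α : AntiDual V} (hα : T.HasTrivialStabilizer α) {ξ : T.FlatConnection}
  {ρ : T.MerRep α} (hρ : T.IsDunklRep C α ξ ρ)

include hρ

theorem IsDunklRep.holToMer_smul {U : Opens T.Y} (f : T.O (T.pre U)) (s : T.holF α (T.pre U)) :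
    T.holToMer α (T.pre U) ⟨f • s.1, (T.holF α (T.pre U)).smul_mem f s.2⟩ =
      ρ.act U (T.funWD (T.toOD f)) (T.holToMer α (T.pre U) s) := by
  refine Subtype.ext (funext fun u => funext fun z => ?_)
  exact (hρ.act_fun U (T.toOD f) (T.holToMer α (T.pre U) s) u z).symm

theorem IsDunklRep.exists_holToMer_grp (U : Opens T.Y) (g : T.W) (s : T.holF α (T.pre U)) :
    ∃ s', T.holToMer α (T.pre U) s' = ρ.act U (T.grpWD U g) (T.holToMer α (T.pre U) s) := by
  refine exists_holToMer_eq _ fun u z₀ hz₀ => ⟨fun z => ext (s.1 (g⁻¹ * u)) (g⁻¹ • z),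
    ((s.2 _).hol _ (T.smul_mem_lift g⁻¹ hz₀)).fun_comp (T.analytic_smulV _ z₀),
    Eventually.of_forall fun z hz => ?_⟩
  rw [hρ.act_grp]
  exact (ext_apply_mem _ (T.smul_mem_lift g⁻¹ hz.1)).symm

theorem IsDunklRep.act_mul_grp {U : Opens T.Y} (f : T.OD (T.pre U)) (g : T.W) (c : ℂ)
    (β : T.merF α (T.pre U)) (u : T.W) (z : T.regLift (T.pre U)) :
    (ρ.act U (c • (T.funWD f * T.grpWD U g)) β).1 u z =
      c * (f.1 z * β.1 (g⁻¹ * u) ⟨g⁻¹ • (z : V), T.smul_mem_regLift g⁻¹ z.2⟩) := by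
  have e : ρ.act U (c • (T.funWD f * T.grpWD U g)) =
      c • (ρ.act U (T.funWD f) * ρ.act U (T.grpWD U g)) := by
    rw [map_smul, map_mul]
  rw [e, ← hρ.act_grp, ← hρ.act_fun]
  rfl

/-- For each (H, j), the Dunkl term of ρ(∂_v) and the reflection term of D_{v,φ} involve the same
component of β, once at z and once at g⁻¹z. Grouping them exhibits the cancellation of poles. -/
theorem IsDunklRep.act_dunklOpdam {U : Opens T.Y} {φ : T.Hypertorus → V → V →L[ℂ] ℂ}
    (hφ : ∀ H, T.IsLogForm (T.pre U) H (φ H)) (v : V) (hD : T.dunklOpdam C hφ v ∈ T.WD U)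
    (β : T.merF α (T.pre U)) (u : T.W) (z : T.regLift (T.pre U)) :
    (ρ.act U ⟨T.dunklOpdam C hφ v, hD⟩ β).1 u z =
      dv v (β.1 u) z - ξ.transport u z v * β.1 u z +
        ∑ p : T.Pairs, C p * (T.dunklForm (T.dualAct ((T.refl p)⁻¹ * u) α) p z v *
          β.1 ((T.refl p)⁻¹ * u) z - φ p.H z v * β.1 ((T.refl p)⁻¹ * u)
            ⟨(T.refl p)⁻¹ • (z : V), T.smul_mem_regLift (T.refl p)⁻¹ z.2⟩) := by
  let ev : T.WD U →+ ℂ :=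
    { toFun := fun A => (ρ.act U A β).1 u z
      map_zero' := by rw [map_zero]; rfl
      map_add' := fun A B => by rw [map_add]; rfl }
  have e1 : ev ⟨T.dunklOpdam C hφ v, hD⟩ + ∑ p : T.Pairs,
      ev (C p • (T.funWD (T.coef (hφ p.H) v) * T.grpWD U (T.refl p))) = ev (T.vecWD U v) :=
    (T.WD U).map_add_sum_eq ev Finset.univ ⟨T.dunklOpdam C hφ v, hD⟩ (T.vecWD U v)
      (fun p => C p • (T.funWD (T.coef (hφ p.H) v) * T.grpWD U (T.refl p)))
      (sub_add_cancel (T.dFam U v) _)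
  have e2 : ev (T.vecWD U v) = _ := hρ.act_vec U v β u z
  have e3 : ∀ p : T.Pairs, ev (C p • (T.funWD (T.coef (hφ p.H) v) * T.grpWD U (T.refl p))) =
      C p * (φ p.H z v * β.1 ((T.refl p)⁻¹ * u)
        ⟨(T.refl p)⁻¹ • (z : V), T.smul_mem_regLift (T.refl p)⁻¹ z.2⟩) :=
    fun p => hρ.act_mul_grp (T.coef (hφ p.H) v) (T.refl p) (C p) β u z
  rw [e2, Finset.sum_congr rfl fun p _ => e3 p] at e1
  refine (eq_sub_of_add_eq e1).trans ?_
  simp only [mul_sub, Finset.sum_sub_distrib, mul_assoc]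
  ring

include hα

/-- The poles cancel separately for every (H, j), by `exists_local_dunklForm_mul_sub`; derivative
and connection terms are holomorphic. -/
theorem IsDunklRep.exists_holToMer_dunklOpdam {U : Opens T.Y}
    {φ : T.Hypertorus → V → V →L[ℂ] ℂ} (hφ : ∀ H, T.IsLogForm (T.pre U) H (φ H)) (v : V)
    (hD : T.dunklOpdam C hφ v ∈ T.WD U) (s : T.holF α (T.pre U)) :
    ∃ s', T.holToMer α (T.pre U) s' =
      ρ.act U ⟨T.dunklOpdam C hφ v, hD⟩ (T.holToMer α (T.pre U) s) := by
  refine exists_holToMer_eq _ fun u z₀ hz₀ => ?_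
  choose q hq hq' using fun p : T.Pairs => exists_local_dunklForm_mul_sub
    (hα.dualAct ((T.refl p)⁻¹ * u)) p (hφ p.H) (b := s.1 ((T.refl p)⁻¹ * u)) (by
      have := s.2 ((T.refl p)⁻¹ * u)
      rwa [dualAct_neg] at this) v hz₀
  have hs := (s.2 u).hol z₀ hz₀
  refine ⟨fun z => fderiv ℂ (ext (s.1 u)) z v - ξ.form 0 (u⁻¹ • v) * ext (s.1 u) z +
    ∑ p, C p * q p z, ((analyticAt_fderiv_apply hs v).fun_sub (analyticAt_const.fun_mul hs)).fun_add
    (Finset.analyticAt_fun_sum _ fun p _ => analyticAt_const.fun_mul (hq p)), ?_⟩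
  filter_upwards [eventually_all.2 hq'] with z hz hzr
  have e4 : dv v ((T.holToMer α (T.pre U) s).1 u) ⟨z, hzr⟩ = fderiv ℂ (ext (s.1 u)) z v :=
    dv_eq_of_eventuallyEq (T.isOpen_regLift _)
      (Eventually.of_forall fun y hy => (ext_apply_mem (s.1 u) hy.1).symm) v
  rw [hρ.act_dunklOpdam hφ v hD, e4, ξ.transport_eq]
  have e5 : ∀ w y (hy : y ∈ T.regLift (T.pre U)),
      (T.holToMer α (T.pre U) s).1 w ⟨y, hy⟩ = ext (s.1 w) y := fun w y hy =>
    (ext_apply_mem (s.1 w) hy.1).symm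
  simp only [e5]
  congr 1
  exact Finset.sum_congr rfl fun p _ => congrArg (C p * ·) (hz p hzr.2)

/-- The Cherednik algebra preserves holomorphic sections. -/
theorem IsDunklRep.exists_holToMer_of_mem_adjoin {U : Opens T.Y} {D : T.Fam U}
    (hD : D ∈ Algebra.adjoin ℂ (T.genH C U)) (hD' : D ∈ T.WD U) (s : T.holF α (T.pre U)) :
    ∃ s', T.holToMer α (T.pre U) s' = ρ.act U ⟨D, hD'⟩ (T.holToMer α (T.pre U) s) := by
  have hle : Algebra.adjoin ℂ (T.genH C U) ≤ T.WD U := by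
    refine le_trans (Algebra.adjoin_le fun D hD => ?_) (T.cherednik_le C U)
    refine ⟨?_, fun y hy => ⟨U, le_rfl, hy, Algebra.subset_adjoin hD⟩⟩
    obtain ⟨f, rfl⟩ | ⟨w, rfl⟩ | ⟨φ, hφ, v, rfl⟩ := hD
    · exact T.isCompat_mulFam _
    · exact T.isCompat_wFam U w
    · exact T.isCompat_dunklOpdam C hφ v
  induction hD using Algebra.adjoin_induction generalizing s with
  | mem D hD =>
    obtain ⟨f, rfl⟩ | ⟨w, rfl⟩ | ⟨φ, hφ, v, rfl⟩ := hD
    · exact ⟨_, hρ.holToMer_smul f s⟩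
    · exact hρ.exists_holToMer_grp U w s
    · exact hρ.exists_holToMer_dunklOpdam hα hφ v hD' s
  | algebraMap c =>
    refine ⟨⟨algebraMap ℂ (T.O (T.pre U)) c • s.1, (T.holF α (T.pre U)).smul_mem _ s.2⟩, ?_⟩
    have e : ρ.act U ⟨algebraMap ℂ _ c, hD'⟩ = algebraMap ℂ _ c := (ρ.act U).commutes c
    rw [e]
    rfl
  | add D E hD hE h1 h2 =>
    obtain ⟨s₁, h1⟩ := h1 (hle hD) s
    obtain ⟨s₂, h2⟩ := h2 (hle hE) s
    have e : ρ.act U ⟨D + E, hD'⟩ = ρ.act U ⟨D, hle hD⟩ + ρ.act U ⟨E, hle hE⟩ :=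
      map_add (ρ.act U) ⟨D, hle hD⟩ ⟨E, hle hE⟩
    refine ⟨s₁ + s₂, ?_⟩
    rw [e, LinearMap.add_apply, ← h1, ← h2]
    rfl
  | mul D E hD hE h1 h2 =>
    obtain ⟨s₂, h2⟩ := h2 (hle hE) s
    obtain ⟨s₁, h1⟩ := h1 (hle hD) s₂
    have e : ρ.act U ⟨D * E, hD'⟩ = ρ.act U ⟨D, hle hD⟩ * ρ.act U ⟨E, hle hE⟩ :=
      map_mul (ρ.act U) ⟨D, hle hD⟩ ⟨E, hle hE⟩
    refine ⟨s₁, ?_⟩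
    rw [e, Module.End.mul_apply, ← h2, ← h1]

/-- D lies in the generated algebra only locally, but extending a section holomorphically is a local
question, so it may be decided after restriction. -/
theorem IsDunklRep.exists_holToMer (U : Opens T.Y) (D : T.Cherednik C U)
    (s : T.holF α (T.pre U)) : ∃ s', T.holToMer α (T.pre U) s' =
      ρ.act U (T.inclWD C U D) (T.holToMer α (T.pre U) s) := by
  refine exists_holToMer_eq _ fun u z₀ hz₀ => ?_
  obtain ⟨U', hU', hz, H⟩ := D.2.2 _ hz₀
  obtain ⟨s', hs'⟩ := hρ.exists_holToMer_of_mem_adjoin hα H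
    (T.cherednik_le C U' (T.resCherednik C hU' D).2) ((T.sheafF α).res (T.pre_mono hU') s)
  have e := ρ.act_res hU' (T.inclWD C U D) (T.holToMer α (T.pre U) s)
  refine ⟨ext (s'.1 u), (s'.2 u).hol z₀ hz, ?_⟩
  filter_upwards [(T.isOpen_lift (T.pre U')).mem_nhds hz] with z hz hzr
  rw [ext_apply_mem _ hz]
  exact (congrFun (congrFun (congrArg Subtype.val (e.trans hs'.symm)) u) ⟨z, ⟨hz, hzr.2⟩⟩)

/-- Holomorphic sections embed in sections with poles, so the extension of ρ(D)s is unique, and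
every identity required of the action is inherited from ρ. -/
theorem IsDunklRep.exists_cherednikAction : ∃ σ : T.CherednikAction C (T.sheafF α),
    ∀ (U : Opens T.Y) (D : T.Cherednik C U) (s : T.holF α (T.pre U)),
      T.holToMer α (T.pre U) (σ.act U D s) =
        ρ.act U (T.inclWD C U D) (T.holToMer α (T.pre U) s) := by
  choose a ha using hρ.exists_holToMer hα
  have hinj := fun U : Opens T.Y => holToMer_injective α (T.pre U)
  have hadd : ∀ U D s t, a U D (s + t) = a U D s + a U D t := by
    intro U D s t
    refine hinj U ((ha U D (s + t)).trans ?_)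
    have e := map_add (ρ.act U (T.inclWD C U D)) (T.holToMer α (T.pre U) s)
      (T.holToMer α (T.pre U) t)
    rw [← ha, ← ha] at e
    exact e
  let act : ∀ U : Opens T.Y, T.Cherednik C U → AddMonoid.End (T.holF α (T.pre U)) := fun U D =>
    AddMonoidHom.mk' (a U D) (hadd U D)
  have hone : ∀ U, act U 1 = 1 := fun U => AddMonoidHom.ext fun s => hinj U <|
    (ha U 1 s).trans <| congrArg (fun A : Module.End ℂ (T.merF α (T.pre U)) =>
      A (T.holToMer α (T.pre U) s)) (map_one (ρ.act U))
  have hzero : ∀ U, act U 0 = 0 := fun U => AddMonoidHom.ext fun s => hinj U <|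
    (ha U 0 s).trans <| congrArg (fun A : Module.End ℂ (T.merF α (T.pre U)) =>
      A (T.holToMer α (T.pre U) s)) (map_zero (ρ.act U))
  have hact_add : ∀ U D E, act U (D + E) = act U D + act U E := by
    intro U D E
    refine AddMonoidHom.ext fun s => hinj U ((ha U (D + E) s).trans ?_)
    have e : ρ.act U (T.inclWD C U (D + E)) =
        ρ.act U (T.inclWD C U D) + ρ.act U (T.inclWD C U E) := map_add (ρ.act U) (T.inclWD C U D) (T.inclWD C U E)
    rw [e, LinearMap.add_apply, ← ha, ← ha]
    rfl
  have hact_mul : ∀ U D E, act U (D * E) = act U D * act U E := by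
    intro U D E
    refine AddMonoidHom.ext fun s => hinj U ((ha U (D * E) s).trans ?_)
    have e : ρ.act U (T.inclWD C U (D * E)) =
        ρ.act U (T.inclWD C U D) * ρ.act U (T.inclWD C U E) := map_mul (ρ.act U) (T.inclWD C U D) (T.inclWD C U E)
    rw [e, Module.End.mul_apply, ← ha, ← ha]
    rfl
  refine ⟨⟨fun U => ⟨⟨⟨act U, hone U⟩, hact_mul U⟩, hzero U, hact_add U⟩,
    fun {U U'} h D s => ?_, fun U f s => ?_⟩, ha⟩
  · refine hinj U' (Eq.trans ?_ (ha U' _ _).symm)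
    have e := ρ.act_res h (T.inclWD C U D) (T.holToMer α (T.pre U) s)
    exact (congrArg (T.resMerF α (T.pre_mono h)) (ha U D s)).trans e
  · exact hinj U ((ha U _ _).trans (hρ.holToMer_smul f s).symm)

end Cherednik

end TorusAction

/-! ### The main theorem -/

theorem corollary5p3 {V : Type*} [NormedAddCommGroup V] [NormedSpace ℂ V] [FiniteDimensional ℂ V]
    (T : TorusAction V) (C : T.Pairs → ℂ) (hC : T.IsInvariant C)
    (α : TorusAction.AntiDual V) (hα : T.HasTrivialStabilizer α) (ξ : T.FlatConnection) :
    ∃ ρ : T.MerRep α, T.IsDunklRep C α ξ ρ ∧ (∀ ρ' : T.MerRep α, T.IsDunklRep C α ξ ρ' → ρ' = ρ) ∧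
      ∃ σ : T.CherednikAction C (T.sheafF α),
        (∀ (U : TopologicalSpace.Opens T.Y) (D : T.Cherednik C U) (s : T.holF α (T.pre U)),
          T.holToMer α (T.pre U) (σ.act U D s) =
            ρ.act U (T.inclWD C U D) (T.holToMer α (T.pre U) s)) ∧
        σ.InCategoryO := by
  have hρ := TorusAction.isDunklRep_dunklRep hC hα ξ
  obtain ⟨σ, hσ⟩ := hρ.exists_cherednikAction hα
  exact ⟨_, hρ, fun ρ' hρ' => hρ'.eq hρ, σ, hσ, TorusAction.isCoherent_sheafF α⟩
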